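/- Let $x=(x_1,\dots,x_9)$ be the coordinates of $\mathbb R^9$. For $c\in\{0,1\}$ let $\Delta_c$ be the rank-two distribution on $\mathbb R^9$ spanned by $$\kappa_1^9=\tfrac{\partial}{\partial x_9},\qquad \kappa_2^9(c)=(x_9+c)\tfrac{\partial}{\partial x_8}+(x_8+1)\tfrac{\partial}{\partial x_7}+x_7\tfrac{\partial}{\partial x_6}+\tfrac{\partial}{\partial x_5}+x_6\Big(x_5\tfrac{\partial}{\partial x_4}+x_4\tfrac{\partial}{\partial x_3}+x_3\tfrac{\partial}{\partial x_2}+\tfrac{\partial}{\partial x_1}\Big).$$ **Definitions.** The *derived flag* of a distribution $\mathcal D$ is $\mathcal D^{(0)}=\mathcal D$, $\mathcal D^{(i+1)}=\mathcal D^{(i)}+[\mathcal D^{(i)},\mathcal D^{(i)}]$; its *Lie flag* is $\mathcal D_0=\mathcal D$, $\mathcal D_{i+1}=\mathcal D_i+[\mathcal D_0,\mathcal D_i]$. A *Goursat structure* in dimension $n\ge 3$ is a rank-two distribution with $\dim\mathcal D^{(i)}(p)=i+2$ for $0\le i\le n-2$ and all $p$. $\mathcal D$ is *completely nonholonomic*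 if for every $p$ some $\mathcal D_N(p)$ is the whole tangent space; the *growth vector* at $p$ is then $(\dim\mathcal D_0(p),\dots,\dim\mathcal D_{N_p}(p))$ with $N_p$ the least such $N$. A *Kumpera–Ruiz normal form* is a pair of vector fields obtained from $(\partial_{x_3},\,x_3\partial_{x_2}+\partial_{x_1})$ on $\mathbb R^3$ by successive prolongations from $\mathbb R^{m}$ to $\mathbb R^{m+1}$, each either regular, $(\kappa_1,\kappa_2)\mapsto(\partial_{x_{m+1}},\,(x_{m+1}+c)\kappa_1+\kappa_2)$ with $c\in\mathbb R$, or singular, $(\kappa_1,\kappa_2)\mapsto(\partial_{x_{m+1}},\,\kappa_1+x_{m+1}\kappa_2)$. For a Goursat structure $\mathcal D$ in dimension $n$ let $\mathcal C_i$ ($0\le i\le n-4$) be the characteristic distribution of $\mathcal D^{(i+1)}$, spanned by the vector fields $f\in\mathcal D^{(i+1)}$ with $[f,\mathcal D^{(i+1)}]\subset\mathcal D^{(i+1)}$. Put $S_0^{(i)}=\{p:\mathcal D^{(i)}(p)=\mathcal C_{i+1}(p)\}$ for $0\le i\le n-5$, $S_0^{(i)}=\emptyset$ for $i\ge n-4$,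 $S_j^{(i)}=\{p\in S_{j-1}^{(i)}:\mathcal D^{(i-j)}(p)\cap T_pS_{j-1}^{(i)}\ne\mathcal C_{i-j}(p)\}$ for $1\le j\le i$, and $S_j^{(i)}=\emptyset$ for $j>i$. The *singularity type* of $\mathcal D$ at $p$ is the word $w_{n-4}\cdots w_0$ with $w_i=a_{j+1}$ if $p\in S_j^{(i+j)}$ for some $j\ge0$, and $w_i=a_0$ otherwise. Two distributions are *locally equivalent* at $p$ and $\tilde p$ if some diffeomorphism $\varphi$ between neighbourhoods of $p$ and $\tilde p$ with $\varphi(p)=\tilde p$ carries one to the other. If a distribution is spanned near a curve by pointwise independent vector fields $f_1,\dots,f_k$ and $H(x,p,u)=\langle p,\sum_i u_if_i(x)\rangle$, then an absolutely continuous curve $x(\cdot)$ on a nondegenerate interval $I$ is an *abnormal curve* of the distribution if there are a measurable control $u$ and an absolutely continuous, nowhere zero covector $p(\cdot)$ along $x$ with $\dot x=\partial H/\partial p$, $\dot p=-\partial H/\partial x$, $\partial H/\partial u=0$ almost everywhere on $I$ (absolute continuity is understood on compact subintervals of $I$). We say that $\mathcal D$ at $p$ and $\tilde{\mathcal D}$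 at $\tilde p$ have *diffeomorphic abnormal curves of all elements of their derived flags* if some diffeomorphism $\varphi$ between neighbourhoods of $p$ and $\tilde p$ with $\varphi(p)=\tilde p$ transforms, for every $i\ge0$, the abnormal curves of $\mathcal D^{(i)}$ into those of $\tilde{\mathcal D}^{(i)}$ and vice versa. A class of distributions is *determined by the abnormal curves of derived flags* if, for members of the class, this property at $p$, $\tilde p$ always implies local equivalence at $p$, $\tilde p$. **Statement.** 1. For $c=0$ and $c=1$, the pair $(\kappa_1^9,\kappa_2^9(c))$ is a Kumpera–Ruiz normal form, $\Delta_c$ is a completely nonholonomic Goursat structure on $\mathbb R^9$, and the singularity type of $\Delta_c$ at $0$ is $a_0a_0a_1a_2a_0a_0$. 2. $\Delta_0$ and $\Delta_1$ are not locally equivalent at $0$ (with $\varphi(0)=0$). 3. $\Delta_0$ and $\Delta_1$ have the same growth vector at $0$. 4. $\Delta_0$ and $\Delta_1$, both at $0$, have diffeomorphic abnormal curves of all elements of their derived flags. 5. For every $n\ge9$, Goursat structures in dimension $n$ (already those on open subsets of $\mathbb R^n$) are not determined by the abnormal curves of their derived flags. -/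

import Mathlib

open Set MeasureTheory
open scoped ContDiff Topology

namespace Goursat

/-- The coordinate space `ℝⁿ`; the coordinate `x_k` of the literature is `x (k - 1)`. -/
abbrev Coord (n : ℕ) : Type := Fin n → ℝ

/-- Vector fields on `ℝⁿ`, through their components. -/
abbrev VField (n : ℕ) : Type := Coord n → Coord n

/-- Fields of subspaces `p ↦ D(p) ⊆ T_p ℝⁿ = ℝⁿ`. -/
abbrev PlaneField (n : ℕ) : Type := Coord n → Submodule ℝ (Coord n)

/-- `f₁, …, f_k` are smooth vector fields on `W`, pointwise linearly independent on `W`, which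
span `D` at every point of `W`. -/
def IsFrameOn {n k : ℕ} (W : Set (Coord n)) (D : PlaneField n) (f : Fin k → VField n) : Prop :=
  (∀ i, ContDiffOn ℝ ∞ (f i) W) ∧
    ∀ x ∈ W, LinearIndependent ℝ (fun i => f i x) ∧
      Submodule.span ℝ (range fun i => f i x) = D x

/-- `D` is a smooth distribution of rank `k` on the open set `U`. -/
def IsDistributionOn {n : ℕ} (U : Set (Coord n)) (k : ℕ) (D : PlaneField n) : Prop :=
  ∀ p ∈ U, ∃ W : Set (Coord n), IsOpen W ∧ p ∈ W ∧ W ⊆ U ∧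
    ∃ f : Fin k → VField n, IsFrameOn W D f

/-- The smooth vector fields on `U` that belong to `D` (values outside `U` are irrelevant). -/
def sections {n : ℕ} (U : Set (Coord n)) (D : PlaneField n) : Submodule ℝ (VField n) where
  carrier := {f | ContDiffOn ℝ ∞ f U ∧ ∀ x ∈ U, f x ∈ D x}
  add_mem' := fun hf hg =>
    ⟨hf.1.add hg.1, fun x hx => (D x).add_mem (hf.2 x hx) (hg.2 x hx)⟩
  zero_mem' := ⟨contDiffOn_const, fun x _ => (D x).zero_mem⟩
  smul_mem' := fun c _ hf =>
    ⟨contDiffOn_const.smul hf.1, fun x hx => (D x).smul_mem c (hf.2 x hx)⟩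

/-- The subspace of `T_p ℝⁿ` formed by the values at `p` of a space of vector fields. -/
def valuesAt {n : ℕ} (M : Submodule ℝ (VField n)) (p : Coord n) : Submodule ℝ (Coord n) :=
  M.map (LinearMap.proj p)

/-- The real linear span of all Lie brackets `[f, g]` with `f ∈ M`, `g ∈ N`.  When `M` and `N` are
modules over the smooth functions, adding this span to a module containing `M` and `N` gives again
a module over the smooth functions, because `h [f, g] = [f, h g] - (f h) g`. -/
def brackets {n : ℕ} (M N : Submodule ℝ (VField n)) : Submodule ℝ (VField n) :=
  Submodule.span ℝ {v | ∃ f ∈ M, ∃ g ∈ N, v = VectorField.lieBracket ℝ f g}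

/-! ### Derived flag and Goursat structures -/

/-- The derived flag `D⁽⁰⁾ = D`, `D⁽ⁱ⁺¹⁾ = D⁽ⁱ⁾ + [D⁽ⁱ⁾, D⁽ⁱ⁾]`, as modules of vector fields. -/
def derivedModule {n : ℕ} (U : Set (Coord n)) (D : PlaneField n) : ℕ → Submodule ℝ (VField n)
  | 0 => sections U D
  | i + 1 => derivedModule U D i ⊔ brackets (derivedModule U D i) (derivedModule U D i)

/-- The derived flag as fields of subspaces, `p ↦ D⁽ⁱ⁾(p)`. -/
def derivedFlag {n : ℕ} (U : Set (Coord n)) (D : PlaneField n) (i : ℕ) : PlaneField n :=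
  valuesAt (derivedModule U D i)

/-- `D` is a Goursat structure on the open set `U ⊆ ℝⁿ`: `n ≥ 3`, `D` has rank two, and
`dim D⁽ⁱ⁾(p) = i + 2` for `0 ≤ i ≤ n - 2` and all `p ∈ U`. -/
structure IsGoursat {n : ℕ} (U : Set (Coord n)) (D : PlaneField n) : Prop where
  three_le : 3 ≤ n
  isOpen : IsOpen U
  isDistribution : IsDistributionOn U 2 D
  finrank_derivedFlag : ∀ i, i + 2 ≤ n → ∀ p ∈ U,
    Module.finrank ℝ (derivedFlag U D i p) = i + 2

/-! ### Lie flag and growth vector -/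

/-- The Lie flag `D₀ = D`, `Dᵢ₊₁ = Dᵢ + [D₀, Dᵢ]`, as modules of vector fields. -/
def lieModule {n : ℕ} (U : Set (Coord n)) (D : PlaneField n) : ℕ → Submodule ℝ (VField n)
  | 0 => sections U D
  | i + 1 => lieModule U D i ⊔ brackets (sections U D) (lieModule U D i)

/-- The subspaces `Dᵢ(p)` of the Lie flag. -/
def lieFlag {n : ℕ} (U : Set (Coord n)) (D : PlaneField n) (i : ℕ) : PlaneField n :=
  valuesAt (lieModule U D i)

/-- At each point of `U` some element of the Lie flag is the whole tangent space. -/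
def IsCompletelyNonholonomic {n : ℕ} (U : Set (Coord n)) (D : PlaneField n) : Prop :=
  ∀ p ∈ U, ∃ N, lieFlag U D N p = ⊤

/-- The nonholonomy degree `N_p`: the smallest `N` with `D_N(p) = T_p ℝⁿ`. -/
noncomputable def nonholonomyDegree {n : ℕ} (U : Set (Coord n)) (D : PlaneField n)
    (p : Coord n) : ℕ :=
  sInf {N | lieFlag U D N p = ⊤}

/-- The growth vector `(dim D₀(p), …, dim D_{N_p}(p))`. -/
noncomputable def growthVector {n : ℕ} (U : Set (Coord n)) (D : PlaneField n)
    (p : Coord n) : List ℕ :=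
  (List.range (nonholonomyDegree U D p + 1)).map fun i => Module.finrank ℝ (lieFlag U D i p)

/-! ### Characteristic distributions and singularity type -/

/-- The characteristic vector fields of a module `M` of vector fields: the `f ∈ M` with
`[f, M] ⊆ M`. -/
def charFields {n : ℕ} (M : Submodule ℝ (VField n)) : Set (VField n) :=
  {f | f ∈ M ∧ ∀ g ∈ M, VectorField.lieBracket ℝ f g ∈ M}

/-- `Cᵢ`, the characteristic distribution of `D⁽ⁱ⁺¹⁾`, as a field of subspaces. -/
def charDistribution {n : ℕ} (U : Set (Coord n)) (D : PlaneField n) (i : ℕ) : PlaneField n :=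
  fun p => Submodule.span ℝ ((fun f : VField n => f p) '' charFields (derivedModule U D (i + 1)))

/-- The tangent space `T_p S`: the velocities at `p` of smooth curves in `S` through `p`. -/
def tangentVectors {n : ℕ} (S : Set (Coord n)) (p : Coord n) : Set (Coord n) :=
  {v | ∃ γ : ℝ → Coord n, ContDiffAt ℝ ∞ γ 0 ∧ γ 0 = p ∧ (∀ᶠ t in 𝓝 (0 : ℝ), γ t ∈ S) ∧
    HasDerivAt γ v 0}

/-- The canonical sets `S_j⁽ⁱ⁾`, written `canonicalSet U D i j`:
`S_0⁽ⁱ⁾ = {p | D⁽ⁱ⁾(p) = Cᵢ₊₁(p)}` for `0 ≤ i ≤ n - 5` and `S_0⁽ⁱ⁾ = ∅` for `i ≥ n - 4`;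
`S_j⁽ⁱ⁾ = {p ∈ S_{j-1}⁽ⁱ⁾ | D⁽ⁱ⁻ʲ⁾(p) ∩ T_p S_{j-1}⁽ⁱ⁾ ≠ Cᵢ₋ⱼ(p)}` for `1 ≤ j ≤ i` and
`S_j⁽ⁱ⁾ = ∅` for `j ≥ i + 1`. -/
def canonicalSet {n : ℕ} (U : Set (Coord n)) (D : PlaneField n) (i : ℕ) : ℕ → Set (Coord n)
  | 0 => {p | p ∈ U ∧ i + 5 ≤ n ∧ derivedFlag U D i p = charDistribution U D (i + 1) p}
  | j + 1 => {p | p ∈ canonicalSet U D i j ∧ j + 1 ≤ i ∧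
      (derivedFlag U D (i - (j + 1)) p : Set (Coord n)) ∩ tangentVectors (canonicalSet U D i j) p
        ≠ (charDistribution U D (i - (j + 1)) p : Set (Coord n))}

open Classical in
/-- The index of the letter `wᵢ` of the singularity type: `wᵢ = a_{j+1}` if `p ∈ S_j⁽ⁱ⁺ʲ⁾` for
some `j` (which is then unique for a Goursat structure), and `wᵢ = a₀` otherwise. -/
noncomputable def singularityLetter {n : ℕ} (U : Set (Coord n)) (D : PlaneField n) (p : Coord n)
    (i : ℕ) : ℕ :=
  if ∃ j, p ∈ canonicalSet U D (i + j) j then sInf {j | p ∈ canonicalSet U D (i + j) j} + 1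
  else 0

/-- The singularity type `w_{n-4} ⋯ w₀` of `D` at `p`; a word in the letters `a₀, a₁, …` is
written as the list of the indices of its letters. -/
noncomputable def singularityType {n : ℕ} (U : Set (Coord n)) (D : PlaneField n)
    (p : Coord n) : List ℕ :=
  ((List.range (n - 3)).map (singularityLetter U D p)).reverse

/-! ### Local diffeomorphisms and local equivalence -/

/-- `φ` is a smooth diffeomorphism from an open neighbourhood of `p` in `U` onto an open
neighbourhood of `q` in `V`, with `φ p = q`. -/
structure IsLocalDiffeo {n : ℕ} (U V : Set (Coord n)) (p q : Coord n)
    (φ : OpenPartialHomeomorph (Coord n) (Coord n)) : Prop where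
  mem_source : p ∈ φ.source
  map_point : φ p = q
  source_subset : φ.source ⊆ U
  target_subset : φ.target ⊆ V
  smooth : ContDiffOn ℝ ∞ φ φ.source
  smooth_symm : ContDiffOn ℝ ∞ φ.symm φ.target

/-- `D` on `U` at `p` and `E` on `V` at `q` are locally equivalent: some local diffeomorphism `φ`
with `φ p = q` satisfies `φ_* D = E`. -/
def LocallyEquivalent {n : ℕ} (U : Set (Coord n)) (D : PlaneField n) (p : Coord n)
    (V : Set (Coord n)) (E : PlaneField n) (q : Coord n) : Prop :=
  ∃ φ : OpenPartialHomeomorph (Coord n) (Coord n), IsLocalDiffeo U V p q φ ∧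
    ∀ x ∈ φ.source, (D x).map (fderiv ℝ φ x).toLinearMap = E (φ x)

/-! ### Abnormal curves -/

/-- The Hamiltonian `H(x, p, u) = ⟨p, ∑ fᵢ(x) uᵢ⟩` of the control system `x' = ∑ fᵢ(x) uᵢ`. -/
def hamiltonian {n k : ℕ} (f : Fin k → VField n) (x p : Coord n) (u : Fin k → ℝ) : ℝ :=
  ∑ a : Fin n, p a * (∑ i : Fin k, u i • f i x) a

/-- Absolute continuity on every compact subinterval of the interval `I`. -/
def IsAbsCont {n : ℕ} (I : Set ℝ) (x : ℝ → Coord n) : Prop :=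
  ∀ a ∈ I, ∀ b ∈ I, AbsolutelyContinuousOnInterval x a b

/-- The curve `x : I → W` is an abnormal curve of the control system given by `f₁, …, f_k` on `W`:
it is absolutely continuous and, for a measurable control `u` and an absolutely continuous covector
`p` that vanishes nowhere on `I`, almost everywhere on `I`
`x' = ∂H/∂p`, `p' = -∂H/∂x` and `∂H/∂u = 0`. -/
def IsAbnormalForSystem {n k : ℕ} (f : Fin k → VField n) (I : Set ℝ) (x : ℝ → Coord n) : Prop :=
  IsAbsCont I x ∧
    ∃ (u : ℝ → Fin k → ℝ) (p : ℝ → Coord n), Measurable u ∧ IsAbsCont I p ∧ (∀ t ∈ I, p t ≠ 0) ∧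
      ∀ᵐ t ∂(volume.restrict I),
        HasDerivAt x
          (fun a => fderiv ℝ (fun q => hamiltonian f (x t) q (u t)) (p t) (Pi.single a 1)) t ∧
        HasDerivAt p
          (fun a => -fderiv ℝ (fun y => hamiltonian f y (p t) (u t)) (x t) (Pi.single a 1)) t ∧
        fderiv ℝ (fun v => hamiltonian f (x t) (p t) v) (u t) = 0

/-- The curve `x : I → U` is an abnormal curve of the distribution `D` on `U`: it is one of the
control system given by a frame of `D` near the curve.  (Whether it is one does not depend on the
frame.) -/
def IsAbnormalCurve {n : ℕ} (U : Set (Coord n)) (D : PlaneField n) (I : Set ℝ)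
    (x : ℝ → Coord n) : Prop :=
  ∃ (W : Set (Coord n)) (k : ℕ) (f : Fin k → VField n), IsOpen W ∧ W ⊆ U ∧ IsFrameOn W D f ∧
    (∀ t ∈ I, x t ∈ W) ∧ IsAbnormalForSystem f I x

/-- Some local diffeomorphism `φ` with `φ p = q` transforms, for every `i ≥ 0`, the abnormal curves
of `D⁽ⁱ⁾` into those of `E⁽ⁱ⁾`, and the other way around: a curve `x` in the domain of `φ`, defined
on a nondegenerate interval `I`, is abnormal for `D⁽ⁱ⁾` if and only if `φ ∘ x` is abnormal for
`E⁽ⁱ⁾`. -/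
def HaveDiffeomorphicAbnormals {n : ℕ} (U : Set (Coord n)) (D : PlaneField n) (p : Coord n)
    (V : Set (Coord n)) (E : PlaneField n) (q : Coord n) : Prop :=
  ∃ φ : OpenPartialHomeomorph (Coord n) (Coord n), IsLocalDiffeo U V p q φ ∧
    ∀ (i : ℕ) (I : Set ℝ) (x : ℝ → Coord n), I.OrdConnected → I.Nontrivial →
      (∀ t ∈ I, x t ∈ φ.source) →
      (IsAbnormalCurve U (derivedFlag U D i) I x ↔
        IsAbnormalCurve V (derivedFlag V E i) I (φ ∘ x))

/-- Distributions of a class `Q` of distributions on open subsets of `ℝⁿ` are (weakly) determined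
by the abnormal curves of their derived flags: whenever a local diffeomorphism transforms the
abnormal curves of `D⁽ⁱ⁾` into those of `E⁽ⁱ⁾` for all `i`, the distributions `D` and `E` are
locally equivalent at the corresponding points. -/
def DeterminedByAbnormalsOfDerivedFlag {n : ℕ} (Q : Set (Coord n) → PlaneField n → Prop) : Prop :=
  ∀ (U V : Set (Coord n)) (D E : PlaneField n), Q U D → Q V E → ∀ p ∈ U, ∀ q ∈ V,
    HaveDiffeomorphicAbnormals U D p V E q → LocallyEquivalent U D p V E q

/-! ### Kumpera–Ruiz normal forms -/

/-- The lift of a vector field from `ℝⁿ` to `ℝⁿ⁺¹` by translation along the last coordinate. -/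
def lift {n : ℕ} (f : VField n) : VField (n + 1) :=
  fun x => Fin.snoc (f (Fin.init x)) (0 : ℝ)

/-- The vector field `∂/∂x_{n+1}` on `ℝⁿ⁺¹`. -/
def lastField (n : ℕ) : VField (n + 1) := fun _ => Pi.single (Fin.last n) 1

/-- Kumpera–Ruiz normal forms on `ℝⁿ`: the pairs of vector fields obtained from
`(∂/∂x₃, x₃ ∂/∂x₂ + ∂/∂x₁)` on `ℝ³` by successive regular prolongations `R_c` and singular
prolongations `S`. -/
inductive IsKumperaRuiz : (n : ℕ) → VField n → VField n → Prop
  | base : IsKumperaRuiz 3 (fun _ => ![0, 0, 1]) (fun x => ![1, x 2, 0])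
  | regular {n : ℕ} {f g : VField n} (c : ℝ) : IsKumperaRuiz n f g →
      IsKumperaRuiz (n + 1) (lastField n) (fun x => (x (Fin.last n) + c) • lift f x + lift g x)
  | singular {n : ℕ} {f g : VField n} : IsKumperaRuiz n f g →
      IsKumperaRuiz (n + 1) (lastField n) (fun x => lift f x + x (Fin.last n) • lift g x)

/-- The field of subspaces spanned by two vector fields. -/
def spannedBy {n : ℕ} (f g : VField n) : PlaneField n := fun x => Submodule.span ℝ {f x, g x}

/-- `κ₁⁹ = ∂/∂x₉`. -/
def kappa9Fst : VField 9 := fun _ => ![0, 0, 0, 0, 0, 0, 0, 0, 1]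

/-- `κ₂⁹(c) = (x₉ + c) ∂₈ + (x₈ + 1) ∂₇ + x₇ ∂₆ + ∂₅ + x₆ (x₅ ∂₄ + x₄ ∂₃ + x₃ ∂₂ + ∂₁)`, where
`x_k` is `x (k - 1)`. -/
def kappa9Snd (c : ℝ) : VField 9 := fun x =>
  ![x 5, x 5 * x 2, x 5 * x 3, x 5 * x 4, 1, x 6, x 7 + 1, x 8 + c, 0]

/-- The distribution on `ℝ⁹` spanned by `(κ₁⁹, κ₂⁹(c))`. -/
def dist9 (c : ℝ) : PlaneField 9 := spannedBy kappa9Fst (kappa9Snd c)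

end Goursat

namespace Goursat

/-! ### Coordinates indexed by natural numbers -/

/-! Coordinates are counted from 0, and all dimensions n = m + 9 are treated together: `tower m c`
is the field `kappa9Snd c` with m more regular prolongations made before the singular one. Write X =
∂_{m+8}, Y = `tower m c`, Z = `contactField m`. Then [∂_k, Y] = ∂_{k-1} for k = m+8, m+7, m+6, next
[∂_{m+5}, Y] = Z, and from there on [∂_k, Z] = ∂_{k-1}. So each step of the derived flag adds one
explicit field, and D⁽ⁱ⁾ is a graph over one root component (m+4 for i ≤ 3, then 0). These graph
equations are `flag`; ranks, characteristic distributions and canonical sets are read off from them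
(`derivedModule_flag`, `charDistribution_flag`).

Abnormal curves. The parameter c occurs only in the equation for dx_{m+7}, which is lost after one
derivation, so D⁽ⁱ⁾ does not depend on c for i ≥ 1. For D itself, where x_{m+7} > -1, the control v
of Y vanishes along every abnormal extremal (`control_ae_eq_zero`): a chain of functions g satisfies
v g = 0 and g' = ± v h, so g² is constant, and either v = 0 or g ≡ 0 and h is next. The abnormal
curves are thus exactly the curves tangent to X, for every c, and the identity map transforms one
family into the other.

Growth vector. At the origin the Lie flag is cut out by coframe forms with explicit weights: an
upper bound comes from orders of vanishing, a lower bound from explicit brackets. Only one form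
involves c at 0, and a linear shear removes it.

Nonequivalence. An equivalence φ from c = 0 to c = 1 preserves the characteristic distributions.
Hence its components of index at most m+3 depend only on x_0, …, x_{m+3}, and component 0 does not
depend on x_{m+3} either. Along the integral curve of Y (c = 0) through 0, these coordinates are
t³/6, t⁴/8 at index m+3, and terms of order t⁷ or higher. So φ_0 has no t⁴ term along the curve and
φ_{m+3} has no t⁵ term. The image is also tangent to the second structure, with some speed f₀ + f₁ t
+ ⋯, which gives the two coefficients in terms of f₀ and f₁. Their vanishing requires f₁ = -f₀²/6
and f₁ = -2 f₀²/15, whence f₀ = 0, which is impossible. -/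

/-- The `k`-th coordinate on `ℝⁿ`, which is zero for `k ≥ n`. -/
noncomputable def coordL {n : ℕ} (k : ℕ) : Coord n →L[ℝ] ℝ :=
  if h : k < n then ContinuousLinearMap.proj ⟨k, h⟩ else 0

lemma coordL_apply {n k : ℕ} (h : k < n) (x : Coord n) : coordL k x = x ⟨k, h⟩ := by
  simp [coordL, h]

lemma coordL_of_le {n k : ℕ} (h : n ≤ k) (x : Coord n) : coordL k x = 0 := by
  simp [coordL, not_lt.mpr h]

lemma apply_eq_coordL {n : ℕ} (j : Fin n) (x : Coord n) : x j = coordL j.val x := by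
  simp [coordL]

lemma ext_coordL {n : ℕ} {x y : Coord n} (h : ∀ j < n, coordL j x = coordL j y) : x = y := by
  funext j
  simpa [apply_eq_coordL] using h j.val j.isLt

/-- The constant vector field `∂/∂x_k` (zero for `k ≥ n`). -/
def unitVec {n : ℕ} (k : ℕ) : Coord n := fun j => if j.val = k then 1 else 0

lemma coordL_unitVec {n : ℕ} {j : ℕ} (k : ℕ) (hj : j < n) :
    coordL j (unitVec k : Coord n) = if j = k then 1 else 0 := by
  simp [coordL, hj, unitVec]

lemma coordL_unitVec_ne {n : ℕ} {j k : ℕ} (h : j ≠ k) :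
    coordL j (unitVec k : Coord n) = 0 := by
  by_cases hj : j < n
  · simp [coordL_unitVec k hj, h]
  · exact coordL_of_le (not_lt.mp hj) _

lemma coordL_comp_bracket {n : ℕ} (j : ℕ) {v w : VField n} {x : Coord n}
    (hv : DifferentiableAt ℝ v x) (hw : DifferentiableAt ℝ w x) :
    coordL j (VectorField.lieBracket ℝ v w x) =
      fderiv ℝ (fun y => coordL j (w y)) x (v x) - fderiv ℝ (fun y => coordL j (v y)) x (w x) := by
  have h (u : VField n) (hu : DifferentiableAt ℝ u x) (a : Coord n) :
      fderiv ℝ (fun y => coordL j (u y)) x a = coordL j (fderiv ℝ u x a) := by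
    have := (coordL (n := n) j).hasFDerivAt.comp x hu.hasFDerivAt
    exact congrArg (fun T => T a) this.fderiv
  rw [VectorField.lieBracket, map_sub, h w hw, h v hv]

/-- The bracket of two fields whose `j`-th component is `W` times their `r`-th component. -/
lemma coordL_bracket_graph {n : ℕ} {j r : ℕ} {v w : VField n} {W : Coord n → ℝ} {x : Coord n}
    (hv : DifferentiableAt ℝ v x) (hw : DifferentiableAt ℝ w x) (hW : DifferentiableAt ℝ W x)
    (hvj : ∀ᶠ y in 𝓝 x, coordL j (v y) = coordL r (v y) * W y)
    (hwj : ∀ᶠ y in 𝓝 x, coordL j (w y) = coordL r (w y) * W y) :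
    coordL j (VectorField.lieBracket ℝ v w x) =
      coordL r (VectorField.lieBracket ℝ v w x) * W x +
        (coordL r (w x) * fderiv ℝ W x (v x) - coordL r (v x) * fderiv ℝ W x (w x)) := by
  have hc (u : VField n) (hu : DifferentiableAt ℝ u x) :
      DifferentiableAt ℝ (fun y => coordL r (u y)) x := (coordL r).differentiableAt.comp x hu
  rw [coordL_comp_bracket j hv hw, coordL_comp_bracket r hv hw,
    Filter.EventuallyEq.fderiv_eq hvj, Filter.EventuallyEq.fderiv_eq hwj,
    fderiv_fun_mul (hc v hv) hW, fderiv_fun_mul (hc w hw) hW]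
  simp
  ring

/-! ### The family of structures -/

/-- The components of `κ₂` on `ℝ^(m+9)`; for `m = 0` it is the field `kappa9Snd c`. -/
noncomputable def towerComp (m : ℕ) (c : ℝ) (j : ℕ) (x : Coord (m + 9)) : ℝ :=
  if j = 0 then coordL (m + 5) x
  else if j ≤ m + 3 then coordL (m + 5) x * coordL (j + 1) x
  else if j = m + 4 then 1
  else if j = m + 6 then coordL (j + 1) x + 1
  else if j = m + 7 then coordL (j + 1) x + c
  else coordL (j + 1) x

/-- The components of the field `∂₀ + x₂ ∂₁ + ⋯ + x_{m+4} ∂_{m+3}` on `ℝ^(m+9)`. -/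
noncomputable def contactComp (m : ℕ) (j : ℕ) (x : Coord (m + 9)) : ℝ :=
  if j = 0 then 1 else if j ≤ m + 3 then coordL (j + 1) x else 0

/-- The vector field `κ₂` on `ℝ^(m+9)`. -/
noncomputable def tower (m : ℕ) (c : ℝ) : VField (m + 9) := fun x j => towerComp m c j x

/-- The vector field `∂₀ + x₂ ∂₁ + ⋯ + x_{m+4} ∂_{m+3}` on `ℝ^(m+9)`. -/
noncomputable def contactField (m : ℕ) : VField (m + 9) := fun x j => contactComp m j x

lemma coordL_tower {m : ℕ} (c : ℝ) (j : ℕ) (x : Coord (m + 9)) :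
    coordL j (tower m c x) = towerComp m c j x := by
  by_cases hj : j < m + 9
  · rw [coordL_apply hj]; rfl
  · rw [coordL_of_le (by omega)]
    have h1 : ¬ j = 0 := by omega
    have h2 : ¬ j ≤ m + 3 := by omega
    have h3 : ¬ j = m + 4 := by omega
    have h4 : ¬ j = m + 6 := by omega
    have h5 : ¬ j = m + 7 := by omega
    simp [towerComp, h1, h2, h3, h4, h5, coordL_of_le (show m + 9 ≤ j + 1 by omega)]

lemma coordL_contactField {m : ℕ} (j : ℕ) (x : Coord (m + 9)) :
    coordL j (contactField m x) = contactComp m j x := by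
  by_cases hj : j < m + 9
  · rw [coordL_apply hj]; rfl
  · rw [coordL_of_le (by omega)]
    have h1 : ¬ j = 0 := by omega
    have h2 : ¬ j ≤ m + 3 := by omega
    simp [contactComp, h1, h2]

lemma contDiff_towerComp (m : ℕ) (c : ℝ) (j : ℕ) : ContDiff ℝ ∞ (towerComp m c j) := by
  unfold towerComp
  split_ifs <;> fun_prop

lemma contDiff_contactComp (m : ℕ) (j : ℕ) : ContDiff ℝ ∞ (contactComp m j) := by
  unfold contactComp
  split_ifs <;> fun_prop

lemma contDiff_tower (m : ℕ) (c : ℝ) : ContDiff ℝ ∞ (tower m c) :=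
  contDiff_pi.2 fun j => contDiff_towerComp m c j

lemma contDiff_contactField (m : ℕ) : ContDiff ℝ ∞ (contactField m) :=
  contDiff_pi.2 fun j => contDiff_contactComp m j

/-- The index of the component along which the flag is a graph. -/
def flagRoot (m i : ℕ) : ℕ := if i ≤ 3 then m + 4 else 0

/-- The coefficients of the graph equations of the flag. -/
noncomputable def flagCoeff (m : ℕ) (c : ℝ) (i j : ℕ) : Coord (m + 9) → ℝ :=
  if i ≤ 3 then towerComp m c j else contactComp m j

/-- The vector field transversal to the coordinate fields in the flag. -/
noncomputable def flagField (m : ℕ) (c : ℝ) (i : ℕ) : VField (m + 9) :=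
  if i ≤ 3 then tower m c else contactField m

/-- The derived flag of the structure spanned by `∂_{m+8}` and `tower m c`, in equations. -/
noncomputable def flag (m : ℕ) (c : ℝ) (i : ℕ) : PlaneField (m + 9) := fun x =>
  { carrier := {v | ∀ j, j + i ≤ m + 7 →
      coordL j v = coordL (flagRoot m i) v * flagCoeff m c i j x}
    add_mem' := fun ha hb j hj => by rw [map_add, map_add, ha j hj, hb j hj]; ring
    zero_mem' := fun j _ => by simp
    smul_mem' := fun r v hv j hj => by
      rw [map_smul, map_smul, hv j hj]; simp only [smul_eq_mul]; ring }

lemma mem_flag {m : ℕ} {c : ℝ} {i : ℕ} {x v : Coord (m + 9)} :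
    v ∈ flag m c i x ↔ ∀ j, j + i ≤ m + 7 →
      coordL j v = coordL (flagRoot m i) v * flagCoeff m c i j x := Iff.rfl

/-- The span of the coordinate fields `∂_k` with `k ≥ m + 8 - i`. -/
noncomputable def charFlag (m : ℕ) (i : ℕ) : Submodule ℝ (Coord (m + 9)) where
  carrier := {v | ∀ j, j + i ≤ m + 7 → coordL j v = 0}
  add_mem' := fun ha hb j hj => by rw [map_add, ha j hj, hb j hj, add_zero]
  zero_mem' := fun j _ => by simp
  smul_mem' := fun r v hv j hj => by rw [map_smul, hv j hj, smul_zero]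

lemma contDiff_flagCoeff (m : ℕ) (c : ℝ) (i j : ℕ) : ContDiff ℝ ∞ (flagCoeff m c i j) := by
  unfold flagCoeff
  split_ifs
  exacts [contDiff_towerComp m c j, contDiff_contactComp m j]

lemma contDiff_flagField (m : ℕ) (c : ℝ) (i : ℕ) : ContDiff ℝ ∞ (flagField m c i) := by
  unfold flagField
  split_ifs
  exacts [contDiff_tower m c, contDiff_contactField m]

lemma coordL_flagField {m : ℕ} (c : ℝ) (i j : ℕ) (x : Coord (m + 9)) :
    coordL j (flagField m c i x) = flagCoeff m c i j x := by
  unfold flagField flagCoeff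
  split_ifs
  exacts [coordL_tower c j x, coordL_contactField j x]

lemma flagCoeff_flagRoot (m : ℕ) (c : ℝ) (i : ℕ) (x : Coord (m + 9)) :
    flagCoeff m c i (flagRoot m i) x = 1 := by
  unfold flagCoeff flagRoot
  split_ifs <;> simp [towerComp, contactComp]

lemma flagField_mem (m : ℕ) (c : ℝ) (i : ℕ) (x : Coord (m + 9)) :
    flagField m c i x ∈ flag m c i x := fun j _ => by
  rw [coordL_flagField, coordL_flagField, flagCoeff_flagRoot, one_mul]

lemma charFlag_le_flag {m : ℕ} (c : ℝ) {i k : ℕ} (hk : k ≤ i) (h : flagRoot m i + k ≤ m + 7)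
    (x : Coord (m + 9)) : charFlag m k ≤ flag m c i x := fun v hv j hj => by
  rw [hv j (by omega), hv _ h, zero_mul]

lemma unitVec_mem_flag {m : ℕ} (c : ℝ) {i k : ℕ} (hk : m + 8 ≤ k + i) (hr : k ≠ flagRoot m i)
    (x : Coord (m + 9)) : unitVec k ∈ flag m c i x := fun j hj => by
  rw [coordL_unitVec_ne (by omega), coordL_unitVec_ne hr.symm, zero_mul]

lemma unitVec_mem_charFlag {m : ℕ} {i k : ℕ} (hk : m + 8 ≤ k + i) :
    (unitVec k : Coord (m + 9)) ∈ charFlag m i := fun j hj =>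
  coordL_unitVec_ne (by omega)

/-! ### Brackets of fields in the flag -/

lemma fderiv_coordL {n : ℕ} (k : ℕ) (x a : Coord n) :
    fderiv ℝ (fun y => coordL k y) x a = coordL k a := by
  exact congrArg (fun T => T a) (coordL (n := n) k).hasFDerivAt.fderiv

lemma fderiv_towerComp_zero {m : ℕ} (c : ℝ) (x a : Coord (m + 9)) :
    fderiv ℝ (towerComp m c 0) x a = coordL (m + 5) a := by
  have : towerComp m c 0 = fun y => coordL (m + 5) y := by funext y; simp [towerComp]
  rw [this, fderiv_coordL]

lemma fderiv_towerComp_low {m j : ℕ} (c : ℝ) (h0 : j ≠ 0) (hj : j ≤ m + 3)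
    (x a : Coord (m + 9)) :
    fderiv ℝ (towerComp m c j) x a =
      coordL (m + 5) x * coordL (j + 1) a + coordL (m + 5) a * coordL (j + 1) x := by
  have : towerComp m c j = fun y => coordL (m + 5) y * coordL (j + 1) y := by
    funext y; simp [towerComp, h0, hj]
  rw [this, fderiv_fun_mul (by fun_prop) (by fun_prop)]
  simp
  ring

lemma fderiv_towerComp_mid {m : ℕ} (c : ℝ) (x a : Coord (m + 9)) :
    fderiv ℝ (towerComp m c (m + 4)) x a = 0 := by
  have : towerComp m c (m + 4) = fun _ => 1 := by
    funext y; simp [towerComp]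
  rw [this]; simp

lemma fderiv_towerComp_high {m j : ℕ} (c : ℝ) (hj : m + 5 ≤ j) (x a : Coord (m + 9)) :
    fderiv ℝ (towerComp m c j) x a = coordL (j + 1) a := by
  have h : ∃ d : ℝ, towerComp m c j = fun y => coordL (j + 1) y + d := by
    by_cases h6 : j = m + 6
    · exact ⟨1, by funext y; simp [towerComp, h6]⟩
    · by_cases h7 : j = m + 7
      · exact ⟨c, by funext y; simp [towerComp, h7]⟩
      · refine ⟨0, ?_⟩
        funext y
        simp [towerComp, h6, h7, show ¬ j = 0 by omega, show ¬ j ≤ m + 3 by omega,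
          show ¬ j = m + 4 by omega]
  obtain ⟨d, hd⟩ := h
  rw [hd, fderiv_add_const, fderiv_coordL]

lemma fderiv_contactComp_zero {m : ℕ} (x a : Coord (m + 9)) :
    fderiv ℝ (contactComp m 0) x a = 0 := by
  have : contactComp m 0 = fun _ => 1 := by funext y; simp [contactComp]
  rw [this]; simp

lemma fderiv_contactComp {m j : ℕ} (h0 : j ≠ 0) (hj : j ≤ m + 3) (x a : Coord (m + 9)) :
    fderiv ℝ (contactComp m j) x a = coordL (j + 1) a := by
  have : contactComp m j = fun y => coordL (j + 1) y := by funext y; simp [contactComp, h0, hj]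
  rw [this, fderiv_coordL]

/-- The structure functions of the flag: the defect of `[v, w]` in the `j`-th equation. -/
lemma coordL_bracket_flag {m : ℕ} {c : ℝ} {i j : ℕ} (hj : j + i ≤ m + 7) {v w : VField (m + 9)}
    {x : Coord (m + 9)} (hv : DifferentiableAt ℝ v x) (hw : DifferentiableAt ℝ w x)
    (hvf : ∀ᶠ y in 𝓝 x, v y ∈ flag m c i y) (hwf : ∀ᶠ y in 𝓝 x, w y ∈ flag m c i y) :
    coordL j (VectorField.lieBracket ℝ v w x) =
      coordL (flagRoot m i) (VectorField.lieBracket ℝ v w x) * flagCoeff m c i j x +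
        (coordL (flagRoot m i) (w x) * fderiv ℝ (flagCoeff m c i j) x (v x) -
          coordL (flagRoot m i) (v x) * fderiv ℝ (flagCoeff m c i j) x (w x)) :=
  coordL_bracket_graph hv hw ((contDiff_flagCoeff m c i j).differentiable (by simp) x)
    (hvf.mono fun y hy => hy j hj) (hwf.mono fun y hy => hy j hj)

/-- Only the change of root at `i = 3` needs an argument: there v_0 = v_{m+4} x_{m+5}, so v_j =
v_{m+4} x_{m+5} x_{j+1} is v_0 x_{j+1}. No division by x_{m+5} occurs, which is why the inclusion
survives on the singular locus. -/
lemma flag_le_flag_succ (m : ℕ) (c : ℝ) (i : ℕ) (x : Coord (m + 9)) :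
    flag m c i x ≤ flag m c (i + 1) x := by
  intro v hv j hj
  by_cases h3 : i = 3
  · subst h3
    have h0 := hv 0 (by omega)
    have hj' := hv j (by omega)
    simp only [flagRoot, flagCoeff, le_refl, if_true, if_neg (show ¬ 3 + 1 ≤ 3 by omega)]
      at h0 hj' ⊢
    rw [h0, hj']
    by_cases hj0 : j = 0
    · simp [towerComp, contactComp, hj0]
    · simp [towerComp, contactComp, hj0, show j ≤ m + 3 by omega]; ring
  · have : (i + 1 ≤ 3) = (i ≤ 3) := by simp; omega
    have := hv j (by omega)
    simp_all only [flagRoot, flagCoeff]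

/-- The last equation of the `i`-th flag has the coordinate m+8-i plus a constant as its
coefficient, so it detects the newest coordinate direction. At `i = 3` the last coefficient is the
constant 1, and equation 0 plays this role instead. -/
lemma fderiv_flagCoeff_high {m : ℕ} (c : ℝ) {i j : ℕ} (hj : j + i = m + 7) (hi : i ≠ 3)
    (hi' : i ≤ m + 6) (x a : Coord (m + 9)) :
    fderiv ℝ (flagCoeff m c i j) x a = coordL (j + 1) a := by
  unfold flagCoeff
  split_ifs with h
  · exact fderiv_towerComp_high c (by omega) x a
  · exact fderiv_contactComp (by omega) (by omega) x a

/-- The derivative of the coefficients of the flag along a vector of the flag. -/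
lemma fderiv_flagCoeff_of_mem {m : ℕ} {c : ℝ} {i j : ℕ} (hj : j + (i + 1) ≤ m + 7) (hi : i ≠ 3)
    (x : Coord (m + 9)) : ∃ s : ℝ, ∀ a ∈ flag m c i x,
    fderiv ℝ (flagCoeff m c i j) x a = coordL (flagRoot m i) a * s := by
  by_cases h : i ≤ 3
  · have hc (k : ℕ) : flagCoeff m c i k = towerComp m c k := by simp [flagCoeff, h]
    rw [hc]
    by_cases h0 : j = 0
    · refine ⟨flagCoeff m c i (m + 5) x, fun a ha => ?_⟩
      rw [h0, fderiv_towerComp_zero, ha (m + 5) (by omega)]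
    · by_cases h3 : j ≤ m + 3
      · refine ⟨coordL (m + 5) x * flagCoeff m c i (j + 1) x
          + flagCoeff m c i (m + 5) x * coordL (j + 1) x, fun a ha => ?_⟩
        rw [fderiv_towerComp_low c h0 h3, ha (m + 5) (by omega), ha (j + 1) (by omega)]
        ring
      · by_cases h4 : j = m + 4
        · exact ⟨0, fun a _ => by rw [h4, fderiv_towerComp_mid, mul_zero]⟩
        · exact ⟨flagCoeff m c i (j + 1) x, fun a ha => by
            rw [fderiv_towerComp_high c (by omega), ha (j + 1) (by omega)]⟩
  · have hc (k : ℕ) : flagCoeff m c i k = contactComp m k := by simp [flagCoeff, h]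
    rw [hc]
    by_cases h0 : j = 0
    · exact ⟨0, fun a _ => by rw [h0, fderiv_contactComp_zero, mul_zero]⟩
    · exact ⟨flagCoeff m c i (j + 1) x, fun a ha => by
        rw [fderiv_contactComp h0 (by omega), ha (j + 1) (by omega)]⟩

/-- Brackets of fields in a member of the flag belong to the next one. -/
lemma bracket_mem_flag_succ {m : ℕ} {c : ℝ} {i : ℕ} {v w : VField (m + 9)}
    {x : Coord (m + 9)} (hv : DifferentiableAt ℝ v x) (hw : DifferentiableAt ℝ w x)
    (hvf : ∀ᶠ y in 𝓝 x, v y ∈ flag m c i y) (hwf : ∀ᶠ y in 𝓝 x, w y ∈ flag m c i y) :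
    VectorField.lieBracket ℝ v w x ∈ flag m c (i + 1) x := by
  have hvx := hvf.self_of_nhds
  have hwx := hwf.self_of_nhds
  intro j hj
  by_cases h3 : i = 3
  · subst h3
    -- At the change of root the bracket is tested against the equations of the fourth flag, which
    -- already hold on the third. The defect w_0 v_{j+1} - v_0 w_{j+1} vanishes because both
    -- components are multiples of component m+4 with the same coefficients for v and w.
    rw [coordL_bracket_flag (i := 4) (c := c) hj hv hw
      (hvf.mono fun y hy => flag_le_flag_succ m c 3 y hy)
      (hwf.mono fun y hy => flag_le_flag_succ m c 3 y hy)]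
    have hc : flagCoeff m c 4 j = contactComp m j := by simp [flagCoeff]
    rw [hc, add_eq_left]
    by_cases h0 : j = 0
    · simp [h0, fderiv_contactComp_zero]
    · rw [fderiv_contactComp h0 (by omega), fderiv_contactComp h0 (by omega),
        hvx (j + 1) (by omega), hwx (j + 1) (by omega)]
      have h1 := hvx 0 (by omega)
      have h2 := hwx 0 (by omega)
      simp only [flagRoot, if_neg (show ¬ 4 ≤ 3 by omega)] at h1 h2 ⊢
      rw [h1, h2]
      ring
  · have hr : flagRoot m (i + 1) = flagRoot m i := by
      have : (i + 1 ≤ 3) = (i ≤ 3) := by simp; omega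
      simp only [flagRoot, this]
    have hc : flagCoeff m c (i + 1) j = flagCoeff m c i j := by
      have : (i + 1 ≤ 3) = (i ≤ 3) := by simp; omega
      simp only [flagCoeff, this]
    obtain ⟨s, hs⟩ := fderiv_flagCoeff_of_mem (c := c) hj h3 x
    rw [coordL_bracket_flag (i := i) (c := c) (by omega) hv hw hvf hwf, hr, hc, hs _ hvx,
      hs _ hwx]
    ring

/-- A field which generates the next member of the flag. -/
noncomputable def newField (m i : ℕ) : VField (m + 9) :=
  if i = 3 then contactField m else fun _ => unitVec (m + 7 - i)

/-- The coefficient of `newField` in a vector of the next member of the flag. -/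
noncomputable def newCoeff (m : ℕ) (c : ℝ) (i : ℕ) (x v : Coord (m + 9)) : ℝ :=
  if i = 3 then coordL 0 v - coordL (m + 4) v * coordL (m + 5) x
  else coordL (m + 7 - i) v - coordL (flagRoot m i) v * flagCoeff m c i (m + 7 - i) x

/-- The complement of one flag member in the next is a line with an explicit smooth coefficient, so
the splitting applies to vector fields and not only to vectors. -/
lemma sub_newField_mem_flag {m : ℕ} {c : ℝ} {i : ℕ} (hi : i ≤ m + 6) {x v : Coord (m + 9)}
    (hv : v ∈ flag m c (i + 1) x) : v - newCoeff m c i x v • newField m i x ∈ flag m c i x := by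
  intro j hj
  rw [map_sub, map_sub, map_smul, map_smul, smul_eq_mul, smul_eq_mul]
  by_cases h3 : i = 3
  · subst h3
    simp only [newCoeff, newField, flagRoot, flagCoeff, le_refl, if_true, coordL_contactField]
    have h4 : contactComp m (m + 4) x = 0 := by simp [contactComp]
    rw [h4, mul_zero, sub_zero]
    by_cases h : j = m + 4
    · subst h
      rw [h4]; simp [towerComp]
    · have := hv j (by omega)
      simp only [flagRoot, flagCoeff, if_neg (show ¬ 3 + 1 ≤ 3 by omega)] at this
      rw [this]
      by_cases hj0 : j = 0
      · simp [towerComp, contactComp, hj0]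
      · simp [towerComp, contactComp, hj0, show j ≤ m + 3 by omega]; ring
  · have h3' : (i + 1 ≤ 3) = (i ≤ 3) := by simp; omega
    have hr : flagRoot m (i + 1) = flagRoot m i := by simp only [flagRoot, h3']
    have hc : flagCoeff m c (i + 1) j = flagCoeff m c i j := by simp only [flagCoeff, h3']
    have hne : flagRoot m i ≠ m + 7 - i := by unfold flagRoot; split_ifs <;> omega
    simp only [newCoeff, newField, if_neg h3]
    rw [coordL_unitVec_ne hne, mul_zero, sub_zero]
    by_cases h : j = m + 7 - i
    · rw [← h, coordL_unitVec _ (by omega)]; simp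
    · rw [coordL_unitVec_ne h, mul_zero, sub_zero, hv j (by omega), hr, hc]

lemma newField_notMem_flag {m : ℕ} (c : ℝ) {i : ℕ} (hi : i ≤ m + 6) (x : Coord (m + 9)) :
    newField m i x ∉ flag m c i x := by
  intro h
  by_cases h3 : i = 3
  · subst h3
    have := h 0 (by omega)
    simp [newField, flagRoot, coordL_contactField, contactComp] at this
  · have hne : flagRoot m i ≠ m + 7 - i := by unfold flagRoot; split_ifs <;> omega
    have := h (m + 7 - i) (by omega)
    simp only [newField, if_neg h3] at this
    rw [coordL_unitVec_ne hne, coordL_unitVec _ (by omega)] at this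
    simp at this

lemma newField_mem_flag_succ {m : ℕ} (c : ℝ) {i : ℕ} (hi : i ≤ m + 6) (x : Coord (m + 9)) :
    newField m i x ∈ flag m c (i + 1) x := by
  by_cases h3 : i = 3
  · subst h3
    exact flagField_mem m c 4 x
  · simp only [newField, if_neg h3]
    exact unitVec_mem_flag c (by omega) (by unfold flagRoot; split_ifs <;> omega) x

lemma flag_succ_eq {m : ℕ} (c : ℝ) {i : ℕ} (hi : i ≤ m + 6) (x : Coord (m + 9)) :
    flag m c (i + 1) x = flag m c i x ⊔ Submodule.span ℝ {newField m i x} := by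
  apply le_antisymm
  · intro v hv
    rw [← sub_add_cancel v (newCoeff m c i x v • newField m i x)]
    exact Submodule.add_mem_sup (sub_newField_mem_flag hi hv)
      (Submodule.smul_mem _ _ (Submodule.mem_span_singleton_self _))
  · refine sup_le (flag_le_flag_succ m c i x) ?_
    rw [Submodule.span_singleton_le_iff_mem]
    exact newField_mem_flag_succ c hi x

lemma flag_eq_top {m : ℕ} (c : ℝ) {i : ℕ} (hi : m + 7 ≤ i) (x : Coord (m + 9)) :
    flag m c i x = ⊤ := by
  refine eq_top_iff.2 fun v _ j hj => ?_
  have : j = 0 := by omega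
  subst this
  simp [flagRoot, flagCoeff, contactComp, show ¬ i ≤ 3 by omega]

lemma lieBracket_const_apply {n : ℕ} (a : Coord n) (w : VField n) (x : Coord n) :
    VectorField.lieBracket ℝ (fun _ => a) w x = fderiv ℝ w x a := by
  simp [VectorField.lieBracket]

lemma coordL_fderiv {n : ℕ} (j : ℕ) {w : VField n} {x : Coord n} (hw : DifferentiableAt ℝ w x)
    (a : Coord n) : coordL j (fderiv ℝ w x a) = fderiv ℝ (fun y => coordL j (w y)) x a := by
  have := (coordL (n := n) j).hasFDerivAt.comp x hw.hasFDerivAt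
  exact (congrArg (fun T => T a) this.fderiv).symm

lemma coordL_fderiv_flagField {m : ℕ} (c : ℝ) (i j : ℕ) (x a : Coord (m + 9)) :
    coordL j (fderiv ℝ (flagField m c i) x a) = fderiv ℝ (flagCoeff m c i j) x a := by
  rw [coordL_fderiv j ((contDiff_flagField m c i).differentiable (by simp) x)]
  simp only [coordL_flagField]

/-- A single bracket per level generates the next member of the flag. At `i = 3` it is the singular
one: differentiating Y in x_{m+5} removes the factor x_{m+5} and leaves the contact field. -/
lemma lieBracket_flagField {m : ℕ} (c : ℝ) {i : ℕ} (hi : i ≤ m + 6) :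
    VectorField.lieBracket ℝ (fun _ => unitVec (m + 8 - i)) (flagField m c i) = newField m i := by
  funext x
  rw [lieBracket_const_apply]
  apply ext_coordL
  intro j hj
  rw [coordL_fderiv_flagField]
  by_cases h3 : i = 3
  · subst h3
    have hk : m + 8 - 3 = m + 5 := by omega
    simp only [flagCoeff, newField, le_refl, if_true, coordL_contactField, hk]
    by_cases h0 : j = 0
    · subst h0
      rw [fderiv_towerComp_zero, coordL_unitVec _ (by omega)]; simp [contactComp]
    · by_cases hj3 : j ≤ m + 3
      · rw [fderiv_towerComp_low c h0 hj3, coordL_unitVec_ne (show j + 1 ≠ m + 5 by omega),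
          coordL_unitVec _ (by omega)]
        simp [contactComp, h0, hj3]
      · have : contactComp m j x = 0 := by simp [contactComp, h0, hj3]
        rw [this]
        by_cases h4 : j = m + 4
        · rw [h4, fderiv_towerComp_mid]
        · rw [fderiv_towerComp_high c (by omega), coordL_unitVec_ne (by omega)]
  · simp only [newField, if_neg h3]
    by_cases hjk : j = m + 7 - i
    · rw [fderiv_flagCoeff_high c (by omega) h3 hi, coordL_unitVec _ (by omega),
        coordL_unitVec _ hj, if_pos (by omega), if_pos hjk]
    · rw [coordL_unitVec_ne hjk]
      unfold flagCoeff
      split_ifs with h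
      · by_cases h0 : j = 0
        · rw [h0, fderiv_towerComp_zero, coordL_unitVec_ne (by omega)]
        · by_cases hj3 : j ≤ m + 3
          · rw [fderiv_towerComp_low c h0 hj3, coordL_unitVec_ne (by omega),
              coordL_unitVec_ne (by omega)]
            simp
          · by_cases h4 : j = m + 4
            · rw [h4, fderiv_towerComp_mid]
            · rw [fderiv_towerComp_high c (by omega), coordL_unitVec_ne (by omega)]
      · by_cases h0 : j = 0
        · rw [h0, fderiv_contactComp_zero]
        · by_cases hj3 : j ≤ m + 3
          · rw [fderiv_contactComp h0 hj3, coordL_unitVec_ne (by omega)]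
          · have : contactComp m j = fun _ => 0 := by funext y; simp [contactComp, h0, hj3]
            rw [this]; simp

/-! ### The derived flag -/

lemma mem_sections_univ {n : ℕ} {D : PlaneField n} {f : VField n} :
    f ∈ sections univ D ↔ ContDiff ℝ ∞ f ∧ ∀ x, f x ∈ D x := by
  change (ContDiffOn ℝ ∞ f univ ∧ ∀ x ∈ univ, f x ∈ D x) ↔ _
  simp [contDiffOn_univ]

lemma contDiff_lieBracket {n : ℕ} {f g : VField n} (hf : ContDiff ℝ ∞ f) (hg : ContDiff ℝ ∞ g) :
    ContDiff ℝ ∞ (VectorField.lieBracket ℝ f g) :=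
  hf.lieBracket_vectorField hg (by simp)

lemma contDiff_of_mem_brackets {n : ℕ} {M N : Submodule ℝ (VField n)}
    (hM : ∀ f ∈ M, ContDiff ℝ ∞ f) (hN : ∀ f ∈ N, ContDiff ℝ ∞ f) :
    ∀ f ∈ brackets M N, ContDiff ℝ ∞ f := by
  intro f hf
  refine Submodule.span_induction ?_ contDiff_const (fun a b _ _ ha hb => ha.add hb)
    (fun r a _ ha => contDiff_const.smul ha) hf
  rintro _ ⟨a, ha, b, hb, rfl⟩
  exact contDiff_lieBracket (hM a ha) (hN b hb)

lemma contDiff_of_mem_derivedModule {n : ℕ} {D : PlaneField n} :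
    ∀ i, ∀ f ∈ derivedModule univ D i, ContDiff ℝ ∞ f
  | 0, _, hf => (mem_sections_univ.1 hf).1
  | i + 1, f, hf => by
    obtain ⟨a, ha, b, hb, rfl⟩ := Submodule.mem_sup.1 hf
    exact (contDiff_of_mem_derivedModule i a ha).add (contDiff_of_mem_brackets
      (contDiff_of_mem_derivedModule i) (contDiff_of_mem_derivedModule i) b hb)

/-- The members of the derived flag are modules over the smooth functions. -/
lemma smul_mem_derivedModule {n : ℕ} {D : PlaneField n} {h : Coord n → ℝ} :
    ∀ i, ContDiff ℝ ∞ h → ∀ f ∈ derivedModule univ D i,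
      (fun x => h x • f x) ∈ derivedModule univ D i := by
  intro i
  induction i generalizing h with
  | zero =>
    intro hh f hf
    obtain ⟨h1, h2⟩ := mem_sections_univ.1 hf
    exact mem_sections_univ.2 ⟨hh.smul h1, fun x => (D x).smul_mem _ (h2 x)⟩
  | succ i ih =>
    intro hh f hf
    obtain ⟨a, ha, b, hb, rfl⟩ := Submodule.mem_sup.1 hf
    have key : (fun x => h x • b x) ∈ derivedModule univ D (i + 1) := by
      refine Submodule.span_induction ?_ ?_ ?_ ?_ hb
      · rintro _ ⟨p, hp, q, hq, rfl⟩
        have hps := contDiff_of_mem_derivedModule i p hp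
        have hqs := contDiff_of_mem_derivedModule i q hq
        have hd : ContDiff ℝ ∞ (fun x => fderiv ℝ h x (p x)) :=
          (hh.fderiv_right (m := ∞) (by simp)).clm_apply hps
        -- The Leibniz rule h [p, q] = [p, h q] - (p h) q: the first term is again a bracket, the
        -- second lies in the previous module.
        have e : (fun x => h x • VectorField.lieBracket ℝ p q x) =
            VectorField.lieBracket ℝ p (fun x => h x • q x) -
              fun x => fderiv ℝ h x (p x) • q x := by
          funext x
          have := VectorField.lieBracket_smul_right (V := p)
            (hh.differentiable (by simp) x) (hqs.differentiable (by simp) x)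
          rw [Pi.sub_apply]
          erw [this]
          simp
        rw [e]
        refine Submodule.sub_mem _ (Submodule.mem_sup_right (Submodule.subset_span
          ⟨p, hp, _, ih hh q hq, rfl⟩)) (Submodule.mem_sup_left (ih hd q hq))
      · have : (fun x => h x • (0 : VField n) x) = 0 := by funext x; simp
        rw [this]; exact Submodule.zero_mem _
      · intro a b _ _ h1 h2
        have : (fun x => h x • (a + b) x) = (fun x => h x • a x) + fun x => h x • b x := by
          funext x; simp
        rw [this]; exact Submodule.add_mem _ h1 h2
      · intro r a _ h1
        have : (fun x => h x • (r • a) x) = r • fun x => h x • a x := by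
          funext x; exact smul_comm (h x) r (a x)
        rw [this]; exact Submodule.smul_mem _ _ h1
    have : (fun x => h x • (a + b) x) = (fun x => h x • a x) + fun x => h x • b x := by
      funext x; simp
    rw [this]
    exact Submodule.add_mem _ (Submodule.mem_sup_left (ih hh a ha)) key

lemma flagField_mem_sections (m : ℕ) (c : ℝ) (i : ℕ) :
    flagField m c i ∈ sections univ (flag m c i) :=
  mem_sections_univ.2 ⟨contDiff_flagField m c i, flagField_mem m c i⟩

lemma unitVec_mem_sections {m : ℕ} (c : ℝ) {i k : ℕ} (hk : m + 8 ≤ k + i)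
    (hr : k ≠ flagRoot m i) :
    (fun _ => unitVec k : VField (m + 9)) ∈ sections univ (flag m c i) :=
  mem_sections_univ.2 ⟨contDiff_const, unitVec_mem_flag c hk hr⟩

lemma sub_ne_flagRoot {m i : ℕ} (hi : i ≤ m + 6) : m + 8 - i ≠ flagRoot m i := by
  unfold flagRoot; split_ifs <;> omega

lemma contDiff_newCoeff (m : ℕ) (c : ℝ) (i : ℕ) {v : VField (m + 9)} (hv : ContDiff ℝ ∞ v) :
    ContDiff ℝ ∞ (fun x => newCoeff m c i x (v x)) := by
  have h (k : ℕ) : ContDiff ℝ ∞ (fun x => coordL k (v x)) := (coordL k).contDiff.comp hv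
  unfold newCoeff
  split_ifs
  · exact (h _).sub ((h _).mul (coordL _).contDiff)
  · exact (h _).sub ((h _).mul (contDiff_flagCoeff m c i _))

/-- The derived flag of the structure consists of the sections of `flag`. -/
theorem derivedModule_flag (m : ℕ) (c : ℝ) (i : ℕ) :
    derivedModule univ (flag m c 0) i = sections univ (flag m c i) := by
  induction i with
  | zero => rfl
  | succ i ih =>
    apply le_antisymm
    · refine sup_le ?_ ?_
      · rw [ih]
        intro f hf
        obtain ⟨h1, h2⟩ := mem_sections_univ.1 hf
        exact mem_sections_univ.2 ⟨h1, fun x => flag_le_flag_succ m c i x (h2 x)⟩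
      · rw [ih]
        refine Submodule.span_le.2 ?_
        rintro _ ⟨f, hf, g, hg, rfl⟩
        obtain ⟨hf1, hf2⟩ := mem_sections_univ.1 hf
        obtain ⟨hg1, hg2⟩ := mem_sections_univ.1 hg
        exact mem_sections_univ.2 ⟨contDiff_lieBracket hf1 hg1, fun x =>
          bracket_mem_flag_succ (hf1.differentiable (by simp) x) (hg1.differentiable (by simp) x)
            (.of_forall hf2) (.of_forall hg2)⟩
    · intro v hv
      obtain ⟨hv1, hv2⟩ := mem_sections_univ.1 hv
      -- For larger `i` the `i`-th member is already the whole tangent space and there is no new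
      -- generator.
      by_cases hi : i ≤ m + 6
      · have hc := contDiff_newCoeff m c i hv1
        have hn : newField m i ∈ derivedModule univ (flag m c 0) (i + 1) := by
          refine Submodule.mem_sup_right (Submodule.subset_span ?_)
          rw [ih]
          exact ⟨_, unitVec_mem_sections c (by omega) (sub_ne_flagRoot hi), _,
            flagField_mem_sections m c i, (lieBracket_flagField c hi).symm⟩
        have hns := smul_mem_derivedModule (i + 1) hc _ hn
        -- Subtracting a smooth multiple of the new bracket leaves a section of the previous member,
        -- to which the induction hypothesis applies.
        have hs : v - (fun x => newCoeff m c i x (v x) • newField m i x) ∈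
            sections univ (flag m c i) :=
          mem_sections_univ.2 ⟨hv1.sub (contDiff_of_mem_derivedModule _ _ hns), fun x =>
            sub_newField_mem_flag hi (hv2 x)⟩
        rw [← ih] at hs
        rw [← sub_add_cancel v (fun x => newCoeff m c i x (v x) • newField m i x)]
        exact Submodule.add_mem _ (Submodule.mem_sup_left hs) hns
      · refine Submodule.mem_sup_left ?_
        rw [ih]
        exact mem_sections_univ.2 ⟨hv1, fun x => by rw [flag_eq_top c (by omega)]; trivial⟩

/-- The constant extension of a vector is corrected by the variation of `flagField`. Since the root
component of that field is identically 1, the correction keeps the root component and restores every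
graph equation. -/
lemma exists_section_flag {m : ℕ} (c : ℝ) (i : ℕ) {p v : Coord (m + 9)} (hv : v ∈ flag m c i p) :
    ∃ f ∈ sections univ (flag m c i), f p = v := by
  refine ⟨fun x => v + coordL (flagRoot m i) v • (flagField m c i x - flagField m c i p), ?_,
    by simp⟩
  refine mem_sections_univ.2 ⟨contDiff_const.add
    (((contDiff_flagField m c i).sub contDiff_const).const_smul _), fun x j hj => ?_⟩
  have := hv j hj
  simp only [map_add, map_smul, map_sub, coordL_flagField, smul_eq_mul, flagCoeff_flagRoot] at this ⊢
  rw [this]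
  ring

theorem derivedFlag_flag (m : ℕ) (c : ℝ) (i : ℕ) :
    derivedFlag univ (flag m c 0) i = flag m c i := by
  funext p
  ext v
  rw [derivedFlag, derivedModule_flag]
  constructor
  · rintro ⟨f, hf, rfl⟩
    exact (mem_sections_univ.1 hf).2 p
  · intro hv
    obtain ⟨f, hf, h⟩ := exists_section_flag c i hv
    exact ⟨f, hf, h⟩

/-! ### Dimensions -/

lemma eq_smul_of_mem_flag_zero {m : ℕ} {c : ℝ} {x v : Coord (m + 9)} (hv : v ∈ flag m c 0 x) :
    v = coordL (m + 8) v • unitVec (m + 8) + coordL (m + 4) v • tower m c x := by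
  apply ext_coordL
  intro j hj
  rw [map_add, map_smul, map_smul, coordL_tower, smul_eq_mul, smul_eq_mul, coordL_unitVec _ hj]
  by_cases h : j = m + 8
  · subst h
    -- The last component falls in the default branch, which is the coordinate of index m+9, zero by
    -- convention.
    have : towerComp m c (m + 8) x = 0 := by
      simp [towerComp, coordL_of_le]
    rw [this]; simp
  · have := hv j (by omega)
    simpa [h, flagRoot, flagCoeff] using this

lemma flag_zero_eq_span (m : ℕ) (c : ℝ) (x : Coord (m + 9)) :
    flag m c 0 x = Submodule.span ℝ {unitVec (m + 8), tower m c x} := by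
  apply le_antisymm
  · intro v hv
    rw [eq_smul_of_mem_flag_zero hv]
    exact Submodule.add_mem _ (Submodule.smul_mem _ _ (Submodule.subset_span (by simp)))
      (Submodule.smul_mem _ _ (Submodule.subset_span (by simp)))
  · rw [Submodule.span_le]
    rintro v (rfl | rfl)
    · exact unitVec_mem_flag c (by omega) (by simp [flagRoot]) x
    · exact flagField_mem m c 0 x

lemma linearIndependent_unitVec_tower (m : ℕ) (c : ℝ) (x : Coord (m + 9)) :
    LinearIndependent ℝ ![unitVec (m + 8), tower m c x] := by
  rw [LinearIndependent.pair_iff]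
  intro s t h
  have h4 := congrArg (coordL (m + 4)) h
  have h8 := congrArg (coordL (m + 8)) h
  rw [map_add, map_smul, map_smul, coordL_tower] at h4 h8
  rw [coordL_unitVec_ne (by omega)] at h4
  have ht : t = 0 := by simpa [towerComp] using h4
  rw [coordL_unitVec _ (by omega), ht] at h8
  exact ⟨by simpa using h8, ht⟩

lemma finrank_flag (m : ℕ) (c : ℝ) (x : Coord (m + 9)) :
    ∀ i ≤ m + 7, Module.finrank ℝ (flag m c i x) = i + 2
  | 0, _ => by
    have := finrank_span_eq_card (linearIndependent_unitVec_tower m c x)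
    rw [flag_zero_eq_span]
    rw [Matrix.range_cons_cons_empty] at this
    simpa using this
  | i + 1, hi => by
    rw [flag_succ_eq c (by omega), Submodule.finrank_sup_span_singleton
      (newField_notMem_flag c (by omega) x), finrank_flag m c x i (by omega)]

lemma isFrameOn_flag_zero (m : ℕ) (c : ℝ) :
    IsFrameOn univ (flag m c 0) ![fun _ => unitVec (m + 8), tower m c] := by
  constructor
  · intro i
    fin_cases i
    · exact contDiffOn_const
    · exact (contDiff_tower m c).contDiffOn
  · intro x _
    have e : (fun i => (![fun _ => unitVec (m + 8), tower m c] :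
        Fin 2 → VField (m + 9)) i x) = ![unitVec (m + 8), tower m c x] := by
      funext i; fin_cases i <;> rfl
    rw [e]
    refine ⟨linearIndependent_unitVec_tower m c x, ?_⟩
    rw [flag_zero_eq_span]
    simp [Set.pair_comm]

theorem isGoursat_flag (m : ℕ) (c : ℝ) : IsGoursat univ (flag m c 0) where
  three_le := by omega
  isOpen := isOpen_univ
  isDistribution := fun p _ => ⟨univ, isOpen_univ, mem_univ p, subset_rfl,
    ![fun _ => unitVec (m + 8), tower m c], isFrameOn_flag_zero m c⟩
  finrank_derivedFlag := fun i hi p _ => by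
    rw [derivedFlag_flag, finrank_flag m c p i (by omega)]

/-- This bracket gives the direction at step five of the Lie flag (for m = 0), and it governs the
evolution of ⟨p, Z⟩ along abnormal extremals. -/
lemma lieBracket_tower_contactField (m : ℕ) (c : ℝ) :
    VectorField.lieBracket ℝ (tower m c) (contactField m) = fun _ => unitVec (m + 3) := by
  funext x
  apply ext_coordL
  intro j hj
  rw [coordL_comp_bracket j ((contDiff_tower m c).differentiable (by simp) x)
    ((contDiff_contactField m).differentiable (by simp) x)]
  simp only [coordL_contactField, coordL_tower]
  by_cases h0 : j = 0
  · subst h0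
    rw [fderiv_contactComp_zero, fderiv_towerComp_zero, coordL_contactField,
      coordL_unitVec _ (by omega)]
    simp [contactComp]
  · by_cases h3 : j ≤ m + 3
    · rw [fderiv_contactComp h0 (by omega), fderiv_towerComp_low c h0 (by omega),
        coordL_contactField, coordL_contactField, coordL_tower, coordL_unitVec _ (by omega)]
      obtain rfl | h3 : j = m + 3 ∨ j ≤ m + 2 := by omega
      · simp [contactComp, towerComp]
      · simp [contactComp, towerComp, show j ≠ m + 3 by omega, h3]
    · have : contactComp m j = fun _ => 0 := by
        funext y; simp [contactComp, h0, show ¬ j ≤ m + 3 by omega]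
      rw [this, coordL_unitVec_ne (by omega)]
      by_cases h4 : j = m + 4
      · subst h4
        rw [fderiv_towerComp_mid]; simp
      · rw [fderiv_towerComp_high c (by omega), coordL_contactField]
        simp [contactComp, show ¬ j + 1 ≤ m + 3 by omega]

/-! ### Characteristic distributions -/

/-- The equations of the member `i + 1` involve no coordinate of index m+8-i or more, so
translations in those directions are symmetries of it. -/
lemma fderiv_flagCoeff_of_mem_charFlag {m : ℕ} (c : ℝ) {i j : ℕ} (hj : j + (i + 1) ≤ m + 7)
    {x a : Coord (m + 9)} (ha : a ∈ charFlag m i) :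
    fderiv ℝ (flagCoeff m c (i + 1) j) x a = 0 := by
  unfold flagCoeff
  split_ifs with h
  · by_cases h0 : j = 0
    · rw [h0, fderiv_towerComp_zero, ha _ (by omega)]
    · by_cases h3 : j ≤ m + 3
      · rw [fderiv_towerComp_low c h0 h3, ha _ (by omega), ha _ (by omega)]; simp
      · by_cases h4 : j = m + 4
        · rw [h4, fderiv_towerComp_mid]
        · rw [fderiv_towerComp_high c (by omega), ha _ (by omega)]
  · by_cases h0 : j = 0
    · rw [h0, fderiv_contactComp_zero]
    · rw [fderiv_contactComp h0 (by omega), ha _ (by omega)]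

lemma flagRoot_succ_le {m i : ℕ} (hi : i ≤ m + 7) : flagRoot m (i + 1) + i ≤ m + 7 := by
  unfold flagRoot; split_ifs <;> omega

lemma charFlag_le_flag_succ {m : ℕ} (c : ℝ) {i : ℕ} (hi : i ≤ m + 7) (x : Coord (m + 9)) :
    charFlag m i ≤ flag m c (i + 1) x := fun v hv j hj => by
  rw [hv j (by omega), hv _ (flagRoot_succ_le hi), zero_mul]

/-- Constant fields in `charFlag m i` are characteristic for `flag m c (i + 1)`. -/
lemma bracket_const_mem_flag {m : ℕ} {c : ℝ} {i : ℕ} (hi : i ≤ m + 7) {a : Coord (m + 9)}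
    (ha : a ∈ charFlag m i) {g : VField (m + 9)} {x : Coord (m + 9)}
    (hg : DifferentiableAt ℝ g x) (hgf : ∀ᶠ y in 𝓝 x, g y ∈ flag m c (i + 1) y) :
    VectorField.lieBracket ℝ (fun _ => a) g x ∈ flag m c (i + 1) x := by
  intro j hj
  rw [coordL_bracket_flag (c := c) hj (by fun_prop) hg
      (.of_forall fun y => charFlag_le_flag_succ c hi y ha) hgf,
    fderiv_flagCoeff_of_mem_charFlag c hj ha, ha _ (flagRoot_succ_le hi)]
  ring

/-- This equation makes the bracket form of the flag nondegenerate modulo `charFlag`. It is the last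
equation except at `i = 3`, where it is equation 0, with coefficient x_{m+5}. -/
lemma exists_fderiv_flagCoeff_eq {m : ℕ} (c : ℝ) {i : ℕ} (hi : i ≤ m + 6) (x : Coord (m + 9)) :
    ∃ j, j + i ≤ m + 7 ∧ ∀ a, fderiv ℝ (flagCoeff m c i j) x a = coordL (m + 8 - i) a := by
  by_cases h3 : i = 3
  · subst h3
    refine ⟨0, by omega, fun a => ?_⟩
    simp only [flagCoeff, le_refl, if_true]
    rw [fderiv_towerComp_zero]
    congr 2
  · refine ⟨m + 7 - i, by omega, fun a => ?_⟩
    rw [fderiv_flagCoeff_high c (by omega) h3 hi]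
    congr 2
    omega

/-- A field whose brackets with the sections of `flag m c (i + 1)` stay there has its value in
`charFlag m i`. -/
lemma mem_charFlag_of_bracket_mem {m : ℕ} {c : ℝ} {i : ℕ} (hi : i ≤ m + 5)
    {v : VField (m + 9)} {x : Coord (m + 9)} (hv : DifferentiableAt ℝ v x)
    (hvf : ∀ᶠ y in 𝓝 x, v y ∈ flag m c (i + 1) y)
    (h : ∀ w ∈ sections univ (flag m c (i + 1)),
      VectorField.lieBracket ℝ v w x ∈ flag m c (i + 1) x) :
    v x ∈ charFlag m i := by
  obtain ⟨j, hj, hd⟩ := exists_fderiv_flagCoeff_eq c (show i + 1 ≤ m + 6 by omega) x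
  -- The bracket defect of the chosen equation is a 2 × 2 determinant in the root component and
  -- component m+7-i. Testing it on ∂_{m+7-i} and on `flagField` kills both components of v.
  have key : ∀ w ∈ sections univ (flag m c (i + 1)),
      coordL (flagRoot m (i + 1)) (w x) * coordL (m + 8 - (i + 1)) (v x) =
        coordL (flagRoot m (i + 1)) (v x) * coordL (m + 8 - (i + 1)) (w x) := by
    intro w hw
    obtain ⟨hw1, hw2⟩ := mem_sections_univ.1 hw
    have h1 := coordL_bracket_flag (c := c) hj hv (hw1.differentiable (by simp) x) hvf
      (.of_forall hw2)
    rw [h w hw j hj, hd, hd] at h1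
    linarith
  have hne := sub_ne_flagRoot (m := m) (i := i + 1) (by omega)
  have h1 := key _ (unitVec_mem_sections c (k := m + 8 - (i + 1)) (by omega) hne)
  rw [coordL_unitVec_ne hne.symm, coordL_unitVec _ (by omega), if_pos rfl] at h1
  have hr : coordL (flagRoot m (i + 1)) (v x) = 0 := by linarith
  have h2 := key _ (flagField_mem_sections m c (i + 1))
  rw [coordL_flagField, flagCoeff_flagRoot, hr] at h2
  intro k hk
  by_cases hki : k = m + 7 - i
  · have : k = m + 8 - (i + 1) := by omega
    rw [this]; linarith
  · rw [hvf.self_of_nhds k (by omega), hr, zero_mul]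

theorem charDistribution_flag {m : ℕ} (c : ℝ) {i : ℕ} (hi : i ≤ m + 5) (p : Coord (m + 9)) :
    charDistribution univ (flag m c 0) i p = charFlag m i := by
  unfold charDistribution charFields
  rw [derivedModule_flag]
  apply le_antisymm
  · rw [Submodule.span_le]
    rintro _ ⟨f, ⟨hf, hfg⟩, rfl⟩
    obtain ⟨h1, h2⟩ := mem_sections_univ.1 hf
    exact mem_charFlag_of_bracket_mem hi (h1.differentiable (by simp) p) (.of_forall h2)
      fun w hw => (mem_sections_univ.1 (hfg w hw)).2 p
  · intro a ha
    refine Submodule.subset_span ⟨fun _ => a, ⟨mem_sections_univ.2 ⟨contDiff_const, fun x =>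
      charFlag_le_flag_succ c (by omega) x ha⟩, fun g hg => ?_⟩, rfl⟩
    obtain ⟨h1, h2⟩ := mem_sections_univ.1 hg
    exact mem_sections_univ.2 ⟨contDiff_lieBracket contDiff_const h1, fun x =>
      bracket_const_mem_flag (by omega) ha (h1.differentiable (by simp) x) (.of_forall h2)⟩

/-! ### The structures on `ℝ⁹` -/

lemma kappa9Snd_eq_tower (c : ℝ) : kappa9Snd c = tower 0 c := by
  funext x j
  fin_cases j <;> simp [kappa9Snd, tower, towerComp, coordL_apply, coordL_of_le]

lemma kappa9Fst_eq_unitVec : kappa9Fst = fun _ => unitVec 8 := by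
  funext x j
  fin_cases j <;> simp [kappa9Fst, unitVec]

lemma dist9_eq_flag (c : ℝ) : dist9 c = flag 0 c 0 := by
  funext x
  rw [flag_zero_eq_span, dist9, spannedBy, kappa9Snd_eq_tower, kappa9Fst_eq_unitVec]

-- From ℝ³ on, the prolongations are R_0, R_0, S, R_0, R_1, R_c; the single singular one creates the
-- locus x_5 = 0.
set_option linter.unusedSimpArgs false in
theorem isKumperaRuiz_kappa9 (c : ℝ) : IsKumperaRuiz 9 kappa9Fst (kappa9Snd c) := by
  have h4 : IsKumperaRuiz 4 (fun _ => ![0, 0, 0, 1]) (fun x => ![1, x 2, x 3, 0]) := by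
    convert IsKumperaRuiz.regular 0 IsKumperaRuiz.base using 1 <;> funext x j <;> fin_cases j <;>
      simp [lastField, lift, Fin.snoc, Fin.init, Fin.ext_iff, Pi.single_apply, Fin.last]
  have h5 : IsKumperaRuiz 5 (fun _ => ![0, 0, 0, 0, 1]) (fun x => ![1, x 2, x 3, x 4, 0]) := by
    convert IsKumperaRuiz.regular 0 h4 using 1 <;> funext x j <;> fin_cases j <;>
      simp [lastField, lift, Fin.snoc, Fin.init, Fin.ext_iff, Pi.single_apply, Fin.last]
  have h6 : IsKumperaRuiz 6 (fun _ => ![0, 0, 0, 0, 0, 1])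
      (fun x => ![x 5, x 5 * x 2, x 5 * x 3, x 5 * x 4, 1, 0]) := by
    convert IsKumperaRuiz.singular h5 using 1 <;> funext x j <;> fin_cases j <;>
      simp [lastField, lift, Fin.snoc, Fin.init, Fin.ext_iff, Pi.single_apply, Fin.last]
  have h7 : IsKumperaRuiz 7 (fun _ => ![0, 0, 0, 0, 0, 0, 1])
      (fun x => ![x 5, x 5 * x 2, x 5 * x 3, x 5 * x 4, 1, x 6, 0]) := by
    convert IsKumperaRuiz.regular 0 h6 using 1 <;> funext x j <;> fin_cases j <;>
      simp [lastField, lift, Fin.snoc, Fin.init, Fin.ext_iff, Pi.single_apply, Fin.last]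
  have h8 : IsKumperaRuiz 8 (fun _ => ![0, 0, 0, 0, 0, 0, 0, 1])
      (fun x => ![x 5, x 5 * x 2, x 5 * x 3, x 5 * x 4, 1, x 6, x 7 + 1, 0]) := by
    convert IsKumperaRuiz.regular 1 h7 using 1 <;> funext x j <;> fin_cases j <;>
      simp [lastField, lift, Fin.snoc, Fin.init, Fin.ext_iff, Pi.single_apply, Fin.last]
  convert IsKumperaRuiz.regular c h8 using 1 <;> funext x j <;> fin_cases j <;>
    simp [kappa9Fst, kappa9Snd, lastField, lift, Fin.snoc, Fin.init, Fin.ext_iff,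
      Pi.single_apply, Fin.last]

/-! ### The singularity type of the structures on `ℝ⁹` -/

/-- The canonical sets met here are coordinate subspaces, and a straight line through the point
realizes each tangent vector. -/
lemma tangentVectors_coordinate_subspace {n : ℕ} {S : Set (Coord n)} {K : Set ℕ}
    (hS : ∀ x, x ∈ S ↔ ∀ j ∈ K, coordL j x = 0) {p : Coord n} (hp : p ∈ S) :
    tangentVectors S p = S := by
  ext v
  constructor
  · rintro ⟨γ, -, -, hγ, hd⟩
    refine (hS v).2 fun j hj => ?_
    have h1 : HasDerivAt (fun t => coordL j (γ t)) (coordL j v) 0 :=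
      (coordL j).hasFDerivAt.comp_hasDerivAt 0 hd
    have h2 : (fun t => coordL j (γ t)) =ᶠ[𝓝 0] fun _ => 0 :=
      hγ.mono fun t ht => (hS _).1 ht j hj
    exact (h1.congr_of_eventuallyEq h2.symm).unique (hasDerivAt_const 0 0)
  · intro hv
    refine ⟨fun t => p + t • v, by fun_prop, by simp, .of_forall fun t => (hS _).2 fun j hj => ?_,
      ?_⟩
    · simp [(hS p).1 hp j hj, (hS v).1 hv j hj]
    · simpa using ((hasDerivAt_id (0 : ℝ)).smul_const v).const_add p

/-- The i-th flag member contains a vector with root component 1, and the characteristic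
distribution kills that component unless `i = 3`. There the root 4 has just left the equations, and
equality holds exactly when the remaining coefficients, all multiples of x_5, vanish. -/
lemma mem_canonicalSet_zero (c : ℝ) (i : ℕ) (p : Coord 9) :
    p ∈ canonicalSet univ (flag 0 c 0) i 0 ↔ i = 3 ∧ coordL 5 p = 0 := by
  change (p ∈ univ ∧ i + 5 ≤ 9 ∧ _ = _) ↔ _
  rw [derivedFlag_flag]
  constructor
  · rintro ⟨-, hi, h⟩
    rw [charDistribution_flag c (by omega)] at h
    have hf := flagField_mem 0 c i p
    rw [h] at hf
    by_cases h3 : i = 3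
    · subst h3
      have := hf 0 (by omega)
      rw [coordL_flagField] at this
      exact ⟨rfl, by simpa [flagCoeff, towerComp] using this⟩
    · have := hf (flagRoot 0 i) (by unfold flagRoot; split_ifs <;> omega)
      rw [coordL_flagField, flagCoeff_flagRoot] at this
      exact absurd this one_ne_zero
  · rintro ⟨rfl, h5⟩
    refine ⟨trivial, by omega, ?_⟩
    rw [charDistribution_flag c (by omega)]
    ext v
    have hY : ∀ j ≤ 3, flagCoeff 0 c 3 j p = 0 := by
      intro j hj
      by_cases h0 : j = 0
      · simp [flagCoeff, towerComp, h0, h5]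
      · simp [flagCoeff, towerComp, h0, hj, h5]
    constructor
    · intro hv j hj
      rw [hv j (by omega), hY j (by omega), mul_zero]
    · intro hv j hj
      by_cases h4 : j = 4
      · subst h4
        have := flagCoeff_flagRoot 0 c 3 p
        simp only [flagRoot, le_refl, if_true] at this ⊢
        rw [this, mul_one]
      · rw [hv j (by omega), hY j (by omega), mul_zero]

lemma canonicalSet_subset_zero {n : ℕ} (U : Set (Coord n)) (D : PlaneField n) (i : ℕ) :
    ∀ j, canonicalSet U D i j ⊆ canonicalSet U D i 0
  | 0 => subset_rfl
  | j + 1 => fun _ hp => canonicalSet_subset_zero U D i j hp.1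

/-- On x_5 = 0 the question is whether the flag has a vector with nonzero root component tangent to
this hyperplane. Its component 5 would be a nonzero multiple of x_6. -/
lemma mem_canonicalSet_three_one (c : ℝ) (p : Coord 9) :
    p ∈ canonicalSet univ (flag 0 c 0) 3 1 ↔ coordL 5 p = 0 ∧ coordL 6 p = 0 := by
  have hS : ∀ x, x ∈ canonicalSet univ (flag 0 c 0) 3 0 ↔ ∀ j ∈ ({5} : Set ℕ), coordL j x = 0 := by
    intro x; rw [mem_canonicalSet_zero]; simp
  change (p ∈ canonicalSet univ (flag 0 c 0) 3 0 ∧ 1 ≤ 3 ∧ _ ≠ _) ↔ _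
  rw [derivedFlag_flag, charDistribution_flag c (by omega)]
  constructor
  · rintro ⟨hp, -, hne⟩
    have h5 := (hS p).1 hp 5 rfl
    refine ⟨h5, ?_⟩
    rw [tangentVectors_coordinate_subspace hS hp] at hne
    by_contra h6
    apply hne
    ext v
    constructor
    · rintro ⟨hv, hv5⟩ j hj
      have hv5 := (hS v).1 hv5 5 rfl
      have h := hv 5 (by omega)
      rw [hv5] at h
      have h4 : coordL (flagRoot 0 2) v = 0 := by
        simpa [flagCoeff, towerComp, h6] using h.symm
      rw [hv j hj, h4, zero_mul]
    · intro hv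
      refine ⟨charFlag_le_flag c le_rfl (by simp [flagRoot]) p hv, (hS v).2 ?_⟩
      rintro j rfl
      exact hv 5 (by omega)
  · rintro ⟨h5, h6⟩
    have hp := (mem_canonicalSet_zero c 3 p).2 ⟨rfl, h5⟩
    refine ⟨hp, by omega, ?_⟩
    rw [tangentVectors_coordinate_subspace hS hp]
    intro h
    have hm : flagField 0 c 2 p ∈ (charFlag 0 2 : Set (Coord 9)) := by
      rw [← h]
      refine ⟨flagField_mem 0 c 2 p, (hS _).2 ?_⟩
      rintro j rfl
      rw [coordL_flagField]
      simpa [flagCoeff, towerComp] using h6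
    have := hm 4 (by omega)
    rw [coordL_flagField] at this
    simp [flagCoeff, towerComp] at this

/-- The regular prolongation with constant 1 makes Y leave x_6 = 0: its component 6 at the origin is
1, so the chain of canonical sets stops here. -/
lemma zero_notMem_canonicalSet_three_two (c : ℝ) :
    (0 : Coord 9) ∉ canonicalSet univ (flag 0 c 0) 3 2 := by
  rintro ⟨hp, -, hne⟩
  apply hne
  have hS : ∀ x, x ∈ canonicalSet univ (flag 0 c 0) 3 1 ↔
      ∀ j ∈ ({5, 6} : Set ℕ), coordL j x = 0 := by
    intro x; rw [mem_canonicalSet_three_one]; simp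
  rw [derivedFlag_flag, charDistribution_flag c (by omega),
    tangentVectors_coordinate_subspace hS hp]
  change (flag 0 c 1 0 : Set (Coord 9)) ∩ _ = (charFlag 0 1 : Set (Coord 9))
  ext v
  constructor
  · rintro ⟨hv, hv6⟩ j hj
    have hv6 := (hS v).1 hv6 6 (by simp)
    have h := hv 6 (by omega)
    rw [hv6] at h
    have h4 : coordL (flagRoot 0 1) v = 0 := by
      simpa [flagCoeff, towerComp] using h.symm
    rw [hv j hj, h4, zero_mul]
  · intro hv
    refine ⟨charFlag_le_flag c le_rfl (by simp [flagRoot]) 0 hv, (hS v).2 ?_⟩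
    rintro j (rfl | rfl)
    exacts [hv 5 (by omega), hv 6 (by omega)]

lemma zero_mem_canonicalSet_iff (c : ℝ) (i j : ℕ) :
    (0 : Coord 9) ∈ canonicalSet univ (flag 0 c 0) i j ↔ i = 3 ∧ j ≤ 1 := by
  constructor
  · intro h
    have h0 := ((mem_canonicalSet_zero c i 0).1 (canonicalSet_subset_zero _ _ _ _ h)).1
    refine ⟨h0, ?_⟩
    subst h0
    by_contra! hj
    have : ∀ k, (0 : Coord 9) ∉ canonicalSet univ (flag 0 c 0) 3 (k + 2) := by
      intro k
      induction k with
      | zero => exact zero_notMem_canonicalSet_three_two c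
      | succ k ih => exact fun h => ih h.1
    exact this (j - 2) (by rwa [Nat.sub_add_cancel hj])
  · rintro ⟨rfl, hj⟩
    obtain rfl | rfl : j = 0 ∨ j = 1 := by omega
    · exact (mem_canonicalSet_zero c 3 0).2 ⟨rfl, map_zero _⟩
    · exact (mem_canonicalSet_three_one c 0).2 ⟨map_zero _, map_zero _⟩

theorem singularityType_flag (c : ℝ) :
    singularityType univ (flag 0 c 0) 0 = [0, 0, 1, 2, 0, 0] := by
  have hl : ∀ i, singularityLetter univ (flag 0 c 0) (0 : Coord 9) i =
      if i = 2 then 2 else if i = 3 then 1 else 0 := by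
    intro i
    have hs : {j | (0 : Coord 9) ∈ canonicalSet univ (flag 0 c 0) (i + j) j} =
        {j | i + j = 3 ∧ j ≤ 1} := by
      ext j; exact zero_mem_canonicalSet_iff c (i + j) j
    unfold singularityLetter
    by_cases h2 : i = 2
    · subst h2
      have e : {j : ℕ | 2 + j = 3 ∧ j ≤ 1} = {1} := by ext j; simp; omega
      rw [if_pos ⟨1, (zero_mem_canonicalSet_iff c _ _).2 (by omega)⟩, hs, e, csInf_singleton]
      simp
    · by_cases h3 : i = 3
      · subst h3
        have e : {j : ℕ | 3 + j = 3 ∧ j ≤ 1} = {0} := by ext j; simp; omega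
        rw [if_pos ⟨0, (zero_mem_canonicalSet_iff c _ _).2 (by omega)⟩, hs, e, csInf_singleton]
        simp
      · rw [if_neg, if_neg h2, if_neg h3]
        rintro ⟨j, hj⟩
        have := (zero_mem_canonicalSet_iff c _ _).1 hj
        omega
  change ((List.range 6).map (singularityLetter univ (flag 0 c 0) (0 : Coord 9))).reverse = _
  rw [funext hl]
  rfl

/-! ### The Lie flag of the structures on `ℝ⁹`: functions of given nonholonomic order -/

/-- The smooth functions on `ℝ⁹` of nonholonomic order at least `k` at the origin. -/
def orderIdeal (c : ℝ) : ℕ → Set (Coord 9 → ℝ)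
  | 0 => {g | ContDiff ℝ ∞ g}
  | k + 1 => {g | ContDiff ℝ ∞ g ∧ g 0 = 0 ∧ (fun x => fderiv ℝ g x (unitVec 8)) ∈ orderIdeal c k ∧
      (fun x => fderiv ℝ g x (tower 0 c x)) ∈ orderIdeal c k}

lemma contDiff_of_mem_orderIdeal {c : ℝ} : ∀ {k : ℕ} {g : Coord 9 → ℝ}, g ∈ orderIdeal c k →
    ContDiff ℝ ∞ g
  | 0, _, h => h
  | _ + 1, _, h => h.1

lemma differentiable_of_mem_orderIdeal {c : ℝ} {k : ℕ} {g : Coord 9 → ℝ}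
    (h : g ∈ orderIdeal c k) : Differentiable ℝ g :=
  (contDiff_of_mem_orderIdeal h).differentiable (by simp)

lemma contDiff_fderiv_apply {n : ℕ} {g : Coord n → ℝ} {v : VField n} (hg : ContDiff ℝ ∞ g)
    (hv : ContDiff ℝ ∞ v) : ContDiff ℝ ∞ (fun x => fderiv ℝ g x (v x)) :=
  (hg.fderiv_right (m := ∞) (by simp)).clm_apply hv

lemma orderIdeal_succ_subset (c : ℝ) : ∀ k, orderIdeal c (k + 1) ⊆ orderIdeal c k
  | 0 => fun _ h => h.1
  | k + 1 => fun _ h => ⟨h.1, h.2.1, orderIdeal_succ_subset c k h.2.2.1,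
      orderIdeal_succ_subset c k h.2.2.2⟩

lemma orderIdeal_anti (c : ℝ) {k l : ℕ} (h : k ≤ l) : orderIdeal c l ⊆ orderIdeal c k := by
  induction h with
  | refl => exact subset_rfl
  | step _ ih => exact (orderIdeal_succ_subset c _).trans ih

lemma zero_mem_orderIdeal (c : ℝ) : ∀ k, (fun _ => 0 : Coord 9 → ℝ) ∈ orderIdeal c k
  | 0 => (contDiff_const : ContDiff ℝ ∞ _)
  | k + 1 => by
    refine ⟨contDiff_const, rfl, ?_, ?_⟩ <;> simpa using zero_mem_orderIdeal c k

lemma add_mem_orderIdeal {c : ℝ} : ∀ {k : ℕ} {f g : Coord 9 → ℝ}, f ∈ orderIdeal c k →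
    g ∈ orderIdeal c k → (fun x => f x + g x) ∈ orderIdeal c k
  | 0, _, _, hf, hg => ContDiff.add (contDiff_of_mem_orderIdeal hf) (contDiff_of_mem_orderIdeal hg)
  | k + 1, f, g, hf, hg => by
    have h (x : Coord 9) : fderiv ℝ (fun x => f x + g x) x = fderiv ℝ f x + fderiv ℝ g x :=
      fderiv_fun_add (differentiable_of_mem_orderIdeal hf x)
        (differentiable_of_mem_orderIdeal hg x)
    refine ⟨hf.1.add hg.1, by simp [hf.2.1, hg.2.1], ?_, ?_⟩ <;>
      simp only [h, add_apply]
    · exact add_mem_orderIdeal hf.2.2.1 hg.2.2.1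
    · exact add_mem_orderIdeal hf.2.2.2 hg.2.2.2

lemma fderiv_mul_apply {n : ℕ} {f g : Coord n → ℝ} (hf : Differentiable ℝ f)
    (hg : Differentiable ℝ g) (x a : Coord n) :
    fderiv ℝ (fun x => f x * g x) x a = fderiv ℝ f x a * g x + f x * fderiv ℝ g x a := by
  rw [fderiv_fun_mul (hf x) (hg x)]
  simp
  ring

lemma mul_mem_orderIdeal {c : ℝ} : ∀ {k : ℕ} {f g : Coord 9 → ℝ}, ContDiff ℝ ∞ f →
    g ∈ orderIdeal c k → (fun x => f x * g x) ∈ orderIdeal c k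
  | 0, _, _, hf, hg => ContDiff.mul hf (contDiff_of_mem_orderIdeal hg)
  | k + 1, f, g, hf, hg => by
    have h := fderiv_mul_apply (hf.differentiable (by simp)) (differentiable_of_mem_orderIdeal hg)
    refine ⟨hf.mul hg.1, by simp [hg.2.1], ?_, ?_⟩ <;> simp only [h] <;>
      refine add_mem_orderIdeal (mul_mem_orderIdeal (contDiff_fderiv_apply hf ?_)
        (orderIdeal_succ_subset c k hg)) (mul_mem_orderIdeal hf ?_)
    exacts [contDiff_const, hg.2.2.1, contDiff_tower 0 c, hg.2.2.2]

lemma fderiv_coordL_tower {m : ℕ} (c : ℝ) (k : ℕ) (x : Coord (m + 9)) :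
    fderiv ℝ (fun y : Coord (m + 9) => coordL k y) x (tower m c x) = towerComp m c k x := by
  rw [fderiv_coordL, coordL_tower]

/-- By Leibniz, a function vanishing at 0 raises the order by at least one. -/
lemma coordL_six_mul_mem_orderIdeal {c : ℝ} {k : ℕ} {g : Coord 9 → ℝ} (hg : g ∈ orderIdeal c k) :
    (fun x => coordL 6 x * g x) ∈ orderIdeal c (k + 1) := by
  induction k generalizing g with
  | zero =>
    have h6 : ContDiff ℝ ∞ (fun x : Coord 9 => coordL 6 x * g x) :=
      (coordL 6).contDiff.mul (contDiff_of_mem_orderIdeal hg)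
    exact ⟨h6, by simp, contDiff_fderiv_apply h6 contDiff_const,
      contDiff_fderiv_apply h6 (contDiff_tower 0 c)⟩
  | succ k ih =>
    have h := fderiv_mul_apply (f := fun x : Coord 9 => coordL 6 x)
      (coordL 6).differentiable (differentiable_of_mem_orderIdeal hg)
    refine ⟨(coordL 6).contDiff.mul hg.1, by simp, ?_, ?_⟩ <;> simp only [h]
    · simp only [fderiv_coordL]
      exact add_mem_orderIdeal (mul_mem_orderIdeal contDiff_const hg) (ih hg.2.2.1)
    · simp only [fderiv_coordL_tower]
      exact add_mem_orderIdeal (mul_mem_orderIdeal (contDiff_towerComp 0 c 6) hg) (ih hg.2.2.2)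

/-- The coordinate x_5 has order at least two, since X x_5 = 0 and Y x_5 = x_6 vanishes at 0. This
is the cause of the jumps by 3 in the weights of the directions 2 and 1. -/
lemma coordL_five_mul_mem_orderIdeal {c : ℝ} {k : ℕ} {g : Coord 9 → ℝ} (hg : g ∈ orderIdeal c k) :
    (fun x => coordL 5 x * g x) ∈ orderIdeal c (k + 2) := by
  induction k generalizing g with
  | zero =>
    have h := fderiv_mul_apply (f := fun x : Coord 9 => coordL 5 x)
      (coordL 5).differentiable (differentiable_of_mem_orderIdeal hg)
    have h5 (g : Coord 9 → ℝ) (hg : ContDiff ℝ ∞ g) :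
        (fun x : Coord 9 => coordL 5 x * g x) ∈ orderIdeal c 1 := by
      have h5 : ContDiff ℝ ∞ (fun x : Coord 9 => coordL 5 x * g x) := (coordL 5).contDiff.mul hg
      exact ⟨h5, by simp, contDiff_fderiv_apply h5 contDiff_const,
        contDiff_fderiv_apply h5 (contDiff_tower 0 c)⟩
    refine ⟨(coordL 5).contDiff.mul hg, by simp, ?_, ?_⟩ <;> simp only [h]
    · simp only [fderiv_coordL, coordL_unitVec_ne (show 5 ≠ 8 by omega), zero_mul, zero_add]
      exact h5 _ (contDiff_fderiv_apply hg contDiff_const)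
    · simp only [fderiv_coordL_tower]
      refine add_mem_orderIdeal ?_ (h5 _ (contDiff_fderiv_apply hg (contDiff_tower 0 c)))
      have : towerComp 0 c 5 = fun x => coordL 6 x := by funext x; simp [towerComp]
      rw [this]
      exact coordL_six_mul_mem_orderIdeal hg
  | succ k ih =>
    have h := fderiv_mul_apply (f := fun x : Coord 9 => coordL 5 x)
      (coordL 5).differentiable (differentiable_of_mem_orderIdeal hg)
    refine ⟨(coordL 5).contDiff.mul hg.1, by simp, ?_, ?_⟩ <;> simp only [h]
    · simp only [fderiv_coordL, coordL_unitVec_ne (show 5 ≠ 8 by omega), zero_mul, zero_add]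
      exact ih hg.2.2.1
    · simp only [fderiv_coordL_tower]
      refine add_mem_orderIdeal ?_ (ih hg.2.2.2)
      have : towerComp 0 c 5 = fun x => coordL 6 x := by funext x; simp [towerComp]
      rw [this]
      exact coordL_six_mul_mem_orderIdeal hg

/-! ### The adapted coframe -/

/-- The index of the reference component of the `j`-th form of the adapted coframe. -/
def coframeRoot (j : ℕ) : ℕ := if j = 1 ∨ j = 2 ∨ j = 3 then 0 else 4

/-- The coefficient of the reference component in the `j`-th form of the adapted coframe. -/
noncomputable def coframeCoeff (c : ℝ) (j : ℕ) : Coord 9 → ℝ :=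
  if j = 1 ∨ j = 2 ∨ j = 3 then contactComp 0 j else towerComp 0 c j

/-- The adapted coframe on `ℝ⁹`. -/
noncomputable def coframe (c : ℝ) (j : ℕ) (x v : Coord 9) : ℝ :=
  coordL j v - coordL (coframeRoot j) v * coframeCoeff c j x

/-- The step of the Lie flag at which the `j`-th direction at the origin appears. -/
def coframeWeight (j : ℕ) : ℕ :=
  if j = 0 then 4 else if j = 1 then 11 else if j = 2 then 8 else if j = 3 then 5
  else if j = 5 then 3 else if j = 6 then 2 else if j = 7 then 1 else 0

lemma contDiff_coframeCoeff (c : ℝ) (j : ℕ) : ContDiff ℝ ∞ (coframeCoeff c j) := by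
  unfold coframeCoeff
  split_ifs
  exacts [contDiff_contactComp 0 j, contDiff_towerComp 0 c j]

lemma contDiff_coframe (c : ℝ) (j : ℕ) {v : VField 9} (hv : ContDiff ℝ ∞ v) :
    ContDiff ℝ ∞ (fun x => coframe c j x (v x)) := by
  have h (k : ℕ) : ContDiff ℝ ∞ (fun x => coordL k (v x)) := (coordL k).contDiff.comp hv
  exact (h _).sub ((h _).mul (contDiff_coframeCoeff c j))

lemma coframe_eq_zero {c : ℝ} {j : ℕ} (hj : j ≤ 7) {x f : Coord 9} (hf : f ∈ flag 0 c 0 x) :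
    coframe c j x f = 0 := by
  unfold coframe coframeRoot coframeCoeff
  have h := hf j (by omega)
  simp only [flagRoot, flagCoeff, zero_le, if_true] at h
  split_ifs with h1
  · have h0 := hf 0 (by omega)
    simp only [flagRoot, flagCoeff, zero_le, if_true] at h0
    rw [h, h0]
    have e1 : towerComp 0 c j x = coordL 5 x * coordL (j + 1) x := by
      simp [towerComp, show j ≠ 0 by omega, show j ≤ 3 by omega]
    have e2 : contactComp 0 j x = coordL (j + 1) x := by
      simp [contactComp, show j ≠ 0 by omega, show j ≤ 3 by omega]
    rw [e1, e2]
    simp [towerComp]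
    ring
  · rw [h]; ring

/-- Cartan's formula ω([f, v]) = f(ω(v)) - v(ω(f)) - dω(f, v) with ω(f) = 0, for ω = dx_j - W dx_r
and dω = -dW ∧ dx_r. -/
lemma coframe_bracket {c : ℝ} {j : ℕ} (hj : j ≤ 7) {f v : VField 9} (hf : ContDiff ℝ ∞ f)
    (hv : ContDiff ℝ ∞ v) (hff : ∀ x, f x ∈ flag 0 c 0 x) (x : Coord 9) :
    coframe c j x (VectorField.lieBracket ℝ f v x) =
      fderiv ℝ (fun y => coframe c j y (v y)) x (f x) +
        (coordL (coframeRoot j) (v x) * fderiv ℝ (coframeCoeff c j) x (f x) -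
          coordL (coframeRoot j) (f x) * fderiv ℝ (coframeCoeff c j) x (v x)) := by
  have hdf := hf.differentiable (by simp)
  have hdv := hv.differentiable (by simp)
  have hc (u : VField 9) (hu : Differentiable ℝ u) (k : ℕ) :
      Differentiable ℝ (fun y => coordL k (u y)) := (coordL k).differentiable.comp hu
  have hC : Differentiable ℝ (coframeCoeff c j) :=
    (contDiff_coframeCoeff c j).differentiable (by simp)
  have e : (fun y => coordL j (f y)) =
      fun y => coordL (coframeRoot j) (f y) * coframeCoeff c j y := by
    funext y
    have := coframe_eq_zero hj (hff y)
    unfold coframe at this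
    linarith
  unfold coframe
  rw [coordL_comp_bracket j (hdf x) (hdv x), coordL_comp_bracket _ (hdf x) (hdv x), e,
    fderiv_fun_sub (hc v hdv _ x) (((hc v hdv _).fun_mul hC) x), sub_apply,
    fderiv_mul_apply (hc v hdv _) hC, fderiv_mul_apply (hc f hdf _) hC]
  ring

lemma fderiv_apply_of_mem {c : ℝ} {x f : Coord 9} (hf : f ∈ flag 0 c 0 x) (g : Coord 9 → ℝ) :
    fderiv ℝ g x f = coordL 4 f * fderiv ℝ g x (tower 0 c x) +
      coordL 8 f * fderiv ℝ g x (unitVec 8) := by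
  conv_lhs => rw [eq_smul_of_mem_flag_zero hf]
  simp
  ring

/-- The correction term in the bracket formula is a multiple of the next form of the coframe. -/
lemma coframe_correction_mem {c : ℝ} {i j : ℕ} (hj : j ≤ 7) (h4 : j ≠ 4) {f v : VField 9}
    (hf : ContDiff ℝ ∞ f) (hv : ContDiff ℝ ∞ v) (hff : ∀ x, f x ∈ flag 0 c 0 x)
    (h : ∀ k ≤ 7, (fun x => coframe c k x (v x)) ∈ orderIdeal c (coframeWeight k - i)) :
    (fun x => coordL (coframeRoot j) (v x) * fderiv ℝ (coframeCoeff c j) x (f x) -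
      coordL (coframeRoot j) (f x) * fderiv ℝ (coframeCoeff c j) x (v x)) ∈
      orderIdeal c (coframeWeight j - (i + 1)) := by
  have hc (u : VField 9) (hu : ContDiff ℝ ∞ u) (k : ℕ) :
      ContDiff ℝ ∞ (fun y => coordL k (u y)) := (coordL k).contDiff.comp hu
  have hfj (x : Coord 9) (k : ℕ) (hk : k ≤ 7) :
      coordL k (f x) = coordL 4 (f x) * towerComp 0 c k x := by
    simpa [flagRoot, flagCoeff] using hff x k (by omega)
  have step : ∀ k ≤ 7, ∀ s : Coord 9 → ℝ, ContDiff ℝ ∞ s →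
      (fun x => (s x * coordL 4 (f x)) * coframe c k x (v x)) ∈
        orderIdeal c (coframeWeight k - i) :=
    fun k hk s hs => mul_mem_orderIdeal (hs.mul (hc f hf 4)) (h k hk)
  have step5 : ∀ k ≤ 7, (fun x => coordL 5 x * ((-1 * coordL 4 (f x)) * coframe c k x (v x))) ∈
        orderIdeal c (coframeWeight k - i + 2) :=
    fun k hk => coordL_five_mul_mem_orderIdeal (step k hk (fun _ => -1) contDiff_const)
  -- With ω_k for `coframe c k`, the corrections for j = 0, 5, 6 are -f_4 times ω_5(v), ω_6(v),
  -- ω_7(v). For j = 3 it is f_4 ω_0(v), and for j = 2, 1 it is -f_4 x_5 times ω_3(v), ω_2(v). So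
  -- the weights grow by 1 along 7, 6, 5, 0, 3 and by 1 + 2 along 3, 2, 1; for j = 7 no vanishing is
  -- required.
  obtain rfl | rfl | rfl | rfl | rfl | rfl | rfl :
    j = 0 ∨ j = 1 ∨ j = 2 ∨ j = 3 ∨ j = 5 ∨ j = 6 ∨ j = 7 := by omega
  · convert orderIdeal_anti c (show coframeWeight 0 - (i + 1) ≤ coframeWeight 5 - i by
      simp [coframeWeight]) (step 5 (by omega) (fun _ => -1) contDiff_const) using 2 with x
    simp [coframe, coframeRoot, coframeCoeff, fderiv_towerComp_zero, hfj x 5]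
    ring
  · convert orderIdeal_anti c (show coframeWeight 1 - (i + 1) ≤ coframeWeight 2 - i + 2 by
      simp [coframeWeight]; omega) (step5 2 (by omega)) using 2 with x
    simp [coframe, coframeRoot, coframeCoeff, fderiv_contactComp, hfj x 0, hfj x 2]
    simp [towerComp, contactComp]
    ring
  · convert orderIdeal_anti c (show coframeWeight 2 - (i + 1) ≤ coframeWeight 3 - i + 2 by
      simp [coframeWeight]; omega) (step5 3 (by omega)) using 2 with x
    simp [coframe, coframeRoot, coframeCoeff, fderiv_contactComp, hfj x 0, hfj x 3]
    simp [towerComp, contactComp]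
    ring
  · convert orderIdeal_anti c (show coframeWeight 3 - (i + 1) ≤ coframeWeight 0 - i by
      simp [coframeWeight]) (step 0 (by omega) (fun _ => 1) contDiff_const) using 2 with x
    simp [coframe, coframeRoot, coframeCoeff, fderiv_contactComp, hfj x 0]
    simp [towerComp]
    ring
  · convert orderIdeal_anti c (show coframeWeight 5 - (i + 1) ≤ coframeWeight 6 - i by
      simp [coframeWeight]) (step 6 (by omega) (fun _ => -1) contDiff_const) using 2 with x
    simp [coframe, coframeRoot, coframeCoeff, fderiv_towerComp_high, hfj x 6]
    ring
  · convert orderIdeal_anti c (show coframeWeight 6 - (i + 1) ≤ coframeWeight 7 - i by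
      simp [coframeWeight]) (step 7 (by omega) (fun _ => -1) contDiff_const) using 2 with x
    simp [coframe, coframeRoot, coframeCoeff, fderiv_towerComp_high, hfj x 7]
    ring
  · have : coframeWeight 7 - (i + 1) = 0 := by simp [coframeWeight]
    rw [this]
    have hW := contDiff_coframeCoeff c 7
    exact ((hc v hv _).mul (contDiff_fderiv_apply hW hf)).sub
      ((hc f hf _).mul (contDiff_fderiv_apply hW hv))

/-- A derivative along the distribution costs one order; truncated subtraction covers order 0, where
only smoothness is asked. -/
lemma fderiv_mem_orderIdeal {c : ℝ} {k : ℕ} {f : VField 9} (hf : ContDiff ℝ ∞ f)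
    (hff : ∀ x, f x ∈ flag 0 c 0 x) {g : Coord 9 → ℝ} (hg : g ∈ orderIdeal c k) :
    (fun x => fderiv ℝ g x (f x)) ∈ orderIdeal c (k - 1) := by
  cases k with
  | zero => exact contDiff_fderiv_apply hg hf
  | succ k =>
    simp only [fderiv_apply_of_mem (hff _) g]
    exact add_mem_orderIdeal
      (mul_mem_orderIdeal ((coordL 4).contDiff.comp hf) hg.2.2.2)
      (mul_mem_orderIdeal ((coordL 8).contDiff.comp hf) hg.2.2.1)

/-- The upper bound for the Lie flag: each bracket costs at most one order. While the order is still
positive, the form vanishes at the origin. -/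
lemma coframe_mem_orderIdeal_of_mem_lieModule {c : ℝ} : ∀ {i : ℕ} {v : VField 9},
    v ∈ lieModule univ (flag 0 c 0) i → ContDiff ℝ ∞ v ∧
      ∀ j ≤ 7, (fun x => coframe c j x (v x)) ∈ orderIdeal c (coframeWeight j - i)
  | 0, v, hv => by
    obtain ⟨h1, h2⟩ := mem_sections_univ.1 hv
    refine ⟨h1, fun j hj => ?_⟩
    simp only [coframe_eq_zero hj (h2 _)]
    exact zero_mem_orderIdeal c _
  | i + 1, v, hv => by
    have hadd : ∀ (a b : Coord 9) (j : ℕ) (x : Coord 9),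
        coframe c j x (a + b) = coframe c j x a + coframe c j x b := by
      intro a b j x; simp only [coframe, map_add]; ring
    obtain ⟨a, ha, b, hb, rfl⟩ := Submodule.mem_sup.1 hv
    obtain ⟨ha1, ha2⟩ := coframe_mem_orderIdeal_of_mem_lieModule ha
    have hb' : ContDiff ℝ ∞ b ∧
        ∀ j ≤ 7, (fun x => coframe c j x (b x)) ∈ orderIdeal c (coframeWeight j - (i + 1)) := by
      refine Submodule.span_induction ?_ ?_ ?_ ?_ hb
      · rintro _ ⟨f, hf, g, hg, rfl⟩
        obtain ⟨hf1, hf2⟩ := mem_sections_univ.1 hf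
        obtain ⟨hg1, hg2⟩ := coframe_mem_orderIdeal_of_mem_lieModule hg
        refine ⟨contDiff_lieBracket hf1 hg1, fun j hj => ?_⟩
        -- The form of index 4 is identically zero, because component 4 is its own root; it carries
        -- no condition.
        by_cases h4 : j = 4
        · subst h4
          have : coframeWeight 4 - (i + 1) = 0 := by simp [coframeWeight]
          rw [this]
          exact contDiff_coframe c 4 (contDiff_lieBracket hf1 hg1)
        · simp only [coframe_bracket hj hf1 hg1 hf2]
          refine add_mem_orderIdeal ?_ (coframe_correction_mem hj h4 hf1 hg1 hf2 hg2)
          have := fderiv_mem_orderIdeal hf1 hf2 (hg2 j hj)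
          rwa [Nat.sub_sub] at this
      · refine ⟨contDiff_const, fun j _ => ?_⟩
        simpa [coframe] using zero_mem_orderIdeal c _
      · intro a b _ _ ha hb
        refine ⟨ha.1.add hb.1, fun j hj => ?_⟩
        simp only [Pi.add_apply, hadd]
        exact add_mem_orderIdeal (ha.2 j hj) (hb.2 j hj)
      · intro r a _ ha
        refine ⟨ha.1.const_smul r, fun j hj => ?_⟩
        have e : (fun x => coframe c j x ((r • a) x)) = fun x => r * coframe c j x (a x) := by
          funext x; simp [coframe]; ring
        rw [e]
        exact mul_mem_orderIdeal contDiff_const (ha.2 j hj)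
    refine ⟨ha1.add hb'.1, fun j hj => ?_⟩
    simp only [Pi.add_apply, hadd]
    exact add_mem_orderIdeal (orderIdeal_anti c (by omega) (ha2 j hj)) (hb'.2 j hj)

/-! ### The Lie flag of the structures on `ℝ⁹`: generators -/

lemma lieModule_mono {n : ℕ} (U : Set (Coord n)) (D : PlaneField n) {i k : ℕ} (h : i ≤ k) :
    lieModule U D i ≤ lieModule U D k := by
  induction h with
  | refl => exact le_rfl
  | step _ ih => exact ih.trans le_sup_left

lemma bracket_mem_lieModule {n : ℕ} {U : Set (Coord n)} {D : PlaneField n} {i : ℕ}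
    {f v : VField n} (hf : f ∈ sections U D) (hv : v ∈ lieModule U D i) :
    VectorField.lieBracket ℝ f v ∈ lieModule U D (i + 1) :=
  Submodule.mem_sup_right (Submodule.subset_span ⟨f, hf, v, hv, rfl⟩)

lemma tower_mem_sections (c : ℝ) : tower 0 c ∈ sections univ (flag 0 c 0) :=
  flagField_mem_sections 0 c 0

lemma unitVec_eight_mem_sections (c : ℝ) :
    (fun _ => unitVec 8 : VField 9) ∈ sections univ (flag 0 c 0) :=
  unitVec_mem_sections c (by omega) (by simp [flagRoot])

/-- Through level 3 the field `flagField` is Y itself, a section of D, so the brackets generating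
the derived flag are also brackets of the Lie flag. -/
lemma newField_mem_lieModule (c : ℝ) {i : ℕ} (hi : i ≤ 3)
    (h : (fun _ => unitVec (8 - i) : VField 9) ∈ lieModule univ (flag 0 c 0) i) :
    newField 0 i ∈ lieModule univ (flag 0 c 0) (i + 1) := by
  have hY : flagField 0 c i = tower 0 c := by simp [flagField, hi]
  have hb := lieBracket_flagField (m := 0) c (i := i) (by omega)
  have h2 := Submodule.neg_mem _ (bracket_mem_lieModule (tower_mem_sections c) h)
  have e : newField 0 i = -VectorField.lieBracket ℝ (tower 0 c) (fun _ => unitVec (8 - i)) := by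
    rw [← hb, hY]
    funext x
    simp only [zero_add]
    exact VectorField.lieBracket_swap
  rwa [e]

lemma unitVec_mem_lieModule (c : ℝ) : ∀ i ≤ 3,
    (fun _ => unitVec (8 - i) : VField 9) ∈ lieModule univ (flag 0 c 0) i
  | 0, _ => unitVec_eight_mem_sections c
  | i + 1, hi => by
    have h := newField_mem_lieModule c (by omega) (unitVec_mem_lieModule c i (by omega))
    have e : 8 - (i + 1) = 0 + 7 - i := by omega
    simpa only [newField, if_neg (show i ≠ 3 by omega), e] using h

lemma contactField_mem_lieModule (c : ℝ) :
    contactField 0 ∈ lieModule univ (flag 0 c 0) 4 := by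
  simpa [newField] using newField_mem_lieModule c le_rfl (unitVec_mem_lieModule c 3 le_rfl)

lemma unitVec_three_mem_lieModule (c : ℝ) :
    (fun _ => unitVec 3 : VField 9) ∈ lieModule univ (flag 0 c 0) 5 := by
  have h := bracket_mem_lieModule (tower_mem_sections c) (contactField_mem_lieModule c)
  rwa [lieBracket_tower_contactField] at h

/-- The vector field `a ∂₂ + b ∂₁` on `ℝ⁹`. -/
def planarField (a b : Coord 9 → ℝ) : VField 9 := fun x => a x • unitVec 2 + b x • unitVec 1

lemma coordL_planarField {a b : Coord 9 → ℝ} {j : ℕ} (hj : j < 9) (x : Coord 9) :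
    coordL j (planarField a b x) = if j = 2 then a x else if j = 1 then b x else 0 := by
  rw [planarField, map_add, map_smul, map_smul, coordL_unitVec _ hj, coordL_unitVec _ hj]
  by_cases h2 : j = 2
  · simp [h2]
  · by_cases h1 : j = 1 <;> simp [h2, h1]

/-- The fields a ∂_2 + b ∂_1 are stable under ad Y: the coefficients of Y do not involve x_1, and
x_2 enters only as x_5 x_2 in component 1. The rest of the Lie flag thus becomes a recursion on (a,
b). -/
lemma lieBracket_tower_planarField (c : ℝ) {a b : Coord 9 → ℝ} (ha : Differentiable ℝ a)
    (hb : Differentiable ℝ b) :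
    VectorField.lieBracket ℝ (tower 0 c) (planarField a b) =
      planarField (fun x => fderiv ℝ a x (tower 0 c x))
        (fun x => fderiv ℝ b x (tower 0 c x) - coordL 5 x * a x) := by
  have hd : Differentiable ℝ (planarField a b) :=
    (ha.smul_const _).add (hb.smul_const _)
  funext x
  apply ext_coordL
  intro j hj
  rw [coordL_comp_bracket j ((contDiff_tower 0 c).differentiable (by simp) x) (hd x),
    coordL_planarField hj]
  simp only [coordL_planarField hj, coordL_tower]
  have hz (k : ℕ) (h2 : k ≠ 2) (h1 : k ≠ 1) : coordL k (planarField a b x) = 0 := by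
    by_cases hk : k < 9
    · rw [coordL_planarField hk]; simp [h1, h2]
    · exact coordL_of_le (by omega) _
  by_cases h0 : j = 0
  · subst h0
    rw [fderiv_towerComp_zero, hz _ (by omega) (by omega)]
    simp
  · by_cases h3 : j ≤ 3
    · rw [fderiv_towerComp_low c h0 (by omega), hz 5 (by omega) (by omega)]
      obtain rfl | rfl | rfl : j = 1 ∨ j = 2 ∨ j = 3 := by omega
      · simp [coordL_planarField]
      · simp [coordL_planarField]
      · simp [coordL_planarField]
    · have h : fderiv ℝ (towerComp 0 c j) x (planarField a b x) = 0 := by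
        by_cases h4 : j = 4
        · subst h4
          rw [fderiv_towerComp_mid]
        · rw [fderiv_towerComp_high c (by omega), hz _ (by omega) (by omega)]
      rw [h]
      simp [show j ≠ 2 by omega, show j ≠ 1 by omega]

lemma lieBracket_unitVec_planarField {a b : Coord 9 → ℝ} (k : ℕ) (ha : Differentiable ℝ a)
    (hb : Differentiable ℝ b) :
    VectorField.lieBracket ℝ (fun _ => unitVec k) (planarField a b) =
      planarField (fun x => fderiv ℝ a x (unitVec k)) (fun x => fderiv ℝ b x (unitVec k)) := by
  funext x
  rw [lieBracket_const_apply]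
  unfold planarField
  rw [fderiv_fun_add ((ha x).smul_const _) ((hb x).smul_const _), fderiv_smul_const (ha x),
    fderiv_smul_const (hb x)]
  simp

lemma planarField_bracket_mem_lieModule {c : ℝ} {i : ℕ} {a b a' b' : Coord 9 → ℝ}
    (h : planarField a b ∈ lieModule univ (flag 0 c 0) i) (ha : Differentiable ℝ a)
    (hb : Differentiable ℝ b) (ha' : ∀ x, fderiv ℝ a x (tower 0 c x) = a' x)
    (hb' : ∀ x, fderiv ℝ b x (tower 0 c x) - coordL 5 x * a x = b' x) :
    planarField a' b' ∈ lieModule univ (flag 0 c 0) (i + 1) := by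
  have := bracket_mem_lieModule (tower_mem_sections c) h
  rwa [lieBracket_tower_planarField c ha hb, funext ha', funext hb'] at this

lemma planarField_deriv_mem_lieModule {c : ℝ} {i : ℕ} {a b a' b' : Coord 9 → ℝ}
    (h : planarField a b ∈ lieModule univ (flag 0 c 0) i) (ha : Differentiable ℝ a)
    (hb : Differentiable ℝ b) (ha' : ∀ x, fderiv ℝ a x (unitVec 8) = a' x)
    (hb' : ∀ x, fderiv ℝ b x (unitVec 8) = b' x) :
    planarField a' b' ∈ lieModule univ (flag 0 c 0) (i + 1) := by
  have := bracket_mem_lieModule (unitVec_eight_mem_sections c) h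
  rwa [lieBracket_unitVec_planarField 8 ha hb, funext ha', funext hb'] at this

lemma planarField_six_mem_lieModule (c : ℝ) :
    planarField (fun x => -coordL 5 x) (fun _ => 0) ∈ lieModule univ (flag 0 c 0) 6 := by
  have h := bracket_mem_lieModule (tower_mem_sections c) (unitVec_three_mem_lieModule c)
  convert h using 1
  funext x
  rw [VectorField.lieBracket_swap, lieBracket_const_apply]
  apply ext_coordL
  intro j hj
  rw [map_neg, coordL_fderiv j ((contDiff_tower 0 c).differentiable (by simp) x),
    coordL_planarField hj]
  simp only [coordL_tower]
  by_cases h0 : j = 0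
  · subst h0
    rw [fderiv_towerComp_zero, coordL_unitVec_ne (by omega)]; simp
  · by_cases h3 : j ≤ 3
    · rw [fderiv_towerComp_low c h0 (by omega), coordL_unitVec_ne (show 0 + 5 ≠ 3 by omega),
        coordL_unitVec _ (by omega)]
      by_cases h2 : j = 2 <;> simp [h2]
    · rw [if_neg (by omega), if_neg (by omega)]
      by_cases h4 : j = 4
      · subst h4
        rw [fderiv_towerComp_mid, neg_zero]
      · rw [fderiv_towerComp_high c (by omega), coordL_unitVec_ne (by omega), neg_zero]

lemma fderiv_coordL_five (c : ℝ) (x : Coord 9) :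
    fderiv ℝ (fun y : Coord 9 => coordL 5 y) x (tower 0 c x) = coordL 6 x := by
  rw [fderiv_coordL_tower]; simp [towerComp]

lemma fderiv_coordL_six (c : ℝ) (x : Coord 9) :
    fderiv ℝ (fun y : Coord 9 => coordL 6 y) x (tower 0 c x) = coordL 7 x + 1 := by
  rw [fderiv_coordL_tower]; simp [towerComp]

lemma fderiv_coordL_seven (c : ℝ) (x : Coord 9) :
    fderiv ℝ (fun y : Coord 9 => coordL 7 y) x (tower 0 c x) = coordL 8 x + c := by
  rw [fderiv_coordL_tower]; simp [towerComp]

lemma fderiv_coordL_eight (c : ℝ) (x : Coord 9) :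
    fderiv ℝ (fun y : Coord 9 => coordL 8 y) x (tower 0 c x) = 0 := by
  rw [fderiv_coordL_tower]; simp [towerComp, coordL_of_le]

/-- Two more brackets with Y turn x_5 into x_6 and then into x_7 + 1, the first coefficient of ∂_2
that is nonzero at the origin. -/
lemma planarField_eight_mem_lieModule (c : ℝ) :
    planarField (fun x => -(coordL 7 x + 1)) (fun x => 3 * (coordL 5 x * coordL 6 x)) ∈
      lieModule univ (flag 0 c 0) 8 := by
  have h7 : planarField (fun x => -coordL 6 x) (fun x => coordL 5 x * coordL 5 x) ∈
      lieModule univ (flag 0 c 0) 7 := by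
    refine planarField_bracket_mem_lieModule (planarField_six_mem_lieModule c) (by fun_prop)
      (by fun_prop) (fun x => ?_) fun x => ?_
    · rw [fderiv_fun_neg, neg_apply, fderiv_coordL_five]
    · simp
  refine planarField_bracket_mem_lieModule h7 (by fun_prop) (by fun_prop) (fun x => ?_) fun x => ?_
  · rw [fderiv_fun_neg, neg_apply, fderiv_coordL_six]
  · rw [fderiv_mul_apply (by fun_prop) (by fun_prop), fderiv_coordL_five]
    ring

lemma planarField_nine_mem_lieModule (c : ℝ) :
    planarField (fun x => -(coordL 8 x + c))
      (fun x => 3 * (coordL 6 x * coordL 6 x) + 4 * (coordL 5 x * (coordL 7 x + 1))) ∈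
      lieModule univ (flag 0 c 0) 9 := by
  refine planarField_bracket_mem_lieModule (planarField_eight_mem_lieModule c) (by fun_prop)
    (by fun_prop) (fun x => ?_) fun x => ?_
  · rw [fderiv_fun_neg, neg_apply, fderiv_add_const, fderiv_coordL_seven]
  · rw [fderiv_const_mul (by fun_prop), smul_apply, fderiv_mul_apply (by fun_prop) (by fun_prop),
      fderiv_coordL_five, fderiv_coordL_six, smul_eq_mul]
    ring

/-- Constant c makes the coefficient of ∂_2 die after step nine, and at the origin step eleven is 10
∂_1 whatever c is. -/
lemma planarField_eleven_mem_lieModule (c : ℝ) :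
    planarField (fun _ => 0)
      (fun x => 10 * ((coordL 7 x + 1) * (coordL 7 x + 1)) +
        15 * (coordL 6 x * (coordL 8 x + c))) ∈
      lieModule univ (flag 0 c 0) 11 := by
  have h10 : planarField (fun _ => 0)
      (fun x => 10 * (coordL 6 x * (coordL 7 x + 1)) + 5 * (coordL 5 x * (coordL 8 x + c))) ∈
      lieModule univ (flag 0 c 0) 10 := by
    refine planarField_bracket_mem_lieModule (planarField_nine_mem_lieModule c) (by fun_prop)
      (by fun_prop) (fun x => ?_) fun x => ?_
    · rw [fderiv_fun_neg, neg_apply, fderiv_add_const, fderiv_coordL_eight, neg_zero]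
    · rw [fderiv_fun_add (by fun_prop) (by fun_prop), add_apply, fderiv_const_mul (by fun_prop),
        fderiv_const_mul (by fun_prop), smul_apply, smul_apply,
        fderiv_mul_apply (by fun_prop) (by fun_prop), fderiv_mul_apply (by fun_prop) (by fun_prop),
        fderiv_add_const, fderiv_coordL_five, fderiv_coordL_six, fderiv_coordL_seven, smul_eq_mul,
        smul_eq_mul]
      ring
  refine planarField_bracket_mem_lieModule h10 (by fun_prop) (by fun_prop) (fun x => ?_) fun x => ?_
  · simp
  · rw [fderiv_fun_add (by fun_prop) (by fun_prop), add_apply, fderiv_const_mul (by fun_prop),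
      fderiv_const_mul (by fun_prop), smul_apply, smul_apply,
      fderiv_mul_apply (by fun_prop) (by fun_prop), fderiv_mul_apply (by fun_prop) (by fun_prop),
      fderiv_add_const, fderiv_add_const, fderiv_coordL_five, fderiv_coordL_six,
      fderiv_coordL_seven, fderiv_coordL_eight, smul_eq_mul, smul_eq_mul]
    ring

lemma fderiv_coordL_unitVec_eight {k : ℕ} (hk : k ≠ 8) (x : Coord 9) :
    fderiv ℝ (fun y : Coord 9 => coordL k y) x (unitVec 8) = 0 := by
  rw [fderiv_coordL, coordL_unitVec_ne hk]

/-- The coefficients found above vanish at some points away from 0; bracketing with X = ∂_8 gives a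
field constant in space. -/
lemma planarField_neg_one_mem_lieModule (c : ℝ) :
    planarField (fun _ => -1) (fun _ => 0) ∈ lieModule univ (flag 0 c 0) 10 := by
  refine planarField_deriv_mem_lieModule (planarField_nine_mem_lieModule c) (by fun_prop)
    (by fun_prop) (fun x => ?_) fun x => ?_
  · rw [fderiv_fun_neg, neg_apply, fderiv_add_const, fderiv_coordL, coordL_unitVec _ (by omega)]
    simp
  · rw [fderiv_fun_add (by fun_prop) (by fun_prop), add_apply, fderiv_const_mul (by fun_prop),
      fderiv_const_mul (by fun_prop), smul_apply, smul_apply,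
      fderiv_mul_apply (by fun_prop) (by fun_prop), fderiv_mul_apply (by fun_prop) (by fun_prop),
      fderiv_add_const, fderiv_coordL_unitVec_eight (by omega),
      fderiv_coordL_unitVec_eight (by omega), fderiv_coordL_unitVec_eight (by omega)]
    simp

/-- Starting from -∂_2, brackets with Y give x_5 ∂_1, x_6 ∂_1, (x_7 + 1) ∂_1, (x_8 + c) ∂_1, and X
then gives ∂_1 at every point. -/
lemma planarField_zero_one_mem_lieModule (c : ℝ) :
    planarField (fun _ => 0) (fun _ => 1) ∈ lieModule univ (flag 0 c 0) 15 := by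
  have h11 : planarField (fun _ => 0) (fun x => coordL 5 x) ∈
      lieModule univ (flag 0 c 0) 11 :=
    planarField_bracket_mem_lieModule (planarField_neg_one_mem_lieModule c) (by fun_prop)
      (by fun_prop) (fun x => by simp) fun x => by simp
  have h12 : planarField (fun _ => 0) (fun x => coordL 6 x) ∈
      lieModule univ (flag 0 c 0) 12 :=
    planarField_bracket_mem_lieModule h11 (by fun_prop)
      (by fun_prop) (fun x => by simp) fun x => by rw [fderiv_coordL_five]; simp
  have h13 : planarField (fun _ => 0) (fun x => coordL 7 x + 1) ∈
      lieModule univ (flag 0 c 0) 13 :=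
    planarField_bracket_mem_lieModule h12 (by fun_prop)
      (by fun_prop) (fun x => by simp) fun x => by rw [fderiv_coordL_six]; simp
  have h14 : planarField (fun _ => 0) (fun x => coordL 8 x + c) ∈
      lieModule univ (flag 0 c 0) 14 :=
    planarField_bracket_mem_lieModule h13 (by fun_prop)
      (by fun_prop) (fun x => by simp) fun x => by
        rw [fderiv_add_const, fderiv_coordL_seven]; simp
  refine planarField_deriv_mem_lieModule h14 (by fun_prop)
      (by fun_prop) (fun x => by simp) fun x => ?_
  rw [fderiv_add_const, fderiv_coordL, coordL_unitVec _ (by omega)]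
  simp

/-! ### Complete nonholonomy and the growth vector at the origin. -/

lemma mem_lieFlag_of_mem_lieModule {n : ℕ} {U : Set (Coord n)} {D : PlaneField n} {i k : ℕ}
    (h : k ≤ i) {f : VField n} (hf : f ∈ lieModule U D k) (p : Coord n) :
    f p ∈ lieFlag U D i p := ⟨f, lieModule_mono U D h hf, rfl⟩

/-- The decomposition of a vector along the adapted frame. -/
lemma eq_sum_coframe (c : ℝ) (x v : Coord 9) :
    v = coordL 4 v • tower 0 c x + coframe c 0 x v • contactField 0 x + coordL 8 v • unitVec 8 +
      coframe c 7 x v • unitVec 7 + coframe c 6 x v • unitVec 6 + coframe c 5 x v • unitVec 5 +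
      coframe c 3 x v • unitVec 3 + coframe c 2 x v • unitVec 2 + coframe c 1 x v • unitVec 1 := by
  apply ext_coordL
  intro j hj
  simp only [map_add, map_smul, smul_eq_mul, coordL_tower, coordL_contactField,
    coordL_unitVec _ hj]
  interval_cases j <;>
    simp [coframe, coframeRoot, coframeCoeff, towerComp, contactComp, coordL_of_le]
  all_goals ring

theorem isCompletelyNonholonomic_flag (c : ℝ) :
    IsCompletelyNonholonomic univ (flag 0 c 0) := by
  intro p _
  -- At level 15 all generators are available at every point; the value is not sharp, and 11
  -- suffices at the origin.
  refine ⟨15, eq_top_iff.2 fun v _ => ?_⟩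
  have hu (k : ℕ) (hk : k ≤ 3) : unitVec (8 - k) ∈ lieFlag univ (flag 0 c 0) 15 p :=
    mem_lieFlag_of_mem_lieModule (by omega) (unitVec_mem_lieModule c k hk) p
  have h2 := Submodule.neg_mem _
    (mem_lieFlag_of_mem_lieModule (show 10 ≤ 15 by omega) (planarField_neg_one_mem_lieModule c) p)
  have h1 := mem_lieFlag_of_mem_lieModule le_rfl (planarField_zero_one_mem_lieModule c) p
  have h3 := mem_lieFlag_of_mem_lieModule (show 5 ≤ 15 by omega) (unitVec_three_mem_lieModule c) p
  have hZ := mem_lieFlag_of_mem_lieModule (show 4 ≤ 15 by omega) (contactField_mem_lieModule c) p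
  have hY := mem_lieFlag_of_mem_lieModule (D := flag 0 c 0) (k := 0) (show 0 ≤ 15 by omega)
    (tower_mem_sections c) p
  simp only [planarField, neg_smul, one_smul, zero_smul, add_zero, neg_neg, zero_add] at h1 h2
  rw [eq_sum_coframe c p v]
  exact add_mem (add_mem (add_mem (add_mem (add_mem (add_mem (add_mem (add_mem
    (Submodule.smul_mem _ _ hY) (Submodule.smul_mem _ _ hZ)) (Submodule.smul_mem _ _ (hu 0 (by omega))))
    (Submodule.smul_mem _ _ (hu 1 (by omega)))) (Submodule.smul_mem _ _ (hu 2 (by omega))))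
    (Submodule.smul_mem _ _ (hu 3 (by omega)))) (Submodule.smul_mem _ _ h3))
    (Submodule.smul_mem _ _ h2)) (Submodule.smul_mem _ _ h1)

/-- The Lie flag at the origin, in equations. -/
theorem mem_lieFlag_zero_iff (c : ℝ) (i : ℕ) (v : Coord 9) :
    v ∈ lieFlag univ (flag 0 c 0) i 0 ↔ ∀ j ≤ 7, i < coframeWeight j → coframe c j 0 v = 0 := by
  constructor
  · rintro ⟨f, hf, rfl⟩ j hj hi
    have h := (coframe_mem_orderIdeal_of_mem_lieModule hf).2 j hj
    obtain ⟨k, hk⟩ : ∃ k, coframeWeight j - i = k + 1 := ⟨coframeWeight j - i - 1, by omega⟩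
    rw [hk] at h
    exact h.2.1
  · intro h
    have key (j : ℕ) (hj : j ≤ 7) (w : Coord 9)
        (hw : coframeWeight j ≤ i → w ∈ lieFlag univ (flag 0 c 0) i 0) :
        coframe c j 0 v • w ∈ lieFlag univ (flag 0 c 0) i 0 := by
      by_cases hi : i < coframeWeight j
      · rw [h j hj hi, zero_smul]; exact Submodule.zero_mem _
      · exact Submodule.smul_mem _ _ (hw (by omega))
    have hu (k : ℕ) (hk : k ≤ 3) (hki : k ≤ i) : unitVec (8 - k) ∈ lieFlag univ (flag 0 c 0) i 0 :=
      mem_lieFlag_of_mem_lieModule hki (unitVec_mem_lieModule c k hk) 0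
    have hY := mem_lieFlag_of_mem_lieModule (D := flag 0 c 0) (k := 0) (Nat.zero_le i)
      (tower_mem_sections c) 0
    rw [eq_sum_coframe c 0 v]
    refine add_mem (add_mem (add_mem (add_mem (add_mem (add_mem (add_mem (add_mem
      (Submodule.smul_mem _ _ hY) (key 0 (by omega) _ fun hi =>
        mem_lieFlag_of_mem_lieModule hi (contactField_mem_lieModule c) 0))
      (Submodule.smul_mem _ _ (hu 0 (by omega) (by omega))))
      (key 7 (by omega) _ fun hi => hu 1 (by omega) hi))
      (key 6 (by omega) _ fun hi => hu 2 (by omega) hi))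
      (key 5 (by omega) _ fun hi => hu 3 (by omega) hi))
      (key 3 (by omega) _ fun hi =>
        mem_lieFlag_of_mem_lieModule hi (unitVec_three_mem_lieModule c) 0))
      (key 2 (by omega) _ fun hi => ?_)) (key 1 (by omega) _ fun hi => ?_)
    -- This is an alternative scaling of the two planar generators: at the origin step eleven equals
    -- 10 ∂_1, hence the factor 1/10.
    · have := Submodule.neg_mem _
        (mem_lieFlag_of_mem_lieModule hi (planarField_eight_mem_lieModule c) 0)
      simpa [planarField] using this
    · have := Submodule.smul_mem _ ((10 : ℝ)⁻¹)
        (mem_lieFlag_of_mem_lieModule hi (planarField_eleven_mem_lieModule c) 0)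
      simpa [planarField, smul_smul] using this

/-- The shear `v ↦ v + c v₄ ∂₇`. -/
noncomputable def shear (c : ℝ) : Coord 9 ≃ₗ[ℝ] Coord 9 where
  toFun v := v + (c * coordL 4 v) • unitVec 7
  map_add' a b := by rw [map_add, mul_add, add_smul]; abel
  map_smul' r a := by simp [smul_smul]; ring_nf
  invFun v := v - (c * coordL 4 v) • unitVec 7
  left_inv v := by simp [coordL_unitVec_ne (show 4 ≠ 7 by omega)]
  right_inv v := by simp [coordL_unitVec_ne (show 4 ≠ 7 by omega)]

/-- At the origin c enters the coframe only through dx_7 - c dx_4, and the shear absorbs this term.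
-/
lemma lieFlag_zero_eq_comap (c : ℝ) (i : ℕ) :
    lieFlag univ (flag 0 0 0) i 0 =
      (lieFlag univ (flag 0 c 0) i 0).comap (shear c).toLinearMap := by
  ext v
  rw [Submodule.mem_comap, mem_lieFlag_zero_iff, mem_lieFlag_zero_iff]
  have e : ∀ j ≤ 7, coframe 0 j 0 v = coframe c j 0 (shear c v) := by
    intro j hj
    have h4 : coordL 4 (unitVec 7 : Coord 9) = 0 := coordL_unitVec_ne (by omega)
    have h0 : coordL 0 (unitVec 7 : Coord 9) = 0 := coordL_unitVec_ne (by omega)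
    simp only [coframe, shear, LinearEquiv.coe_mk, LinearMap.coe_mk, AddHom.coe_mk, map_add,
      map_smul, coordL_unitVec (n := 9) 7 (show j < 9 by omega)]
    interval_cases j <;>
      simp [coframeRoot, coframeCoeff, towerComp, contactComp, h4, h0]
    all_goals ring
  exact forall₂_congr fun j hj => by rw [e j hj]; rfl

theorem growthVector_flag (c : ℝ) :
    growthVector univ (flag 0 0 0) 0 = growthVector univ (flag 0 c 0) (0 : Coord 9) := by
  have h1 (i : ℕ) : Module.finrank ℝ (lieFlag univ (flag 0 0 0) i (0 : Coord 9)) =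
      Module.finrank ℝ (lieFlag univ (flag 0 c 0) i (0 : Coord 9)) := by
    rw [lieFlag_zero_eq_comap c, Submodule.comap_equiv_eq_map_symm]
    exact LinearEquiv.finrank_map_eq _ _
  have h2 (i : ℕ) : lieFlag univ (flag 0 0 0) i (0 : Coord 9) = ⊤ ↔
      lieFlag univ (flag 0 c 0) i (0 : Coord 9) = ⊤ := by
    constructor <;> intro h <;> apply Submodule.eq_top_of_finrank_eq
    · rw [← h1, h, finrank_top]
    · rw [h1, h, finrank_top]
  unfold growthVector nonholonomyDegree
  simp only [h1, h2]

/-! ### Absolutely continuous functions -/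

lemma absolutelyContinuousOnInterval_coordL {n : ℕ} {x : ℝ → Coord n} {a b : ℝ}
    (h : AbsolutelyContinuousOnInterval x a b) (k : ℕ) :
    AbsolutelyContinuousOnInterval (fun t => coordL k (x t)) a b := by
  refine squeeze_zero (fun t => Finset.sum_nonneg fun i _ => dist_nonneg)
    (fun t => Finset.sum_le_sum fun i _ => ?_) h
  beta_reduce
  by_cases hk : k < n
  · rw [coordL_apply hk, coordL_apply hk]
    exact dist_le_pi_dist _ _ _
  · rw [coordL_of_le (not_lt.mp hk), coordL_of_le (not_lt.mp hk), dist_self]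
    exact dist_nonneg

/-- Local absolute continuity of a real function on an interval. -/
def IsAbsContReal (I : Set ℝ) (g : ℝ → ℝ) : Prop :=
  ∀ a ∈ I, ∀ b ∈ I, AbsolutelyContinuousOnInterval g a b

lemma IsAbsCont.coordL {n : ℕ} {I : Set ℝ} {x : ℝ → Coord n} (h : IsAbsCont I x) (k : ℕ) :
    IsAbsContReal I (fun t => coordL k (x t)) := fun a ha b hb =>
  absolutelyContinuousOnInterval_coordL (h a ha b hb) k

lemma IsAbsContReal.mul {I : Set ℝ} {f g : ℝ → ℝ} (hf : IsAbsContReal I f)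
    (hg : IsAbsContReal I g) : IsAbsContReal I (fun t => f t * g t) := fun a ha b hb =>
  (hf a ha b hb).fun_mul (hg a ha b hb)

lemma isAbsContReal_const (I : Set ℝ) (r : ℝ) : IsAbsContReal I (fun _ => r) := fun a _ b _ => by
  refine squeeze_zero (fun t => Finset.sum_nonneg fun i _ => dist_nonneg)
    (fun t => (Finset.sum_le_sum fun i _ => (dist_self r).le).trans (by simp)) tendsto_const_nhds

lemma isAbsContReal_sum {ι : Type*} {I : Set ℝ} (s : Finset ι) {f : ι → ℝ → ℝ}
    (h : ∀ i ∈ s, IsAbsContReal I (f i)) : IsAbsContReal I (fun t => ∑ i ∈ s, f i t) := by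
  classical
  induction s using Finset.induction_on with
  | empty => simpa using isAbsContReal_const I 0
  | insert i s hi ih =>
    simp only [Finset.sum_insert hi]
    exact fun a ha b hb => (h i (by simp) a ha b hb).fun_add
      (ih (fun j hj => h j (by simp [hj])) a ha b hb)

/-- An absolutely continuous function `g` with `g g' = 0` vanishes everywhere or nowhere. -/
lemma IsAbsContReal.eq_zero_or_ne_zero {I : Set ℝ} (hI : I.OrdConnected) {g : ℝ → ℝ}
    (hg : IsAbsContReal I g)
    (h : ∀ᵐ t ∂(volume.restrict I), ∃ d, HasDerivAt g d t ∧ g t * d = 0) :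
    (∀ t ∈ I, g t = 0) ∨ ∀ t ∈ I, g t ≠ 0 := by
  by_contra! hc
  obtain ⟨⟨s, hs, hgs⟩, t, ht, hgt⟩ := hc
  rw [ae_restrict_iff' hI.measurableSet] at h
  -- The absolutely continuous function g² has derivative zero almost everywhere, so it is constant.
  obtain ⟨C, hC⟩ := (hg.mul hg s hs t ht).const_of_ae_hasDerivAt_zero (by
    filter_upwards [h] with r hr hrm
    obtain ⟨d, hd, hz⟩ := hr (hI.uIcc_subset hs ht hrm)
    have := hd.mul hd
    have e : d * g r + g r * d = 0 := by linarith
    rwa [e] at this)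
  have h1 := hC s left_mem_uIcc
  have h2 := hC t right_mem_uIcc
  rw [hgt, mul_zero] at h2
  rw [← h2] at h1
  exact hgs (mul_self_eq_zero.1 h1)

/-- A nondegenerate interval has unique derivatives, also at its end points. -/
lemma hasDerivAt_eq_zero_of_eqOn_zero {I : Set ℝ} (hI : I.OrdConnected) (hn : I.Nontrivial)
    {g : ℝ → ℝ} (hg : ∀ t ∈ I, g t = 0) {t d : ℝ} (ht : t ∈ I) (hd : HasDerivAt g d t) :
    d = 0 := by
  obtain ⟨a, ha, b, hb, hab⟩ := hn.exists_lt
  have hu : UniqueDiffWithinAt ℝ I t := uniqueDiffOn_convex hI.convex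
    ⟨(a + b) / 2, interior_mono (hI.out ha hb) (by rw [interior_Icc]; constructor <;> linarith)⟩
    t ht
  exact hu.eq_deriv _ hd.hasDerivWithinAt
    ((hasDerivWithinAt_const t I (0 : ℝ)).congr hg (hg t ht))

/-! ### Abnormal curves -/

lemma dotProduct_unitVec {n : ℕ} (p : Coord n) {k : ℕ} (hk : k < n) :
    p ⬝ᵥ (unitVec k : Coord n) = coordL k p := by
  have : (unitVec k : Coord n) = Pi.single ⟨k, hk⟩ 1 := by
    funext j; simp [unitVec, Pi.single_apply, Fin.ext_iff]
  rw [this, dotProduct_single, mul_one, coordL_apply hk]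

lemma hamiltonian_eq {n k : ℕ} (f : Fin k → VField n) (x p : Coord n) (u : Fin k → ℝ) :
    hamiltonian f x p u = p ⬝ᵥ ∑ i, u i • f i x := rfl

lemma fderiv_dotProduct {n : ℕ} (p : Coord n) {V : VField n} {x : Coord n}
    (hV : DifferentiableAt ℝ V x) (a : Coord n) :
    fderiv ℝ (fun y => p ⬝ᵥ V y) x a = p ⬝ᵥ fderiv ℝ V x a := by
  let L : Coord n →L[ℝ] ℝ := ∑ j, p j • ContinuousLinearMap.proj j
  have hL (w : Coord n) : L w = p ⬝ᵥ w := by simp [L, dotProduct]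
  have : (fun y => p ⬝ᵥ V y) = fun y => L (V y) := by funext y; rw [hL]
  rw [this, ← hL]
  exact congrArg (fun T => T a) (L.hasFDerivAt.comp x hV.hasFDerivAt).fderiv

/-- The equations of an abnormal extremal at one time, for a frame of the flag. -/
lemma extremal_equations {m k : ℕ} {c : ℝ} {W : Set (Coord (m + 9))} (hW : IsOpen W)
    {f : Fin k → VField (m + 9)} (hf : IsFrameOn W (flag m c 0) f) {x p : ℝ → Coord (m + 9)}
    {u : Fin k → ℝ} {t : ℝ} (hx : x t ∈ W)
    (h1 : HasDerivAt x
      (fun a => fderiv ℝ (fun q => hamiltonian f (x t) q u) (p t) (Pi.single a 1)) t)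
    (h2 : HasDerivAt p
      (fun a => -fderiv ℝ (fun y => hamiltonian f y (p t) u) (x t) (Pi.single a 1)) t)
    (h3 : fderiv ℝ (fun v => hamiltonian f (x t) (p t) v) u = 0) :
    ∃ F ∈ flag m c 0 (x t), HasDerivAt x F t ∧ (∀ w ∈ flag m c 0 (x t), p t ⬝ᵥ w = 0) ∧
      ∀ a < m + 9, HasDerivAt (fun s => coordL a (p s))
        (-(coordL (m + 4) F * (p t ⬝ᵥ fderiv ℝ (tower m c) (x t) (unitVec a)))) t := by
  set F : VField (m + 9) := fun y => ∑ i, u i • f i y with hF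
  have hspan := (hf.2 (x t) hx).2
  have hFm : ∀ y ∈ W, F y ∈ flag m c 0 y := fun y hy => by
    rw [← (hf.2 y hy).2]
    exact Submodule.sum_mem _ fun i _ => Submodule.smul_mem _ _ (Submodule.subset_span ⟨i, rfl⟩)
  have hFd : DifferentiableAt ℝ F (x t) := by
    refine DifferentiableAt.fun_sum fun i _ => ?_
    exact (((hf.1 i).contDiffAt (hW.mem_nhds hx)).differentiableAt (by simp)).const_smul (u i)
  have hp : ∀ w ∈ flag m c 0 (x t), p t ⬝ᵥ w = 0 := by
    intro w hw
    rw [← hspan] at hw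
    refine Submodule.span_induction ?_ (by simp) (fun a b _ _ ha hb => by
      rw [dotProduct_add, ha, hb, add_zero]) (fun r a _ ha => by
      rw [dotProduct_smul, ha, smul_zero]) hw
    rintro _ ⟨i, rfl⟩
    have hlin : (fun v => hamiltonian f (x t) (p t) v) =
        fun v => (∑ j, (p t ⬝ᵥ f j (x t)) •
          (ContinuousLinearMap.proj j : (Fin k → ℝ) →L[ℝ] ℝ)) v := by
      funext v
      simp only [hamiltonian_eq, dotProduct_sum, dotProduct_smul, sum_apply,
        smul_apply, smul_eq_mul, ContinuousLinearMap.proj_apply]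
      exact Finset.sum_congr rfl fun j _ => mul_comm _ _
    rw [hlin, ContinuousLinearMap.fderiv] at h3
    have := congrArg (fun T => T (Pi.single i 1)) h3
    simpa [sum_apply, Pi.single_apply] using this
  refine ⟨F (x t), hFm _ hx, ?_, hp, ?_⟩
  · convert h1 using 1
    funext a
    have hlin : (fun q => hamiltonian f (x t) q u) =
        fun q => (∑ j, F (x t) j • (ContinuousLinearMap.proj j : Coord (m + 9) →L[ℝ] ℝ)) q := by
      funext q
      simp only [hamiltonian_eq, dotProduct, sum_apply, smul_apply,
        smul_eq_mul, ContinuousLinearMap.proj_apply, hF]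
      exact Finset.sum_congr rfl fun j _ => mul_comm _ _
    rw [hlin, ContinuousLinearMap.fderiv]
    simp [Pi.single_apply]
  · intro a ha
    have h : HasDerivAt (fun s => coordL a (p s)) (coordL a fun b : Fin (m + 9) =>
        -fderiv ℝ (fun y => hamiltonian f y (p t) u) (x t) (Pi.single b 1)) t :=
      (coordL (n := m + 9) a).hasFDerivAt.comp_hasDerivAt t h2
    refine h.congr_deriv ?_
    rw [coordL_apply ha, neg_inj]
    have hsingle : (Pi.single ⟨a, ha⟩ 1 : Coord (m + 9)) = unitVec a := by
      funext j; simp [unitVec, Pi.single_apply, Fin.ext_iff]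
    -- Any frame gives H = F_{m+4} ⟨p, Y⟩ + F_{m+8} p_{m+8} nearby. Both p-factors vanish at x(t),
    -- so derivatives of the frame drop out and only the derivative of Y remains.
    have e : (fun y => hamiltonian f y (p t) u) =ᶠ[𝓝 (x t)] fun y =>
        coordL (m + 4) (F y) * (p t ⬝ᵥ tower m c y) +
          coordL (m + 8) (F y) * coordL (m + 8) (p t) := by
      filter_upwards [hW.mem_nhds hx] with y hy
      rw [hamiltonian_eq]
      change p t ⬝ᵥ F y = _
      conv_lhs => rw [eq_smul_of_mem_flag_zero (hFm y hy)]
      rw [dotProduct_add, dotProduct_smul, dotProduct_smul, dotProduct_unitVec _ (by omega)]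
      simp only [smul_eq_mul]
      ring
    have hc (j : ℕ) : DifferentiableAt ℝ (fun y => coordL j (F y)) (x t) :=
      (coordL j).differentiableAt.comp (x t) hFd
    have hT : DifferentiableAt ℝ (tower m c) (x t) :=
      (contDiff_tower m c).differentiable (by simp) _
    have hpT : DifferentiableAt ℝ (fun y => p t ⬝ᵥ tower m c y) (x t) := by
      unfold dotProduct
      refine DifferentiableAt.fun_sum fun i _ => ?_
      exact ((contDiff_towerComp m c i).differentiable (by simp) (x t)).const_mul _
    have hY : p t ⬝ᵥ tower m c (x t) = 0 := hp _ (flagField_mem m c 0 (x t))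
    have hX : coordL (m + 8) (p t) = 0 := by
      rw [← dotProduct_unitVec _ (by omega)]
      exact hp _ (unitVec_mem_flag c (by omega) (by simp [flagRoot]) _)
    rw [hsingle, e.fderiv_eq, hX]
    simp only [mul_zero, add_zero]
    rw [fderiv_fun_mul (hc _) hpT, hY]
    simp [fderiv_dotProduct _ hT]

/-- From g' = r w h and w g = 0 follows g g' = 0, so g vanishes nowhere, which forces w = 0, or
everywhere, which forces w h = 0. Repeating this with h in place of g drives the whole descent along
an extremal. -/
lemma IsAbsContReal.ae_eq_zero_or {I : Set ℝ} (hI : I.OrdConnected) (hn : I.Nontrivial)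
    {g w h : ℝ → ℝ} {r : ℝ} (hr : r ≠ 0) (hg : IsAbsContReal I g)
    (hd : ∀ᵐ t ∂(volume.restrict I), HasDerivAt g (r * (w t * h t)) t)
    (hz : ∀ᵐ t ∂(volume.restrict I), w t * g t = 0) :
    (∀ᵐ t ∂(volume.restrict I), w t = 0) ∨
      ((∀ t ∈ I, g t = 0) ∧ ∀ᵐ t ∂(volume.restrict I), w t * h t = 0) := by
  rcases hg.eq_zero_or_ne_zero hI (by
    filter_upwards [hd, hz] with t h1 h2
    exact ⟨_, h1, by linear_combination (r * h t) * h2⟩) with h0 | h0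
  · refine Or.inr ⟨h0, ?_⟩
    filter_upwards [hd, ae_restrict_mem hI.measurableSet] with t h1 ht
    exact (mul_eq_zero.1 (hasDerivAt_eq_zero_of_eqOn_zero hI hn h0 ht h1)).resolve_left hr
  · refine Or.inl ?_
    filter_upwards [hz, ae_restrict_mem hI.measurableSet] with t h1 ht
    exact (mul_eq_zero.1 h1).resolve_right (h0 t ht)

lemma fderiv_tower_unitVec_high {m : ℕ} (c : ℝ) {i : ℕ} (hi : i ≤ 3) (x : Coord (m + 9)) :
    fderiv ℝ (tower m c) x (unitVec (m + 8 - i)) = newField m i x := by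
  rw [← lieBracket_flagField c (show i ≤ m + 6 by omega), lieBracket_const_apply]
  simp [flagField, hi]

lemma fderiv_tower_unitVec_low {m : ℕ} (c : ℝ) {k : ℕ} (hk : k ≤ m + 3) (x : Coord (m + 9)) :
    fderiv ℝ (tower m c) x (unitVec (k + 1)) =
      if k = 0 then 0 else coordL (m + 5) x • unitVec k := by
  apply ext_coordL
  intro j hj
  rw [coordL_fderiv j ((contDiff_tower m c).differentiable (by simp) x)]
  simp only [coordL_tower]
  have hrhs : coordL j (if k = 0 then 0 else coordL (m + 5) x • unitVec k : Coord (m + 9)) =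
      if j = k ∧ k ≠ 0 then coordL (m + 5) x else 0 := by
    by_cases h : k = 0
    · simp [h]
    · simp [h, coordL_unitVec _ hj]
  rw [hrhs]
  by_cases h0 : j = 0
  · subst h0
    rw [fderiv_towerComp_zero, coordL_unitVec_ne (by omega), if_neg (by omega)]
  · by_cases h3 : j ≤ m + 3
    · rw [fderiv_towerComp_low c h0 h3, coordL_unitVec_ne (show m + 5 ≠ k + 1 by omega),
        coordL_unitVec _ (by omega)]
      by_cases h : j = k
      · subst h; simp [h0]
      · simp [h]
    · rw [if_neg (by omega)]
      by_cases h4 : j = m + 4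
      · rw [h4, fderiv_towerComp_mid]
      · rw [fderiv_towerComp_high c (by omega), coordL_unitVec_ne (by omega)]

lemma tower_eq_sum (m : ℕ) (c : ℝ) (x : Coord (m + 9)) :
    tower m c x = coordL (m + 5) x • contactField m x + unitVec (m + 4) +
      coordL (m + 6) x • unitVec (m + 5) + (coordL (m + 7) x + 1) • unitVec (m + 6) +
      (coordL (m + 8) x + c) • unitVec (m + 7) := by
  apply ext_coordL
  intro j hj
  simp only [map_add, map_smul, coordL_tower, coordL_contactField, coordL_unitVec _ hj,
    smul_eq_mul]
  by_cases h0 : j = 0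
  · subst h0; simp [towerComp, contactComp]
  · by_cases h3 : j ≤ m + 3
    · simp [towerComp, contactComp, h0, h3, show j ≠ m + 4 by omega, show j ≠ m + 5 by omega,
        show j ≠ m + 6 by omega, show j ≠ m + 7 by omega]
    · obtain rfl | rfl | rfl | rfl | rfl :
        j = m + 4 ∨ j = m + 5 ∨ j = m + 6 ∨ j = m + 7 ∨ j = m + 8 := by omega
      all_goals simp [towerComp, contactComp, coordL_of_le]

lemma sum_smul_unitVec {n : ℕ} (w : Coord n) : ∑ a : Fin n, w a • unitVec a.val = w := by
  funext j
  simp only [Finset.sum_apply, Pi.smul_apply, unitVec, smul_eq_mul]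
  simp [← Fin.ext_iff]

/-- Along an extremal, ⟨p, Z⟩ changes at the rate v ⟨p, [Y, Z]⟩; the control of X does not
contribute, since X commutes with Z. -/
lemma hasDerivAt_dotProduct_contactField {m : ℕ} {c : ℝ} {x p : ℝ → Coord (m + 9)} {t : ℝ}
    {F : Coord (m + 9)} (hF : F ∈ flag m c 0 (x t)) (hx : HasDerivAt x F t)
    (hp : ∀ a < m + 9, HasDerivAt (fun s => coordL a (p s))
        (-(coordL (m + 4) F * (p t ⬝ᵥ fderiv ℝ (tower m c) (x t) (unitVec a)))) t) :
    HasDerivAt (fun s => p s ⬝ᵥ contactField m (x s))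
      (coordL (m + 4) F * coordL (m + 3) (p t)) t := by
  have hZ : DifferentiableAt ℝ (contactField m) (x t) :=
    (contDiff_contactField m).differentiable (by simp) _
  have h (a : Fin (m + 9)) : HasDerivAt (fun s => p s a * contactField m (x s) a)
      (-(coordL (m + 4) F * (p t ⬝ᵥ fderiv ℝ (tower m c) (x t) (unitVec a.val))) *
        contactField m (x t) a + p t a * fderiv ℝ (contactField m) (x t) F a) t := by
    have h1 := hp a a.isLt
    have h2 := hasDerivAt_pi.1 (hZ.hasFDerivAt.comp_hasDerivAt t hx) a
    simp only [← apply_eq_coordL] at h1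
    exact h1.mul h2
  refine (HasDerivAt.fun_sum fun a _ => h a).congr_deriv ?_
  rw [Finset.sum_add_distrib]
  have e1 : ∑ a : Fin (m + 9), -(coordL (m + 4) F *
      (p t ⬝ᵥ fderiv ℝ (tower m c) (x t) (unitVec a.val))) * contactField m (x t) a =
      -(coordL (m + 4) F * (p t ⬝ᵥ fderiv ℝ (tower m c) (x t) (contactField m (x t)))) := by
    conv_rhs => rw [← sum_smul_unitVec (contactField m (x t))]
    rw [map_sum, dotProduct_sum, Finset.mul_sum, ← Finset.sum_neg_distrib]
    refine Finset.sum_congr rfl fun a _ => ?_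
    rw [map_smul, dotProduct_smul, smul_eq_mul]
    ring
  have e2 : fderiv ℝ (contactField m) (x t) F =
      coordL (m + 4) F • fderiv ℝ (contactField m) (x t) (tower m c (x t)) := by
    conv_lhs => rw [eq_smul_of_mem_flag_zero hF]
    rw [map_add, map_smul, map_smul]
    have : fderiv ℝ (contactField m) (x t) (unitVec (m + 8)) = 0 := by
      apply ext_coordL
      intro j hj
      rw [coordL_fderiv j hZ]
      simp only [coordL_contactField, map_zero]
      by_cases h0 : j = 0
      · rw [h0, fderiv_contactComp_zero]
      · by_cases h3 : j ≤ m + 3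
        · rw [fderiv_contactComp h0 h3, coordL_unitVec_ne (by omega)]
        · have : contactComp m j = fun _ => 0 := by funext y; simp [contactComp, h0, h3]
          rw [this]; simp
    rw [this, smul_zero, zero_add]
  have e3 := congrFun (lieBracket_tower_contactField m c) (x t)
  rw [VectorField.lieBracket] at e3
  change _ + p t ⬝ᵥ fderiv ℝ (contactField m) (x t) F = _
  rw [e1, e2, ← dotProduct_unitVec (p t) (show m + 3 < m + 9 by omega), ← e3, dotProduct_smul,
    dotProduct_sub, smul_eq_mul]
  ring

/-- The differential equations of an abnormal extremal, for coordinate functions `X`, covector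
components `P`, the function `q` and the control `v`, force `v = 0`. -/
lemma control_ae_eq_zero {m : ℕ} {c : ℝ} {I : Set ℝ} (hI : I.OrdConnected) (hn : I.Nontrivial)
    {x p : ℝ → Coord (m + 9)} {v : ℝ → ℝ} (hx : IsAbsCont I x) (hp : IsAbsCont I p)
    (hp0 : ∀ t ∈ I, p t ≠ 0) (hx7 : ∀ t ∈ I, -1 < coordL (m + 7) (x t))
    (hX : ∀ᵐ t ∂(volume.restrict I), ∀ k ≤ m + 7,
      HasDerivAt (fun s => coordL k (x s)) (v t * towerComp m c k (x t)) t)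
    (hP : ∀ᵐ t ∂(volume.restrict I), ∀ a < m + 9, HasDerivAt (fun s => coordL a (p s))
      (-(v t * (p t ⬝ᵥ fderiv ℝ (tower m c) (x t) (unitVec a)))) t)
    (hq : ∀ᵐ t ∂(volume.restrict I), HasDerivAt (fun s => p s ⬝ᵥ contactField m (x s))
      (v t * coordL (m + 3) (p t)) t)
    (hann : ∀ᵐ t ∂(volume.restrict I), coordL (m + 8) (p t) = 0 ∧ p t ⬝ᵥ tower m c (x t) = 0) :
    ∀ᵐ t ∂(volume.restrict I), v t = 0 := by
  have hhigh (i : ℕ) (hi : i ≤ 2) : ∀ᵐ t ∂(volume.restrict I),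
      HasDerivAt (fun s => coordL (m + 8 - i) (p s)) (-1 * (v t * coordL (m + 7 - i) (p t))) t := by
    filter_upwards [hP] with t ht
    have := ht (m + 8 - i) (by omega)
    rw [fderiv_tower_unitVec_high c (by omega), newField, if_neg (by omega),
      dotProduct_unitVec _ (by omega)] at this
    rwa [neg_one_mul]
  have hlow (k : ℕ) (hk0 : k ≠ 0) (hk : k ≤ m + 3) : ∀ᵐ t ∂(volume.restrict I),
      HasDerivAt (fun s => coordL (k + 1) (p s))
        (-1 * ((v t * coordL (m + 5) (x t)) * coordL k (p t))) t := by
    filter_upwards [hP] with t ht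
    have := ht (k + 1) (by omega)
    rw [fderiv_tower_unitVec_low c hk, if_neg hk0, dotProduct_smul,
      dotProduct_unitVec _ (by omega), smul_eq_mul] at this
    rwa [neg_one_mul, mul_assoc]
  rcases (hp.coordL (m + 8)).ae_eq_zero_or hI hn (by norm_num) (hhigh 0 (by omega))
    (hann.mono fun t ht => by rw [ht.1, mul_zero]) with h | ⟨-, h8⟩
  · exact h
  rcases (hp.coordL (m + 7)).ae_eq_zero_or hI hn (by norm_num) (hhigh 1 (by omega)) h8
    with h | ⟨hP7, h7⟩
  · exact h
  rcases (hp.coordL (m + 6)).ae_eq_zero_or hI hn (by norm_num) (hhigh 2 (by omega)) h7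
    with h | ⟨hP6, h6⟩
  · exact h
  rcases (hp.coordL (m + 5)).ae_eq_zero_or (h := fun t => p t ⬝ᵥ contactField m (x t)) hI hn
    (r := -1) (by norm_num) (by
      filter_upwards [hP] with t ht
      have := ht (m + 8 - 3) (by omega)
      rw [fderiv_tower_unitVec_high c le_rfl, newField, if_pos rfl] at this
      rwa [neg_one_mul]) h6 with h | ⟨hP5, h5⟩
  · exact h
  have hqac : IsAbsContReal I (fun s => p s ⬝ᵥ contactField m (x s)) := by
    refine isAbsContReal_sum _ fun a _ => IsAbsContReal.mul ?_ ?_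
    · simpa only [apply_eq_coordL] using hp.coordL a.val
    · change IsAbsContReal I fun s => contactComp m a.val (x s)
      unfold contactComp
      split_ifs
      exacts [isAbsContReal_const I 1, hx.coordL _, isAbsContReal_const I 0]
  rcases hqac.ae_eq_zero_or hI hn one_ne_zero
    (hq.mono fun t ht => by rwa [one_mul]) h5 with h | ⟨hq0, h3⟩
  · exact h
  -- Below level m+5 the effective control is v x_{m+5}. If it is not zero almost everywhere, the
  -- dichotomy always falls into its second branch, all components of p vanish, and this contradicts
  -- p ≠ 0.
  have hv5 : ∀ᵐ t ∂(volume.restrict I), v t * coordL (m + 5) (x t) = 0 := by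
    by_contra hne
    have hdown : ∀ i ≤ m + 2, (∀ᵐ t ∂(volume.restrict I),
        (v t * coordL (m + 5) (x t)) * coordL (m + 3 - i) (p t) = 0) ∧
        ∀ k, m + 3 < k + i → k ≤ m + 3 → ∀ t ∈ I, coordL k (p t) = 0 := by
      intro i
      induction i with
      | zero =>
        refine fun _ => ⟨h3.mono fun t ht => ?_, fun k h1 h2 => by omega⟩
        rw [Nat.sub_zero]
        linear_combination coordL (m + 5) (x t) * ht
      | succ i ih =>
        intro hi
        obtain ⟨h1, h2⟩ := ih (by omega)
        have e : m + 3 - (i + 1) + 1 = m + 3 - i := by omega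
        have hl := hlow (m + 3 - (i + 1)) (by omega) (by omega)
        rw [e] at hl
        rcases (hp.coordL (m + 3 - i)).ae_eq_zero_or hI hn (by norm_num) hl h1 with h | ⟨h, h'⟩
        · exact absurd h hne
        · refine ⟨h', fun k hk1 hk2 => ?_⟩
          by_cases hk : k = m + 3 - i
          · rw [hk]; exact h
          · exact h2 k (by omega) hk2
    obtain ⟨h1, h2⟩ := hdown (m + 2) le_rfl
    rw [show m + 3 - (m + 2) = 1 by omega] at h1
    have hP1 : ∀ t ∈ I, coordL 1 (p t) = 0 := by
      rcases (hp.coordL 1).ae_eq_zero_or (h := fun _ => 0) hI hn (r := 1) (by norm_num) (by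
        filter_upwards [hP] with t ht
        have := ht (0 + 1) (by omega)
        rw [fderiv_tower_unitVec_low c (by omega), if_pos rfl] at this
        simpa using this) h1 with h | ⟨h, -⟩
      · exact absurd h hne
      · exact h
    have hPlow : ∀ k, k ≠ 0 → k ≤ m + 3 → ∀ t ∈ I, coordL k (p t) = 0 := by
      intro k hk0 hk
      by_cases hk1 : k = 1
      · rw [hk1]; exact hP1
      · exact h2 k (by omega) hk
    -- Annihilation of Y reduces to p_{m+4} = 0, because ⟨p, Z⟩ and the components m+5, m+6, m+7
    -- already vanish.
    have hP4 : ∀ t ∈ I, coordL (m + 4) (p t) = 0 := by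
      rcases (hp.coordL (m + 4)).ae_eq_zero_or (w := fun t => v t * coordL (m + 5) (x t)) hI hn
        (by norm_num) (hlow (m + 3) (by omega) le_rfl) (by
        filter_upwards [hann, ae_restrict_mem hI.measurableSet] with t ht htI
        have h := ht.2
        rw [tower_eq_sum] at h
        simp only [dotProduct_add, dotProduct_smul, smul_eq_mul,
          dotProduct_unitVec _ (show m + 4 < m + 9 by omega),
          dotProduct_unitVec _ (show m + 5 < m + 9 by omega),
          dotProduct_unitVec _ (show m + 6 < m + 9 by omega),
          dotProduct_unitVec _ (show m + 7 < m + 9 by omega)] at h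
        have e5 : coordL (m + 5) (p t) = 0 := hP5 t htI
        have e6 : coordL (m + 6) (p t) = 0 := hP6 t htI
        have e7 : coordL (m + 7) (p t) = 0 := hP7 t htI
        rw [hq0 t htI, e5, e6, e7] at h
        have : coordL (m + 4) (p t) = 0 := by linarith
        rw [this, mul_zero]) with h | ⟨h, -⟩
      · exact absurd h hne
      · exact h
    -- Annihilation of X gives p_{m+8} = 0 only almost everywhere. If p_{m+8} vanished nowhere,
    -- every almost-everywhere statement on I would hold, against `hne`.
    have hP8 : ∀ t ∈ I, coordL (m + 8) (p t) = 0 := by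
      rcases (hp.coordL (m + 8)).eq_zero_or_ne_zero hI (by
        filter_upwards [hP, hann] with t ht h0
        exact ⟨_, ht (m + 8) (by omega), by rw [h0.1, zero_mul]⟩) with h | h
      · exact h
      · refine absurd ?_ hne
        filter_upwards [hann, ae_restrict_mem hI.measurableSet] with t ht htI
        exact absurd ht.1 (h t htI)
    obtain ⟨t, ht⟩ := hn.nonempty
    refine hp0 t ht (ext_coordL fun j hj => ?_)
    rw [map_zero]
    by_cases h0 : j = 0
    · subst h0
      have h := hq0 t ht
      have e : contactField m (x t) = unitVec 0 + ∑ a : Fin (m + 9),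
          (if a.val ≠ 0 ∧ a.val ≤ m + 3 then contactComp m a.val (x t) else 0) • unitVec a.val := by
        conv_lhs => rw [← sum_smul_unitVec (contactField m (x t))]
        have e0 : (unitVec 0 : Coord (m + 9)) =
            ∑ a : Fin (m + 9), (if a.val = 0 then (1 : ℝ) else 0) • unitVec a.val := by
          rw [← sum_smul_unitVec (unitVec 0)]
          rfl
        rw [e0, ← Finset.sum_add_distrib]
        refine Finset.sum_congr rfl fun a _ => ?_
        rw [← add_smul]
        congr 1
        change contactComp m a.val (x t) = _
        by_cases ha : a.val = 0
        · simp [ha, contactComp]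
        · by_cases ha3 : a.val ≤ m + 3
          · simp [ha, ha3]
          · simp [ha, ha3, contactComp]
      rw [e, dotProduct_add, dotProduct_unitVec _ (by omega), dotProduct_sum] at h
      rw [Finset.sum_eq_zero, add_zero] at h
      · exact h
      · intro a _
        rw [dotProduct_smul, dotProduct_unitVec _ a.isLt]
        split_ifs with ha
        · rw [hPlow _ ha.1 ha.2 t ht, smul_zero]
        · rw [zero_smul]
    · by_cases h3 : j ≤ m + 3
      · exact hPlow j h0 h3 t ht
      · obtain rfl | rfl | rfl | rfl | rfl :
          j = m + 4 ∨ j = m + 5 ∨ j = m + 6 ∨ j = m + 7 ∨ j = m + 8 := by omega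
        exacts [hP4 t ht, hP5 t ht, hP6 t ht, hP7 t ht, hP8 t ht]
  -- The same dichotomy now runs on the coordinates: x_{m+5}' = v x_{m+6} and x_{m+6}' = v (x_{m+7}
  -- + 1), and the last factor is positive in the region considered.
  rcases (hx.coordL (m + 5)).ae_eq_zero_or (h := fun t => coordL (m + 6) (x t)) hI hn one_ne_zero
    (hX.mono fun t ht => by simpa [towerComp] using ht (m + 5) (by omega)) hv5 with h | ⟨-, h6⟩
  · exact h
  rcases (hx.coordL (m + 6)).ae_eq_zero_or (h := fun t => coordL (m + 7) (x t) + 1) hI hn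
    one_ne_zero (hX.mono fun t ht => by simpa [towerComp] using ht (m + 6) (by omega)) h6
    with h | ⟨-, h7⟩
  · exact h
  filter_upwards [h7, ae_restrict_mem hI.measurableSet] with t ht htI
  exact (mul_eq_zero.1 ht).resolve_right (by linarith [hx7 t htI])

/-- Where `x_{m+7} > -1`, abnormal curves of the structure are tangent to `∂_{m+8}`. -/
lemma IsAbnormalCurve.ae_hasDerivAt {m : ℕ} {c : ℝ} {I : Set ℝ} (hI : I.OrdConnected)
    (hn : I.Nontrivial) {x : ℝ → Coord (m + 9)} (h : IsAbnormalCurve univ (flag m c 0) I x)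
    (hx7 : ∀ t ∈ I, -1 < coordL (m + 7) (x t)) :
    IsAbsCont I x ∧ ∀ᵐ t ∂(volume.restrict I), ∃ s : ℝ, HasDerivAt x (s • unitVec (m + 8)) t := by
  obtain ⟨W, k, f, hW, -, hf, hxW, hx, u, p, -, hp, hp0, hH⟩ := h
  refine ⟨hx, ?_⟩
  have hE : ∀ᵐ t ∂(volume.restrict I), ∃ F ∈ flag m c 0 (x t), HasDerivAt x F t ∧
      (∀ w ∈ flag m c 0 (x t), p t ⬝ᵥ w = 0) ∧
      ∀ a < m + 9, HasDerivAt (fun s => coordL a (p s))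
        (-(coordL (m + 4) F * (p t ⬝ᵥ fderiv ℝ (tower m c) (x t) (unitVec a)))) t := by
    filter_upwards [hH, ae_restrict_mem hI.measurableSet] with t ⟨h1, h2, h3⟩ ht
    exact extremal_equations hW hf (hxW t ht) h1 h2 h3
  -- The velocity F is only given time by time; the control of Y is recovered as the derivative of
  -- x_{m+4}, since Y has component 1 there.
  have hv {t : ℝ} {F : Coord (m + 9)} (hF : HasDerivAt x F t) :
      deriv (fun s => coordL (m + 4) (x s)) t = coordL (m + 4) F :=
    ((coordL (m + 4)).hasFDerivAt.comp_hasDerivAt t hF).deriv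
  have hzero := control_ae_eq_zero (c := c) (v := deriv fun s => coordL (m + 4) (x s)) hI hn hx hp
    hp0 hx7
    (by
      filter_upwards [hE] with t ⟨F, hF, hd, _, _⟩ k hk
      rw [hv hd]
      have := hF k (by omega)
      simp only [flagRoot, flagCoeff, zero_le, if_true] at this
      rw [← this]
      exact (coordL k).hasFDerivAt.comp_hasDerivAt t hd)
    (by
      filter_upwards [hE] with t ⟨F, hF, hd, _, hp⟩
      rwa [hv hd])
    (by
      filter_upwards [hE] with t ⟨F, hF, hd, _, hp⟩
      rw [hv hd]
      exact hasDerivAt_dotProduct_contactField hF hd hp)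
    (by
      filter_upwards [hE] with t ⟨F, hF, hd, hw, hp⟩
      refine ⟨?_, hw _ (flagField_mem m c 0 (x t))⟩
      rw [← dotProduct_unitVec _ (by omega)]
      exact hw _ (unitVec_mem_flag c (by omega) (by simp [flagRoot]) _))
  filter_upwards [hE, hzero] with t ⟨F, hF, hd, _, _⟩ hz
  rw [hv hd] at hz
  have := eq_smul_of_mem_flag_zero hF
  rw [hz, zero_smul, add_zero] at this
  exact ⟨coordL (m + 8) F, by rwa [← this]⟩

lemma isAbsCont_of_coordL {n : ℕ} {I : Set ℝ} {x : ℝ → Coord n}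
    (h : ∀ k < n, IsAbsContReal I (fun t => coordL k (x t))) : IsAbsCont I x := fun a ha b hb => by
  have hs : Filter.Tendsto (fun E : ℕ × (ℕ → ℝ × ℝ) => ∑ j : Fin n,
      ∑ i ∈ Finset.range E.1, dist (x (E.2 i).1 j) (x (E.2 i).2 j))
      (AbsolutelyContinuousOnInterval.totalLengthFilter ⊓
        Filter.principal (AbsolutelyContinuousOnInterval.disjWithin a b)) (𝓝 0) := by
    have := tendsto_finsetSum (Finset.univ : Finset (Fin n)) fun j _ =>
      (show Filter.Tendsto (fun E : ℕ × (ℕ → ℝ × ℝ) =>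
        ∑ i ∈ Finset.range E.1, dist (x (E.2 i).1 j) (x (E.2 i).2 j)) _ (𝓝 0) by
          simp only [apply_eq_coordL]
          exact h j j.isLt a ha b hb)
    simpa using this
  refine squeeze_zero (fun t => Finset.sum_nonneg fun i _ => dist_nonneg) (fun E => ?_) hs
  rw [Finset.sum_comm]
  refine Finset.sum_le_sum fun i _ => (dist_pi_le_iff (by positivity)).2 fun j => ?_
  exact Finset.single_le_sum (f := fun j => dist (x (E.2 i).1 j) (x (E.2 i).2 j))
    (fun _ _ => dist_nonneg) (Finset.mem_univ j)

/-- Curves tangent to `∂_{m+8}` are abnormal. -/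
lemma isAbnormalCurve_of_ae_hasDerivAt {m : ℕ} (c : ℝ) {I : Set ℝ} {x : ℝ → Coord (m + 9)}
    (hx : IsAbsCont I x)
    (h : ∀ᵐ t ∂(volume.restrict I), ∃ s : ℝ, HasDerivAt x (s • unitVec (m + 8)) t) :
    IsAbnormalCurve univ (flag m c 0) I x := by
  refine ⟨univ, 2, _, isOpen_univ, subset_rfl, isFrameOn_flag_zero m c, fun _ _ => mem_univ _, hx,
    fun t => ![deriv (fun s => coordL (m + 8) (x s)) t, 0],
    -- The covector dx_1 - x_2 dx_0 annihilates both X and Y, and along a curve tangent to X its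
    -- coefficient x_2 has derivative zero.
    fun t => unitVec 1 - coordL 2 (x t) • unitVec 0, ?_, ?_, ?_, ?_⟩
  · refine measurable_pi_lambda _ fun i => ?_
    fin_cases i
    · exact measurable_deriv _
    · exact measurable_const
  · refine isAbsCont_of_coordL fun k hk => ?_
    have : (fun t => coordL k (unitVec 1 - coordL 2 (x t) • unitVec 0 : Coord (m + 9))) =
        fun t => coordL k (unitVec 1 : Coord (m + 9)) +
          coordL 2 (x t) * -coordL k (unitVec 0 : Coord (m + 9)) := by
      funext t
      rw [map_sub, map_smul, smul_eq_mul]; ring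
    rw [this]
    exact fun a ha b hb => (isAbsContReal_const I _ a ha b hb).fun_add
      ((hx.coordL 2).mul (isAbsContReal_const I _) a ha b hb)
  · intro t _ h0
    have := congrArg (coordL 1) h0
    rw [map_sub, map_smul, coordL_unitVec _ (by omega), coordL_unitVec_ne (by omega)] at this
    simp at this
  · filter_upwards [h] with t ⟨s, hs⟩
    have hu : deriv (fun s => coordL (m + 8) (x s)) t = s := by
      refine ((coordL (m + 8)).hasFDerivAt.comp_hasDerivAt t hs).deriv.trans ?_
      rw [map_smul, coordL_unitVec _ (by omega)]
      simp
    have hp (r : ℝ) (y : Coord (m + 9)) : (unitVec 1 - r • unitVec 0) ⬝ᵥ y =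
        coordL 1 y - r * coordL 0 y := by
      rw [dotProduct_comm, dotProduct_sub, dotProduct_smul, dotProduct_unitVec _ (by omega),
        dotProduct_unitVec _ (by omega), smul_eq_mul]
    rw [hu]
    have hsum (y : Coord (m + 9)) (v : Fin 2 → ℝ) :
        ∑ i, v i • (![fun _ => unitVec (m + 8), tower m c] : Fin 2 → VField (m + 9)) i y =
          v 0 • unitVec (m + 8) + v 1 • tower m c y := by
      simp [Fin.sum_univ_two]
    refine ⟨?_, ?_, ?_⟩
    · convert hs using 1
      funext a
      have hlin : (fun q => hamiltonian ![fun _ => unitVec (m + 8), tower m c] (x t) q ![s, 0]) =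
          fun q => (∑ j, (s • unitVec (m + 8) : Coord (m + 9)) j •
            (ContinuousLinearMap.proj j : Coord (m + 9) →L[ℝ] ℝ)) q := by
        funext q
        rw [hamiltonian_eq, hsum]
        simp only [dotProduct, sum_apply, smul_apply, smul_eq_mul,
          ContinuousLinearMap.proj_apply]
        refine Finset.sum_congr rfl fun j _ => ?_
        simp [mul_comm]
      rw [hlin, ContinuousLinearMap.fderiv]
      simp [Pi.single_apply]
    · have hd : HasDerivAt (fun t => (unitVec 1 - coordL 2 (x t) • unitVec 0 : Coord (m + 9))) 0
          t := by
        have h2 := (coordL 2).hasFDerivAt.comp_hasDerivAt t hs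
        rw [map_smul, coordL_unitVec_ne (by omega), smul_zero] at h2
        simpa using ((h2.smul_const (unitVec 0 : Coord (m + 9))).const_sub (unitVec 1))
      convert hd using 1
      funext a
      have hconst (q : Coord (m + 9)) : (fun y => hamiltonian ![fun _ => unitVec (m + 8), tower m c]
          y q ![s, 0]) = fun _ => q ⬝ᵥ (s • unitVec (m + 8)) := by
        funext y
        rw [hamiltonian_eq, hsum]
        simp
      rw [hconst]
      simp
    · have hconst : (fun v => hamiltonian ![fun _ => unitVec (m + 8), tower m c] (x t)
          (unitVec 1 - coordL 2 (x t) • unitVec 0) v) = fun _ => 0 := by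
        funext v
        rw [hamiltonian_eq, hsum, hp]
        simp only [map_add, map_smul, coordL_tower, coordL_unitVec_ne (show 1 ≠ m + 8 by omega),
          coordL_unitVec_ne (show 0 ≠ m + 8 by omega)]
        simp [towerComp]
        ring
      rw [hconst]
      simp

/-- The parameter occurs only in the equation of index m+7, which is present at level 0 alone. -/
lemma flag_eq_of_pos (m : ℕ) (c d : ℝ) {i : ℕ} (hi : 1 ≤ i) : flag m c i = flag m d i := by
  funext x
  ext v
  rw [mem_flag, mem_flag]
  refine forall₂_congr fun j hj => ?_
  have : flagCoeff m c i j x = flagCoeff m d i j x := by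
    unfold flagCoeff towerComp
    simp [show j ≠ m + 7 by omega]
  rw [this]

/-- The structures for different values of the parameter have diffeomorphic abnormal curves. -/
theorem haveDiffeomorphicAbnormals_flag (m : ℕ) (c d : ℝ) :
    HaveDiffeomorphicAbnormals univ (flag m c 0) 0 univ (flag m d 0) 0 := by
  have hopen : IsOpen {y : Coord (m + 9) | -1 < coordL (m + 7) y} :=
    isOpen_lt continuous_const (coordL (m + 7)).continuous
  -- The identity, restricted to the region where the abnormal curves are those tangent to X.
  refine ⟨OpenPartialHomeomorph.ofSet _ hopen, ⟨?_, rfl, subset_univ _, subset_univ _,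
    contDiffOn_id, contDiffOn_id⟩, ?_⟩
  · change -1 < coordL (m + 7) (0 : Coord (m + 9))
    simp
  · intro i I x hI hn hx
    have hcomp : (OpenPartialHomeomorph.ofSet _ hopen) ∘ x = x := rfl
    rw [hcomp, derivedFlag_flag, derivedFlag_flag]
    rcases Nat.eq_zero_or_pos i with rfl | hi
    · constructor <;> intro h <;> obtain ⟨h1, h2⟩ := h.ae_hasDerivAt hI hn hx <;>
        exact isAbnormalCurve_of_ae_hasDerivAt _ h1 h2
    · rw [flag_eq_of_pos m c d hi]

/-! ### Naturality under local diffeomorphisms -/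

lemma IsLocalDiffeo.symm {n : ℕ} {U V : Set (Coord n)} {p q : Coord n}
    {φ : OpenPartialHomeomorph (Coord n) (Coord n)} (h : IsLocalDiffeo U V p q φ) :
    IsLocalDiffeo V U q p φ.symm where
  mem_source := by
    rw [← h.map_point]; exact φ.map_source h.mem_source
  map_point := by
    rw [← h.map_point]; exact φ.left_inv h.mem_source
  source_subset := h.target_subset
  target_subset := h.source_subset
  smooth := h.smooth_symm
  smooth_symm := by simpa using h.smooth

section Pushforward

variable {n : ℕ} {U V : Set (Coord n)} {p q : Coord n}
  {φ : OpenPartialHomeomorph (Coord n) (Coord n)}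

lemma IsLocalDiffeo.contDiffAt (h : IsLocalDiffeo U V p q φ) {x : Coord n} (hx : x ∈ φ.source) :
    ContDiffAt ℝ ∞ φ x := h.smooth.contDiffAt (φ.open_source.mem_nhds hx)

lemma IsLocalDiffeo.fderiv_symm_comp (h : IsLocalDiffeo U V p q φ) {x : Coord n}
    (hx : x ∈ φ.source) (v : Coord n) : fderiv ℝ φ.symm (φ x) (fderiv ℝ φ x v) = v := by
  have h1 : HasFDerivAt φ (fderiv ℝ φ x) x :=
    ((h.contDiffAt hx).differentiableAt (by simp)).hasFDerivAt
  have h2 : HasFDerivAt φ.symm (fderiv ℝ φ.symm (φ x)) (φ x) :=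
    ((h.symm.contDiffAt (φ.map_source hx)).differentiableAt (by simp)).hasFDerivAt
  have h3 : HasFDerivAt id ((fderiv ℝ φ.symm (φ x)).comp (fderiv ℝ φ x)) x := by
    refine (h2.comp x h1).congr_of_eventuallyEq ?_
    filter_upwards [φ.open_source.mem_nhds hx] with y hy
    exact (φ.left_inv hy).symm
  exact congrArg (fun T => T v) (h3.unique (hasFDerivAt_id x))

lemma IsLocalDiffeo.fderiv_comp_symm (h : IsLocalDiffeo U V p q φ) {y : Coord n}
    (hy : y ∈ φ.target) (v : Coord n) :
    fderiv ℝ φ (φ.symm y) (fderiv ℝ φ.symm y v) = v := h.symm.fderiv_symm_comp hy v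

/-- The image of a vector field under a local diffeomorphism. -/
noncomputable def pushforward (φ : OpenPartialHomeomorph (Coord n) (Coord n)) (a : VField n) :
    VField n := fun y => fderiv ℝ φ (φ.symm y) (a (φ.symm y))

lemma IsLocalDiffeo.contDiffAt_pushforward (h : IsLocalDiffeo U V p q φ) {a : VField n}
    {y : Coord n} (hy : y ∈ φ.target) (ha : ContDiffAt ℝ ∞ a (φ.symm y)) :
    ContDiffAt ℝ ∞ (pushforward φ a) y := by
  have h1 := h.symm.contDiffAt hy
  have h2 : ContDiffAt ℝ ∞ (fderiv ℝ φ) (φ.symm y) :=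
    (h.contDiffAt (φ.map_target hy)).fderiv_right (by simp)
  exact (h2.comp y h1).clm_apply (ha.comp y h1)

lemma IsLocalDiffeo.pushforward_eq_pullback (h : IsLocalDiffeo U V p q φ) (a : VField n)
    {y : Coord n} (hy : y ∈ φ.target) :
    VectorField.pullback ℝ φ.symm a y = pushforward φ a y := by
  let e : Coord n ≃L[ℝ] Coord n := ContinuousLinearEquiv.equivOfInverse (fderiv ℝ φ.symm y)
    (fderiv ℝ φ (φ.symm y)) (h.fderiv_comp_symm hy) fun v => by
      have := h.fderiv_symm_comp (φ.map_target hy) v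
      rwa [φ.right_inv hy] at this
  have he : fderiv ℝ φ.symm y = e := rfl
  rw [VectorField.pullback, he, ContinuousLinearMap.inverse_equiv]
  rfl

lemma IsLocalDiffeo.pushforward_lieBracket (h : IsLocalDiffeo U V p q φ) {a b : VField n}
    {y : Coord n} (hy : y ∈ φ.target) (ha : DifferentiableAt ℝ a (φ.symm y))
    (hb : DifferentiableAt ℝ b (φ.symm y)) :
    VectorField.lieBracket ℝ (pushforward φ a) (pushforward φ b) y =
      fderiv ℝ φ (φ.symm y) (VectorField.lieBracket ℝ a b (φ.symm y)) := by
  have e (a : VField n) : pushforward φ a =ᶠ[𝓝 y] VectorField.pullback ℝ φ.symm a := by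
    filter_upwards [φ.open_target.mem_nhds hy] with z hz
    exact (h.pushforward_eq_pullback a hz).symm
  rw [(e a).lieBracket_vectorField_eq (e b),
    ← VectorField.pullback_lieBracket (n := ∞)
      (by rw [minSmoothness_of_isRCLikeNormedField]; exact WithTop.coe_le_coe.2 le_top)
      (h.symm.contDiffAt hy) ha hb,
    h.pushforward_eq_pullback _ hy]
  rfl

lemma IsLocalDiffeo.pushforward_symm (h : IsLocalDiffeo U V p q φ) (w : VField n) {y : Coord n}
    (hy : y ∈ φ.target) : pushforward φ (pushforward φ.symm w) =ᶠ[𝓝 y] w := by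
  filter_upwards [φ.open_target.mem_nhds hy] with z hz
  have h1 := h.fderiv_comp_symm hz (w z)
  simp only [pushforward, OpenPartialHomeomorph.symm_symm]
  rwa [φ.right_inv hz]

end Pushforward

/-- The local diffeomorphism maps `flag m c i` into `flag m d i`. -/
def MapsFlag {m : ℕ} (c d : ℝ) (φ : OpenPartialHomeomorph (Coord (m + 9)) (Coord (m + 9)))
    (i : ℕ) : Prop :=
  ∀ x ∈ φ.source, ∀ v ∈ flag m c i x, fderiv ℝ φ x v ∈ flag m d i (φ x)

section Naturality

variable {m : ℕ} {c d : ℝ} {U V : Set (Coord (m + 9))} {p q : Coord (m + 9)}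
  {φ : OpenPartialHomeomorph (Coord (m + 9)) (Coord (m + 9))}

lemma MapsFlag.pushforward_mem {i : ℕ} (h : MapsFlag c d φ i) {a : VField (m + 9)}
    (ha : ∀ x, a x ∈ flag m c i x) {y : Coord (m + 9)} (hy : y ∈ φ.target) :
    ∀ᶠ z in 𝓝 y, pushforward φ a z ∈ flag m d i z := by
  filter_upwards [φ.open_target.mem_nhds hy] with z hz
  have := h _ (φ.map_target hz) _ (ha (φ.symm z))
  rwa [φ.right_inv hz] at this

/-- The new generator is a bracket of two fields of the previous member, and the differential of φ
commutes with brackets. -/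
lemma MapsFlag.succ (hφ : IsLocalDiffeo U V p q φ) {i : ℕ} (hi : i ≤ m + 6)
    (h : MapsFlag c d φ i) : MapsFlag c d φ (i + 1) := by
  intro x hx v hv
  rw [← sub_add_cancel v (newCoeff m c i x v • newField m i x), map_add, map_smul]
  refine Submodule.add_mem _ (flag_le_flag_succ m d i _ (h x hx _ (sub_newField_mem_flag hi hv)))
    (Submodule.smul_mem _ _ ?_)
  have hy := φ.map_source hx
  have ha := mem_sections_univ.1 (unitVec_mem_sections (m := m) c (i := i) (k := m + 8 - i)
    (by omega) (sub_ne_flagRoot hi))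
  have hb := mem_sections_univ.1 (flagField_mem_sections m c i)
  have key := hφ.pushforward_lieBracket hy (ha.1.differentiable (by simp) _)
    (hb.1.differentiable (by simp) _)
  rw [φ.left_inv hx, lieBracket_flagField c hi] at key
  rw [← key]
  exact bracket_mem_flag_succ
    ((hφ.contDiffAt_pushforward hy ha.1.contDiffAt).differentiableAt (by simp))
    ((hφ.contDiffAt_pushforward hy hb.1.contDiffAt).differentiableAt (by simp))
    (h.pushforward_mem ha.2 hy) (h.pushforward_mem hb.2 hy)

lemma MapsFlag.of_zero (hφ : IsLocalDiffeo U V p q φ) (h : MapsFlag c d φ 0) :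
    ∀ i ≤ m + 7, MapsFlag c d φ i
  | 0, _ => h
  | i + 1, hi => (of_zero hφ h i (by omega)).succ hφ (by omega)

/-- Being characteristic is intrinsic: a test field on the target is pulled back, bracketed with the
constant field `a`, and the result is mapped forward again. This is why both φ and its inverse must
preserve the flag. -/
lemma MapsFlag.fderiv_mem_charFlag (hφ : IsLocalDiffeo U V p q φ) {i : ℕ} (hi : i ≤ m + 5)
    (h : MapsFlag c d φ (i + 1)) (h' : MapsFlag d c φ.symm (i + 1)) {x : Coord (m + 9)}
    (hx : x ∈ φ.source) {a : Coord (m + 9)} (ha : a ∈ charFlag m i) :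
    fderiv ℝ φ x a ∈ charFlag m i := by
  have hy := φ.map_source hx
  have key : pushforward φ (fun _ => a) (φ x) ∈ charFlag m i := by
    refine mem_charFlag_of_bracket_mem (c := d) hi
      ((hφ.contDiffAt_pushforward hy contDiffAt_const).differentiableAt (by simp))
      (h.pushforward_mem (fun y => charFlag_le_flag_succ c (by omega) y ha) hy) fun w hw => ?_
    obtain ⟨hw1, hw2⟩ := mem_sections_univ.1 hw
    have hx' : x ∈ φ.symm.target := hx
    have hwd : DifferentiableAt ℝ (pushforward φ.symm w) x :=
      (hφ.symm.contDiffAt_pushforward hx' hw1.contDiffAt).differentiableAt (by simp)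
    have e := hφ.pushforward_lieBracket (a := fun _ => a) (b := pushforward φ.symm w) hy
      (by fun_prop) (by rwa [φ.left_inv hx])
    rw [(Filter.EventuallyEq.refl _ _).lieBracket_vectorField_eq (hφ.pushforward_symm w hy),
      φ.left_inv hx] at e
    rw [e]
    exact h x hx _ (bracket_const_mem_flag (by omega) ha hwd (h'.pushforward_mem hw2 hx'))
  rwa [pushforward, φ.left_inv hx] at key

end Naturality

/-! ### Jets of functions of one variable -/

open Asymptotics Filter

lemma isBigO_of_hasDerivAt {E : Type*} [NormedAddCommGroup E] [NormedSpace ℝ E] {h h' : ℝ → E}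
    {k : ℕ} (hd : ∀ᶠ t in 𝓝 (0 : ℝ), HasDerivAt h (h' t) t) (h0 : h 0 = 0)
    (hb : h' =O[𝓝 0] fun t : ℝ => t ^ k) : h =O[𝓝 0] fun t : ℝ => t ^ (k + 1) := by
  obtain ⟨C, hC⟩ := hb.bound
  obtain ⟨ε, hε, H⟩ := Metric.eventually_nhds_iff.1 (hd.and hC)
  refine IsBigO.of_bound C (Metric.eventually_nhds_iff.2 ⟨ε, hε, fun t ht => ?_⟩)
  have hs (s : ℝ) (hs : s ∈ Metric.closedBall (0 : ℝ) |t|) : |s| ≤ |t| := by simpa using hs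
  have key := (convex_closedBall (0 : ℝ) |t|).norm_image_sub_le_of_norm_hasDerivWithin_le
    (f := h) (f' := h') (C := C * |t| ^ k) (x := 0) (y := t)
    (fun s hs' => (H (by simpa using (hs s hs').trans_lt (by simpa using ht))).1.hasDerivWithinAt)
    (fun s hs' => by
      have h1 := (H (y := s) (by simpa using (hs s hs').trans_lt (by simpa using ht))).2
      -- The constant from the O-bound need not be nonnegative; a negative one is possible only at t
      -- = 0.
      have hC0 : 0 ≤ C ∨ t = 0 := by
        by_contra! hcon
        have h2 := (H (y := t) ht).2
        rw [norm_pow, Real.norm_eq_abs] at h2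
        nlinarith [norm_nonneg (h' t), pow_pos (abs_pos.2 hcon.2) k]
      obtain hC0 | rfl := hC0
      · refine h1.trans ?_
        rw [norm_pow, Real.norm_eq_abs]
        exact mul_le_mul_of_nonneg_left (pow_le_pow_left₀ (abs_nonneg s) (hs s hs') k) hC0
      · have : s = 0 := by simpa using hs s hs'
        subst this
        simpa [norm_pow] using h1)
    (by simp) (by simp)
  rw [h0, sub_zero, sub_zero, Real.norm_eq_abs t] at key
  rw [norm_pow, Real.norm_eq_abs, pow_succ, ← mul_assoc]
  exact key

/-- The function `h` is `a t ^ k + b t ^ (k + 1) + O(t ^ (k + 2))` at `0`. -/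
def HasJet (k : ℕ) (a b : ℝ) (h : ℝ → ℝ) : Prop :=
  (fun t => h t - (a * t ^ k + b * t ^ (k + 1))) =O[𝓝 0] fun t : ℝ => t ^ (k + 2)

lemma isBigO_pow_of_le {k l : ℕ} (h : l ≤ k) :
    (fun t : ℝ => t ^ k) =O[𝓝 0] fun t : ℝ => t ^ l := by
  refine IsBigO.of_bound 1 ?_
  filter_upwards [Metric.closedBall_mem_nhds (0 : ℝ) one_pos] with t ht
  rw [one_mul, norm_pow, norm_pow]
  exact pow_le_pow_of_le_one (norm_nonneg t) (by simpa using ht) h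

lemma isBigO_const_mul_pow (a : ℝ) {k l : ℕ} (h : l ≤ k) :
    (fun t : ℝ => a * t ^ k) =O[𝓝 0] fun t : ℝ => t ^ l := (isBigO_pow_of_le h).const_mul_left a

lemma HasJet.isBigO {k : ℕ} {a b : ℝ} {h : ℝ → ℝ} (H : HasJet k a b h) :
    h =O[𝓝 0] fun t : ℝ => t ^ k := by
  have := (H.trans (isBigO_pow_of_le (show k ≤ k + 2 by omega))).add
    ((isBigO_const_mul_pow a le_rfl).add (isBigO_const_mul_pow b (show k ≤ k + 1 by omega)))
  simpa using this

lemma HasJet.mul {k l : ℕ} {a b a' b' : ℝ} {g h : ℝ → ℝ} (hg : HasJet k a b g)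
    (hh : HasJet l a' b' h) : HasJet (k + l) (a * a') (a * b' + b * a') fun t => g t * h t := by
  have e1 := IsBigO.mul hg hh.isBigO
  have e2 := ((isBigO_const_mul_pow a le_rfl).add
    (isBigO_const_mul_pow b (show k ≤ k + 1 by omega))).mul hh
  have e3 := isBigO_const_mul_pow (b * b') (le_refl (k + l + 2))
  have e4 : (fun t : ℝ => t ^ (k + 2) * t ^ l) = fun t => t ^ (k + l + 2) := by funext t; ring
  have e5 : (fun t : ℝ => t ^ k * t ^ (l + 2)) = fun t => t ^ (k + l + 2) := by funext t; ring
  rw [e4] at e1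
  rw [e5] at e2
  refine ((e1.add e2).add e3).congr_left fun t => ?_
  ring

lemma HasJet.of_hasDerivAt {k : ℕ} {a b : ℝ} {h h' : ℝ → ℝ} (hj : HasJet k a b h')
    (hd : ∀ᶠ t in 𝓝 (0 : ℝ), HasDerivAt h (h' t) t) (h0 : h 0 = 0) :
    HasJet (k + 1) (a / (k + 1)) (b / (k + 2)) h := by
  refine isBigO_of_hasDerivAt (h' := fun t => h' t - (a * t ^ k + b * t ^ (k + 1))) ?_
    (by simp [h0]) hj
  filter_upwards [hd] with t ht
  have h1 := (hasDerivAt_pow (k + 1) t).const_mul (a / (k + 1))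
  have h2 := (hasDerivAt_pow (k + 1 + 1) t).const_mul (b / (k + 2))
  refine (ht.sub (h1.add h2)).congr_deriv ?_
  have : (k : ℝ) + 1 ≠ 0 := by positivity
  have : (k : ℝ) + 2 ≠ 0 := by positivity
  have : (k : ℝ) + 1 + 1 = k + 2 := by ring
  push_cast
  rw [this]
  field_simp

lemma HasJet.one_add {a b : ℝ} {h : ℝ → ℝ} (hj : HasJet 1 a b h) :
    HasJet 0 1 a fun t => h t + 1 := by
  have := (hj.trans (isBigO_pow_of_le (show 2 ≤ 1 + 2 by omega))).add
    (isBigO_const_mul_pow b (le_refl 2))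
  refine this.congr_left fun t => ?_
  ring

lemma hasJet_of_contDiffAt {f : ℝ → ℝ} (hf : ContDiffAt ℝ 2 f 0) :
    HasJet 0 (f 0) (deriv f 0) f := by
  have hd : ∀ᶠ t in 𝓝 (0 : ℝ), HasDerivAt f (deriv f t) t := by
    filter_upwards [hf.eventually (by simp)] with t ht
    exact (ht.differentiableAt (by simp)).hasDerivAt
  have h1 : DifferentiableAt ℝ (deriv f) 0 := by
    have : ContDiffAt ℝ 1 (fderiv ℝ f) 0 := hf.fderiv_right (by norm_num)
    exact (this.differentiableAt (by simp)).clm_apply (differentiableAt_const 1)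
  have h2 := h1.hasDerivAt.isBigO_sub
  refine isBigO_of_hasDerivAt (h' := fun t => deriv f t - deriv f 0) ?_ (by simp)
    (by simpa using h2)
  filter_upwards [hd] with t ht
  have h3 : HasDerivAt (fun s => f 0 * s ^ 0 + deriv f 0 * s ^ (0 + 1)) (deriv f 0) t := by
    simpa using ((hasDerivAt_id t).const_mul (deriv f 0)).const_add (f 0)
  exact ht.sub h3

lemma eq_zero_of_isBigO {a : ℝ} {k : ℕ}
    (h : (fun t : ℝ => a * t ^ k) =O[𝓝 0] fun t : ℝ => t ^ (k + 1)) : a = 0 := by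
  have h1 : (fun t : ℝ => t ^ (k + 1)) =o[𝓝 0] fun t : ℝ => t ^ k := isLittleO_pow_pow (by omega)
  have h2 : (fun t : ℝ => a * t ^ k) =o[𝓝[≠] 0] fun t : ℝ => t ^ k :=
    (h.trans_isLittleO h1).mono nhdsWithin_le_nhds
  by_contra ha
  have h3 : (fun t : ℝ => t ^ k) =o[𝓝[≠] 0] fun t : ℝ => t ^ k :=
    (isLittleO_const_mul_left_iff ha).1 h2
  refine (isLittleO_irrefl ?_) h3
  apply Eventually.frequently
  filter_upwards [self_mem_nhdsWithin] with t ht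
  exact pow_ne_zero k ht

lemma eq_zero_of_isBigO_three {a b c : ℝ}
    (h : (fun t : ℝ => a * t ^ 3 + b * t ^ 4 + c * t ^ 5) =O[𝓝 0] fun t : ℝ => t ^ 6) :
    a = 0 ∧ b = 0 ∧ c = 0 := by
  have ha : a = 0 := eq_zero_of_isBigO (k := 3) <| by
    refine (((h.trans (isBigO_pow_of_le (show 4 ≤ 6 by omega))).sub
      (isBigO_const_mul_pow b (le_refl 4))).sub
      (isBigO_const_mul_pow c (show 4 ≤ 5 by omega))).congr_left fun t => ?_
    ring
  have hb : b = 0 := eq_zero_of_isBigO (k := 4) <| by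
    refine ((h.trans (isBigO_pow_of_le (show 5 ≤ 6 by omega))).sub
      (isBigO_const_mul_pow c (le_refl 5))).congr_left fun t => ?_
    rw [ha]; ring
  refine ⟨ha, hb, eq_zero_of_isBigO (k := 5) <| h.congr_left fun t => ?_⟩
  rw [ha, hb]; ring

/-- A function is affine up to order six along a curve that is tangent to `0` to third order. -/
lemma isBigO_comp_curve {n : ℕ} {g : Coord n → ℝ} (hg : ContDiffAt ℝ 2 g 0)
    {r r' : ℝ → Coord n} (hr : ∀ t, HasDerivAt r (r' t) t) (hr0 : r 0 = 0)
    (hr' : r' =O[𝓝 0] fun t : ℝ => t ^ 2) :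
    (fun t => g (r t) - g 0 - fderiv ℝ g 0 (r t)) =O[𝓝 0] fun t : ℝ => t ^ 6 := by
  have hr3 : r =O[𝓝 0] fun t : ℝ => t ^ 3 := isBigO_of_hasDerivAt (.of_forall hr) hr0 hr'
  have hrt : Tendsto r (𝓝 0) (𝓝 0) := by
    have := (hr 0).continuousAt.tendsto
    rwa [hr0] at this
  have h1 : (fun x => fderiv ℝ g x - fderiv ℝ g 0) =O[𝓝 0] fun x : Coord n => x := by
    have : ContDiffAt ℝ 1 (fderiv ℝ g) 0 := hg.fderiv_right (by norm_num)
    simpa using (this.differentiableAt (by simp)).hasFDerivAt.isBigO_sub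
  have h2 : (fun t => fderiv ℝ g (r t) - fderiv ℝ g 0) =O[𝓝 0] fun t : ℝ => t ^ 3 :=
    (h1.comp_tendsto hrt).trans hr3
  have h3 : (fun t => (fderiv ℝ g (r t) - fderiv ℝ g 0) (r' t)) =O[𝓝 0] fun t : ℝ => t ^ 5 := by
    have h4 : (fun t => (fderiv ℝ g (r t) - fderiv ℝ g 0) (r' t)) =O[𝓝 0]
        fun t => ‖fderiv ℝ g (r t) - fderiv ℝ g 0‖ * ‖r' t‖ :=
      IsBigO.of_bound 1 (.of_forall fun t => by
        simpa using (fderiv ℝ g (r t) - fderiv ℝ g 0).le_opNorm (r' t))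
    exact (h4.trans (h2.norm_left.mul hr'.norm_left)).congr_right fun t => by ring
  refine isBigO_of_hasDerivAt (h' := fun t => (fderiv ℝ g (r t) - fderiv ℝ g 0) (r' t)) ?_
    (by simp [hr0]) h3
  filter_upwards [hrt.eventually (hg.eventually (by simp))] with t ht
  have h5 := (ht.differentiableAt (by simp)).hasFDerivAt.comp_hasDerivAt t (hr t)
  have h6 := (fderiv ℝ g 0).hasFDerivAt.comp_hasDerivAt t (hr t)
  exact (h5.sub_const (g 0)).sub h6

/-! ### Nonequivalence -/

/-- The leading coefficients of the low components of the integral curve `towerCurve`. -/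
noncomputable def curveCoeff : ℕ → ℝ
  | 0 => 1 / 8
  | k + 1 => curveCoeff k / (2 * (7 + 3 * k))

/-- The components of `towerCurve`. -/
noncomputable def curveComp (m j : ℕ) (t : ℝ) : ℝ :=
  if j = 0 then t ^ 3 / 6
  else if j ≤ m + 3 then curveCoeff (m + 3 - j) * t ^ (4 + 3 * (m + 3 - j))
  else if j = m + 4 then t
  else if j = m + 5 then t ^ 2 / 2
  else if j = m + 6 then t
  else 0

/-- An integral curve of `tower m 0` through the origin. -/
noncomputable def towerCurve (m : ℕ) (t : ℝ) : Coord (m + 9) := fun j => curveComp m j t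

/-- The projection of `towerCurve` along `charFlag m 4`. -/
noncomputable def lowCurve (m : ℕ) (t : ℝ) : Coord (m + 9) :=
  fun j => if j.val ≤ m + 3 then curveComp m j t else 0

lemma coordL_towerCurve (m j : ℕ) (t : ℝ) : coordL j (towerCurve m t) = curveComp m j t := by
  by_cases hj : j < m + 9
  · rw [coordL_apply hj]; rfl
  · rw [coordL_of_le (by omega)]
    simp [curveComp, show j ≠ 0 by omega, show ¬ j ≤ m + 3 by omega, show j ≠ m + 4 by omega,
      show j ≠ m + 5 by omega, show j ≠ m + 6 by omega]

lemma coordL_lowCurve (m j : ℕ) (t : ℝ) :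
    coordL j (lowCurve m t) = if j ≤ m + 3 then curveComp m j t else 0 := by
  by_cases hj : j < m + 9
  · rw [coordL_apply hj]; rfl
  · rw [coordL_of_le (by omega), if_neg (by omega)]

lemma hasDerivAt_curveComp (m j : ℕ) (t : ℝ) :
    HasDerivAt (curveComp m j) (towerComp m 0 j (towerCurve m t)) t := by
  unfold towerComp
  simp only [coordL_towerCurve]
  have h5 : curveComp m (m + 5) t = t ^ 2 / 2 := by simp [curveComp]
  rw [h5]
  by_cases h0 : j = 0
  · have e : curveComp m j = fun t => t ^ 3 / 6 := by funext s; simp [curveComp, h0]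
    rw [e, if_pos h0]
    exact ((hasDerivAt_pow 3 t).div_const 6).congr_deriv (by norm_num; ring)
  rw [if_neg h0]
  by_cases h3 : j ≤ m + 3
  · rw [if_pos h3]
    have e : curveComp m j = fun t => curveCoeff (m + 3 - j) * t ^ (4 + 3 * (m + 3 - j)) := by
      funext s; simp [curveComp, h0, h3]
    rw [e]
    refine ((hasDerivAt_pow _ t).const_mul _).congr_deriv ?_
    obtain ⟨k, hk⟩ := Nat.exists_eq_add_of_le h3
    obtain rfl | k := k
    · rw [show j = m + 3 by omega]
      simp [curveComp, curveCoeff]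
      ring
    · rw [curveComp, if_neg (by omega), if_pos (by omega), show m + 3 - j = k + 1 by omega,
        show m + 3 - (j + 1) = k by omega, curveCoeff]
      have : (7 : ℝ) + 3 * k ≠ 0 := by positivity
      rw [show 4 + 3 * (k + 1) - 1 = 2 + (4 + 3 * k) by omega, pow_add t 2]
      push_cast
      field_simp
      ring
  rw [if_neg h3]
  by_cases h4 : j = m + 4
  · have e : curveComp m j = fun t => t := by funext s; simp [curveComp, h4]
    rw [e, if_pos h4]
    exact hasDerivAt_id t
  rw [if_neg h4]
  by_cases h6 : j = m + 6
  · have e : curveComp m j = fun t => t := by funext s; simp [curveComp, h6]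
    rw [e, if_pos h6, h6]
    exact (hasDerivAt_id t).congr_deriv (by simp [curveComp])
  rw [if_neg h6]
  by_cases h5' : j = m + 5
  · have e : curveComp m j = fun t => t ^ 2 / 2 := by funext s; simp [curveComp, h5']
    rw [e, h5', if_neg (by omega)]
    refine ((hasDerivAt_pow 2 t).div_const 2).congr_deriv ?_
    simp [curveComp]
  have e : curveComp m j = fun t => 0 := by
    funext s; simp [curveComp, h0, h3, h4, h5', h6]
  have e1 : curveComp m (j + 1) t = 0 := by
    simp [curveComp, show ¬ j + 1 ≤ m + 3 by omega, show j ≠ m + 3 by omega, h4, h5']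
  rw [e, e1]
  simpa using hasDerivAt_const t (0 : ℝ)

lemma hasDerivAt_towerCurve (m : ℕ) (t : ℝ) :
    HasDerivAt (towerCurve m) (tower m 0 (towerCurve m t)) t :=
  hasDerivAt_pi.2 fun j => hasDerivAt_curveComp m j t

lemma contDiff_towerCurve (m : ℕ) : ContDiff ℝ ∞ (towerCurve m) := by
  refine contDiff_pi.2 fun j => ?_
  unfold towerCurve curveComp
  split_ifs <;> fun_prop

lemma towerCurve_zero (m : ℕ) : towerCurve m 0 = 0 := by
  funext j
  simp [towerCurve, curveComp]

lemma lowCurve_zero (m : ℕ) : lowCurve m 0 = 0 := by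
  funext j
  simp [lowCurve, curveComp]

lemma hasDerivAt_lowCurve (m : ℕ) (t : ℝ) : HasDerivAt (lowCurve m)
    (fun j => if j.val ≤ m + 3 then towerComp m 0 j (towerCurve m t) else 0) t := by
  refine hasDerivAt_pi.2 fun j => ?_
  by_cases hj : j.val ≤ m + 3
  · simpa [lowCurve, hj] using hasDerivAt_curveComp m j t
  · simpa [lowCurve, hj] using hasDerivAt_const t (0 : ℝ)

lemma isBigO_deriv_lowCurve (m : ℕ) :
    (fun t (j : Fin (m + 9)) => if j.val ≤ m + 3 then towerComp m 0 j (towerCurve m t) else 0)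
      =O[𝓝 0] fun t : ℝ => t ^ 2 := by
  refine isBigO_pi.2 fun j => ?_
  by_cases hj : j.val ≤ m + 3
  · simp only [hj, if_true]
    have h5 (t : ℝ) : curveComp m (m + 5) t = t ^ 2 / 2 := by simp [curveComp]
    by_cases h0 : j.val = 0
    · simp only [towerComp, h0, if_true, coordL_towerCurve, h5]
      simpa [div_eq_inv_mul] using isBigO_const_mul_pow (2⁻¹ : ℝ) (le_refl 2)
    · simp only [towerComp, h0, hj, if_true, if_false, coordL_towerCurve, h5]
      have hb : curveComp m (j + 1) =O[𝓝 0] fun _ => (1 : ℝ) :=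
        (hasDerivAt_curveComp m (j + 1) 0).continuousAt.tendsto.isBigO_one ℝ
      have := (isBigO_const_mul_pow (2⁻¹ : ℝ) (le_refl 2)).mul hb
      simpa [div_eq_inv_mul] using this
  · simpa [hj] using isBigO_zero _ _

/-- A linear form along the projected curve. -/
lemma isBigO_apply_lowCurve (m : ℕ) (T : Coord (m + 9) →L[ℝ] ℝ) :
    (fun t => T (lowCurve m t) - (T (unitVec 0) / 6 * t ^ 3 + T (unitVec (m + 3)) / 8 * t ^ 4))
      =O[𝓝 0] fun t : ℝ => t ^ 6 := by
  -- Beyond components 0 and m+3 the powers of t are 7, 10, …, which are invisible modulo t⁶.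
  have e (t : ℝ) : lowCurve m t - ((t ^ 3 / 6) • unitVec 0 + (t ^ 4 / 8) • unitVec (m + 3)) =
      fun j : Fin (m + 9) => if j.val = 0 ∨ m + 3 ≤ j.val then 0 else
        curveCoeff (m + 3 - j) * t ^ (4 + 3 * (m + 3 - j)) := by
    funext j
    simp only [Pi.sub_apply, Pi.add_apply, Pi.smul_apply, lowCurve, unitVec, smul_eq_mul,
      curveComp]
    obtain h | h | h | h : j.val = 0 ∨ j.val = m + 3 ∨ m + 3 < j.val ∨ (j.val ≠ 0 ∧ j.val < m + 3) :=
      by omega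
    · simp [h]
    · simp [h, curveCoeff]
      ring
    · simp [show ¬ j.val ≤ m + 3 by omega, show j.val ≠ 0 by omega, show m + 3 ≤ j.val by omega,
        show j.val ≠ m + 3 by omega]
    · simp [show j.val ≤ m + 3 by omega, h.1, show ¬ m + 3 ≤ j.val by omega,
        show j.val ≠ m + 3 by omega]
  have hb : (fun t => lowCurve m t - ((t ^ 3 / 6) • unitVec 0 + (t ^ 4 / 8) • unitVec (m + 3)))
      =O[𝓝 0] fun t : ℝ => t ^ 6 := by
    simp only [e]
    refine isBigO_pi.2 fun j => ?_
    by_cases h : j.val = 0 ∨ m + 3 ≤ j.val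
    · simp only [if_pos h]
      exact isBigO_zero _ _
    · simp only [h, if_false]
      exact isBigO_const_mul_pow _ (by omega)
  refine ((T.isBigO_comp _ _).trans hb).congr_left fun t => ?_
  simp only [map_sub, map_add, map_smul, smul_eq_mul]
  ring

/-- A function annihilated by `charFlag m 4` near the origin has the same values on both curves. -/
lemma eventually_comp_towerCurve_eq {m : ℕ} {g : Coord (m + 9) → ℝ} {s : Set (Coord (m + 9))}
    (hs : s ∈ 𝓝 (0 : Coord (m + 9))) (hg : ∀ x ∈ s, DifferentiableAt ℝ g x)
    (h : ∀ x ∈ s, ∀ a ∈ charFlag m 4, fderiv ℝ g x a = 0) :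
    ∀ᶠ t in 𝓝 (0 : ℝ), g (towerCurve m t) = g (lowCurve m t) := by
  obtain ⟨ε, hε, hball⟩ := Metric.mem_nhds_iff.1 hs
  have h1 := (hasDerivAt_towerCurve m 0).continuousAt.tendsto
  have h2 := (hasDerivAt_lowCurve m 0).continuousAt.tendsto
  rw [towerCurve_zero] at h1
  rw [lowCurve_zero] at h2
  filter_upwards [h1.eventually (Metric.ball_mem_nhds _ hε),
    h2.eventually (Metric.ball_mem_nhds _ hε)] with t ht1 ht2
  -- The two curves differ by a vector of `charFlag m 4`, so g is constant on the segment joining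
  -- them.
  have ha : towerCurve m t - lowCurve m t ∈ charFlag m 4 := fun j hj => by
    rw [map_sub, coordL_towerCurve, coordL_lowCurve, if_pos (by omega), sub_self]
  have hd (u : ℝ) (hu : u ∈ Icc (0 : ℝ) 1) : HasDerivWithinAt
      (fun u : ℝ => g (lowCurve m t + u • (towerCurve m t - lowCurve m t))) 0 (Icc 0 1) u := by
    have hx : lowCurve m t + u • (towerCurve m t - lowCurve m t) ∈ s :=
      hball ((convex_ball _ _).add_smul_sub_mem ht2 ht1 hu)
    have hl : HasDerivAt (fun u : ℝ => lowCurve m t + u • (towerCurve m t - lowCurve m t))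
        (towerCurve m t - lowCurve m t) u := by
      simpa using ((hasDerivAt_id u).smul_const (towerCurve m t - lowCurve m t)).const_add
        (lowCurve m t)
    have := (hg _ hx).hasFDerivAt.comp_hasDerivAt u hl
    rw [h _ hx _ ha] at this
    exact this.hasDerivWithinAt
  have key := (convex_Icc (0 : ℝ) 1).norm_image_sub_le_of_norm_hasDerivWithin_le (C := 0) hd
    (by simp) (left_mem_Icc.2 zero_le_one) (right_mem_Icc.2 zero_le_one)
  rw [zero_mul] at key
  have := sub_eq_zero.1 (norm_le_zero_iff.1 key)
  simpa using this

/-- The expansion along the curve of a function annihilated by `charFlag m 4`. -/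
lemma isBigO_comp_towerCurve {m : ℕ} {g : Coord (m + 9) → ℝ} {s : Set (Coord (m + 9))}
    (hs : s ∈ 𝓝 (0 : Coord (m + 9))) (hg : ∀ x ∈ s, ContDiffAt ℝ 2 g x)
    (h : ∀ x ∈ s, ∀ a ∈ charFlag m 4, fderiv ℝ g x a = 0) (h0 : g 0 = 0) :
    (fun t => g (towerCurve m t) - (fderiv ℝ g 0 (unitVec 0) / 6 * t ^ 3 +
      fderiv ℝ g 0 (unitVec (m + 3)) / 8 * t ^ 4)) =O[𝓝 0] fun t : ℝ => t ^ 6 := by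
  have h1 := isBigO_comp_curve (hg 0 (mem_of_mem_nhds hs)) (hasDerivAt_lowCurve m)
    (lowCurve_zero m) (isBigO_deriv_lowCurve m)
  have h2 := h1.add (isBigO_apply_lowCurve m (fderiv ℝ g 0))
  refine h2.congr' ?_ EventuallyEq.rfl
  filter_upwards [eventually_comp_towerCurve_eq hs
    (fun x hx => (hg x hx).differentiableAt (by simp)) h] with t ht
  rw [ht, h0]
  ring

/-! ### Transport by an equivalence and the contradiction between jets. -/

lemma mapsFlag_zero_of_map_eq {m : ℕ} {c d : ℝ}
    {φ : OpenPartialHomeomorph (Coord (m + 9)) (Coord (m + 9))}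
    (h : ∀ x ∈ φ.source, (flag m c 0 x).map (fderiv ℝ φ x).toLinearMap = flag m d 0 (φ x)) :
    MapsFlag c d φ 0 := fun x hx v hv => by
  rw [← h x hx]
  exact Submodule.mem_map_of_mem hv

lemma mapsFlag_zero_symm_of_map_eq {m : ℕ} {c d : ℝ} {U V : Set (Coord (m + 9))}
    {p q : Coord (m + 9)} {φ : OpenPartialHomeomorph (Coord (m + 9)) (Coord (m + 9))}
    (hφ : IsLocalDiffeo U V p q φ)
    (h : ∀ x ∈ φ.source, (flag m c 0 x).map (fderiv ℝ φ x).toLinearMap = flag m d 0 (φ x)) :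
    MapsFlag d c φ.symm 0 := fun y hy w hw => by
  have hx := φ.map_target hy
  have e := h _ hx
  rw [φ.right_inv hy] at e
  rw [← e] at hw
  obtain ⟨v, hv, rfl⟩ := Submodule.mem_map.1 hw
  have := hφ.fderiv_symm_comp hx v
  rw [φ.right_inv hy] at this
  rw [ContinuousLinearMap.coe_coe, this]
  exact hv

lemma fderiv_coordL_comp {n : ℕ} {φ : Coord n → Coord n} {x : Coord n}
    (h : DifferentiableAt ℝ φ x) (j : ℕ) (a : Coord n) :
    fderiv ℝ (fun y => coordL j (φ y)) x a = coordL j (fderiv ℝ φ x a) := by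
  have := ((coordL (n := n) j).hasFDerivAt.comp x h.hasFDerivAt).fderiv
  exact congrArg (fun T => T a) this

/-- The jets of an integral curve of `tower m 1` reparametrized with speed `f`. -/
lemma hasJet_of_reparametrized {m : ℕ} {h : ℕ → ℝ → ℝ} {f : ℝ → ℝ} {f₀ f₁ : ℝ}
    (hf : HasJet 0 f₀ f₁ f) (h8 : ContDiffAt ℝ 2 (h (m + 8)) 0) (h0 : ∀ j, h j 0 = 0)
    (hz : ∀ᶠ t in 𝓝 (0 : ℝ), HasDerivAt (h 0) (f t * h (m + 5) t) t)
    (h3 : ∀ᶠ t in 𝓝 (0 : ℝ), HasDerivAt (h (m + 3)) (f t * (h (m + 5) t * h (m + 4) t)) t)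
    (h4 : ∀ᶠ t in 𝓝 (0 : ℝ), HasDerivAt (h (m + 4)) (f t) t)
    (h5 : ∀ᶠ t in 𝓝 (0 : ℝ), HasDerivAt (h (m + 5)) (f t * h (m + 6) t) t)
    (h6 : ∀ᶠ t in 𝓝 (0 : ℝ), HasDerivAt (h (m + 6)) (f t * (h (m + 7) t + 1)) t)
    (h7 : ∀ᶠ t in 𝓝 (0 : ℝ), HasDerivAt (h (m + 7)) (f t * (h (m + 8) t + 1)) t) :
    HasJet 3 (f₀ ^ 3 / 6) ((f₀ ^ 4 / 6 + f₀ ^ 2 * f₁) / 4) (h 0) ∧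
      HasJet 4 (f₀ ^ 4 / 8) ((f₀ ^ 5 / 6 + 5 / 4 * f₀ ^ 3 * f₁) / 5) (h (m + 3)) := by
  -- Only h_{m+8}(0) = 0 matters: its unknown slope enters the second coefficient of `j7`, which
  -- `one_add` discards. The summand 1 is the parameter c = 1.
  have j8 := hasJet_of_contDiffAt (h8.add (contDiffAt_const (c := (1 : ℝ))))
  have j7 := (hf.mul j8).of_hasDerivAt (by simpa using h7) (h0 _)
  have j6 := (hf.mul j7.one_add).of_hasDerivAt h6 (h0 _)
  have j5 := (hf.mul j6).of_hasDerivAt h5 (h0 _)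
  have j4 := hf.of_hasDerivAt h4 (h0 _)
  have j0 := (hf.mul j5).of_hasDerivAt hz (h0 _)
  have j3 := (hf.mul (j5.mul j4)).of_hasDerivAt h3 (h0 _)
  simp only [h0] at j0 j3
  constructor
  · convert j0 using 1 <;> push_cast <;> ring
  · convert j3 using 1 <;> push_cast <;> ring

/-- Two expansions of φ along one integral curve are compared: one uses that φ preserves
characteristic directions, the other that the image curve is tangent to the second structure. -/
theorem not_locallyEquivalent_flag (m : ℕ) :
    ¬ LocallyEquivalent univ (flag m 0 0) 0 univ (flag m 1 0) 0 := by
  rintro ⟨φ, hφ, hmap⟩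
  have hM := mapsFlag_zero_of_map_eq hmap
  have hN := mapsFlag_zero_symm_of_map_eq hφ hmap
  have hMs := hM.of_zero hφ
  have hNs := hN.of_zero hφ.symm
  have hchar {i : ℕ} (hi : i ≤ 5) {x a : Coord (m + 9)} (hx : x ∈ φ.source)
      (ha : a ∈ charFlag m i) : fderiv ℝ φ x a ∈ charFlag m i :=
    (hMs (i + 1) (by omega)).fderiv_mem_charFlag hφ (by omega) (hNs (i + 1) (by omega)) hx ha
  have hdiff {x : Coord (m + 9)} (hx : x ∈ φ.source) : DifferentiableAt ℝ φ x :=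
    (hφ.contDiffAt hx).differentiableAt (by simp)
  have hγ : Tendsto (towerCurve m) (𝓝 0) (𝓝 0) := by
    have := (contDiff_towerCurve m).continuous.tendsto 0
    rwa [towerCurve_zero] at this
  have hsrc : ∀ᶠ t in 𝓝 (0 : ℝ), towerCurve m t ∈ φ.source :=
    hγ.eventually (φ.open_source.mem_nhds hφ.mem_source)
  set w : ℝ → Coord (m + 9) := fun t =>
    fderiv ℝ φ (towerCurve m t) (tower m 0 (towerCurve m t)) with hw
  set f : ℝ → ℝ := fun t => coordL (m + 4) (w t) with hf
  set h : ℕ → ℝ → ℝ := fun j t => coordL j (φ (towerCurve m t)) with hh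
  have hφ0 : ContDiffAt ℝ ∞ φ (towerCurve m 0) := by
    rw [towerCurve_zero]; exact hφ.contDiffAt hφ.mem_source
  have hfs : ContDiffAt ℝ ∞ f 0 := by
    have h1 : ContDiffAt ℝ ∞ (fderiv ℝ φ) (towerCurve m 0) := hφ0.fderiv_right (by simp)
    have h2 := (h1.comp 0 (contDiff_towerCurve m).contDiffAt).clm_apply
      ((contDiff_tower m 0).comp (contDiff_towerCurve m)).contDiffAt
    exact (coordL (m + 4)).contDiff.contDiffAt.comp 0 h2
  have hhs (j : ℕ) : ContDiffAt ℝ ∞ (h j) 0 :=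
    (coordL j).contDiff.contDiffAt.comp 0 (hφ0.comp 0 (contDiff_towerCurve m).contDiffAt)
  have hder (j : ℕ) : ∀ᶠ t in 𝓝 (0 : ℝ), HasDerivAt (h j) (coordL j (w t)) t := by
    filter_upwards [hsrc] with t ht
    exact (coordL j).hasFDerivAt.comp_hasDerivAt t
      ((hdiff ht).hasFDerivAt.comp_hasDerivAt t (hasDerivAt_towerCurve m t))
  have hmem {t : ℝ} (ht : towerCurve m t ∈ φ.source) : w t ∈ flag m 1 0 (φ (towerCurve m t)) :=
    hM _ ht _ (flagField_mem m 0 0 _)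
  have hcomp {j : ℕ} (hj : j ≤ m + 7) : ∀ᶠ t in 𝓝 (0 : ℝ),
      HasDerivAt (h j) (f t * towerComp m 1 j (φ (towerCurve m t))) t := by
    filter_upwards [hder j, hsrc] with t ht hs
    rw [(hmem hs j hj : coordL j (w t) = _)] at ht
    exact ht
  have hh0 (j : ℕ) : h j 0 = 0 := by
    simp [hh, towerCurve_zero, hφ.map_point]
  have h0src : (0 : Coord (m + 9)) ∈ φ.source := hφ.mem_source
  -- the speed does not vanish
  have hf0 : f 0 ≠ 0 := by
    intro hf0
    -- With zero speed the image of Y at 0 would be characteristic; pulled back, Y itself would lie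
    -- in `charFlag m 3`, but its component m+4 is 1.
    have hwm : w 0 ∈ charFlag m 3 := fun j hj => by
      rw [hmem (by rwa [towerCurve_zero]) j (by omega)]
      exact mul_eq_zero_of_left hf0 _
    have h1 := (hNs 4 (by omega)).fderiv_mem_charFlag hφ.symm (by omega)
      (by simpa using hMs 4 (by omega)) (φ.map_source h0src)
      (a := w 0) hwm
    have h2 := hφ.fderiv_symm_comp h0src (tower m 0 0)
    simp only [hw, towerCurve_zero] at h1
    rw [h2] at h1
    have h3 := h1 (m + 4) (by omega)
    rw [coordL_tower] at h3
    simp [towerComp] at h3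
  -- jets
  obtain ⟨J0, J3⟩ := hasJet_of_reparametrized (m := m) (h := h)
    (hasJet_of_contDiffAt (hfs.of_le (WithTop.coe_le_coe.2 le_top)))
    ((hhs (m + 8)).of_le (WithTop.coe_le_coe.2 le_top)) hh0
    (by simpa [towerComp] using hcomp (j := 0) (by omega))
    (by simpa [towerComp] using hcomp (j := m + 3) (by omega))
    (by simpa [towerComp] using hcomp (j := m + 4) (by omega))
    (by simpa [towerComp] using hcomp (j := m + 5) (by omega))
    (by simpa [towerComp] using hcomp (j := m + 6) (by omega))
    (by simpa [towerComp] using hcomp (j := m + 7) (by omega))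
  -- expansions
  have hexp {j : ℕ} (hj : j ≤ m + 3) := isBigO_comp_towerCurve (m := m)
    (g := fun y => coordL j (φ y)) (φ.open_source.mem_nhds h0src)
    (fun x hx => (coordL j).contDiff.contDiffAt.comp x
      ((hφ.contDiffAt hx).of_le (WithTop.coe_le_coe.2 le_top)))
    (fun x hx a ha => by
      rw [fderiv_coordL_comp (hdiff hx)]
      exact hchar (by omega) hx ha j (by omega)) (by simp [hφ.map_point])
  -- Since ∂_{m+3} lies in `charFlag m 5`, its image has no component 0; this removes the t⁴ term of
  -- φ_0.
  have hz : fderiv ℝ (fun y => coordL 0 (φ y)) 0 (unitVec (m + 3)) = 0 := by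
    rw [fderiv_coordL_comp (hdiff h0src)]
    exact hchar le_rfl h0src (unitVec_mem_charFlag (by omega)) 0 (by omega)
  have E0 := hexp (j := 0) (by omega)
  have E3 := hexp (j := m + 3) le_rfl
  rw [hz] at E0
  have e1 : (f 0 ^ 4 / 6 + f 0 ^ 2 * deriv f 0) / 4 = 0 := by
    have h1 := (E0.trans (isBigO_pow_of_le (show 5 ≤ 6 by omega))).sub J0
    have h2 : f 0 ^ 3 / 6 - fderiv ℝ (fun y => coordL 0 (φ y)) 0 (unitVec 0) / 6 = 0 :=
      eq_zero_of_isBigO (k := 3) <| by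
        refine ((h1.trans (isBigO_pow_of_le (show 4 ≤ 5 by omega))).sub (isBigO_const_mul_pow
          ((f 0 ^ 4 / 6 + f 0 ^ 2 * deriv f 0) / 4) (le_refl 4))).congr_left fun t => ?_
        simp only [hh]
        ring
    refine eq_zero_of_isBigO (k := 4) (h1.congr_left fun t => ?_)
    simp only [hh]
    linear_combination t ^ 3 * h2
  -- A linear form of the low curve contributes only t³ and t⁴, and quadratic terms start at t⁶, so
  -- the t⁵ coefficient must vanish.
  have e2 : (f 0 ^ 5 / 6 + 5 / 4 * f 0 ^ 3 * deriv f 0) / 5 = 0 := by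
    refine (eq_zero_of_isBigO_three
      (a := -(fderiv ℝ (fun y => coordL (m + 3) (φ y)) 0 (unitVec 0) / 6))
      (b := f 0 ^ 4 / 8 - fderiv ℝ (fun y => coordL (m + 3) (φ y)) 0 (unitVec (m + 3)) / 8)
      ((E3.sub J3).congr_left fun t => ?_)).2.2
    simp only [hh]
    ring
  -- The combination eliminates f₁ and leaves (5 - 4) f₀⁵.
  have : f 0 ^ 5 = 0 := by linear_combination 120 * f 0 * e1 - 120 * e2
  exact hf0 (by simpa using this)

end Goursat

/-- Two Kumpera–Ruiz normal forms on `ℝ⁹` with the same singularity type, the same growth vector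
and diffeomorphic abnormal curves of all elements of the derived flag, that are not locally
equivalent at `0`; and for every `n ≥ 9` Goursat structures in dimension `n` are not determined by
the abnormal curves of their derived flags. -/
theorem mainTheorem8 :
    (∀ c : ℝ, c = 0 ∨ c = 1 →
      Goursat.IsKumperaRuiz 9 Goursat.kappa9Fst (Goursat.kappa9Snd c) ∧
      Goursat.IsGoursat Set.univ (Goursat.dist9 c) ∧
      Goursat.IsCompletelyNonholonomic Set.univ (Goursat.dist9 c) ∧
      Goursat.singularityType Set.univ (Goursat.dist9 c) 0 = [0, 0, 1, 2, 0, 0]) ∧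
    ¬ Goursat.LocallyEquivalent Set.univ (Goursat.dist9 0) 0 Set.univ (Goursat.dist9 1) 0 ∧
    Goursat.growthVector Set.univ (Goursat.dist9 0) 0 =
      Goursat.growthVector Set.univ (Goursat.dist9 1) 0 ∧
    Goursat.HaveDiffeomorphicAbnormals Set.univ (Goursat.dist9 0) 0
      Set.univ (Goursat.dist9 1) 0 ∧
    ∀ n : ℕ, 9 ≤ n →
      ¬ Goursat.DeterminedByAbnormalsOfDerivedFlag (n := n) Goursat.IsGoursat := by
  simp only [Goursat.dist9_eq_flag]
  refine ⟨fun c _ => ⟨Goursat.isKumperaRuiz_kappa9 c, Goursat.isGoursat_flag 0 c,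
    Goursat.isCompletelyNonholonomic_flag c, Goursat.singularityType_flag c⟩,
    Goursat.not_locallyEquivalent_flag 0, Goursat.growthVector_flag 1,
    Goursat.haveDiffeomorphicAbnormals_flag 0 0 1, fun n hn h => ?_⟩
  obtain ⟨m, rfl⟩ := Nat.exists_eq_add_of_le' hn
  exact Goursat.not_locallyEquivalent_flag m
    (h univ univ _ _ (Goursat.isGoursat_flag m 0) (Goursat.isGoursat_flag m 1) 0 (mem_univ _) 0
      (mem_univ _) (Goursat.haveDiffeomorphicAbnormals_flag m 0 1))
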